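/- **Theorem (Basic comparison principle).** Let $\Omega\subset\mathbb R^n$ ($n\ge 1$) be a bounded Lipschitz domain with exterior $\Omega_e=\mathbb R^n\setminus\overline\Omega$, let $T>0$, $0<s<1$, $m>1$, and write $A_T=A\times(0,T)$ and $\Phi^m(t)=|t|^{m-1}t$. Let $K\colon\mathbb R^n\times\mathbb R^n\to\mathbb R$ be measurable with $K(x,y)=K(y,x)$ and $\lambda\le K(x,y)\le\Lambda$ for all $x,y$ and some constants $0<\lambda\le\Lambda<\infty$; let $L_K$ be the associated integro-differential operator of order $2s$, with bilinear form $$B_K(u,v)=\int_{\mathbb R^{2n}}K(x,y)\frac{(u(x)-u(y))(v(x)-v(y))}{|x-y|^{n+2s}}\,dx\,dy .$$ Let $H^s(\mathbb R^n)$ be the fractional Sobolev space with its Gagliardo norm and $\widetilde H^s(\Omega)$ the closure of $C_c^\infty(\Omega)$ in it. Functions in $C_c([0,T]\times\Omega_e)$ are extended by zero to $[0,T]\times\mathbb R^n$. For $\Phi\colon\mathbb R\to\mathbb R$, *data* for $\Phi$ are a triple $(F,\varphi,u_0)$ with $F\in L^2(\Omega_T)$, $\varphi\in C_c([0,T]\times\Omega_e)$,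 $\Phi(\varphi)\in L^2(0,T;H^s(\mathbb R^n))$ and $u_0\in L^\infty(\Omega)\cap\widetilde H^s(\Omega)$. A function $u\colon\mathbb R^n\times(0,T)\to\mathbb R$ is a (weak) solution of $$\partial_tu+L_K(\Phi(u))=F\ \text{in }\Omega_T,\qquad u=\varphi\ \text{in }(\Omega_e)_T,\qquad u(0)=u_0\ \text{in }\Omega \tag{$P_\Phi(F,\varphi,u_0)$}$$ if $\Phi(u)\in L^2(0,T;H^s(\mathbb R^n))$, $\Phi(u-\varphi)\in L^2(0,T;\widetilde H^s(\Omega))$ and, for all $\psi\in C_c^\infty([0,T)\times\Omega)$, $$-\int_{\Omega_T}u\,\partial_t\psi\,dx\,dt+\int_0^TB_K(\Phi(u),\psi)\,dt=\int_{\Omega_T}F\psi\,dx\,dt+\int_\Omega u_0\psi(0)\,dx .$$ Then there is a constant $C>0$, depending only on $n,\Omega,T,s,m,K$, such that the following holds. Let $\Phi_\varepsilon^m\colon\mathbb R\to\mathbb R$ ($\varepsilon>0$ small) be any family of odd $C^1$ functions with $c_\varepsilon\le(\Phi_\varepsilon^m)'\le C_\varepsilon$ for some constants $0<c_\varepsilon\le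 C_\varepsilon<\infty$ and with $\Phi_\varepsilon^m\to\Phi^m$ uniformly on compact sets as $\varepsilon\to0$. For $j=1,2$ let $(F_j,\varphi_j,u_{0,j})$ be data for $\Phi^m$ and let $u_j$ be a solution of $P_{\Phi^m}(F_j,\varphi_j,u_{0,j})$. Suppose that for all small $\varepsilon>0$ there are data $(F_j^\varepsilon,\varphi_j^\varepsilon,u_{0,j}^\varepsilon)$ for $\Phi_\varepsilon^m$ and functions $u_{j,\varepsilon}\in H^1(0,T;L^2(\Omega))\cap L^2(0,T;H^s(\mathbb R^n))$, $j=1,2$, such that 1. $\liminf_{\varepsilon\to0}\int_{\Omega_T}(F_1^\varepsilon-F_2^\varepsilon)_+\,dx\,dt\le\int_{\Omega_T}(F_1-F_2)_+\,dx\,dt$; 2. $\displaystyle\liminf_{\varepsilon\to0}\int_0^T\!\!\int_{\Omega}\int_{\Omega_e}\frac{(\Phi_\varepsilon^m(\varphi_1^\varepsilon)-\Phi_\varepsilon^m(\varphi_2^\varepsilon))_+(x,t)}{|x-y|^{n+2s}}\,dx\,dy\,dt\le\int_0^T\!\!\int_{\Omega}\int_{\Omega_e}\frac{(\Phi^m(\varphi_1)-\Phi^m(\varphi_2))_+(x,t)}{|x-y|^{n+2s}}\,dx\,dy\,dt$;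 3. $u_{0,j}^\varepsilon\to u_{0,j}$ in $L^1(\Omega)$ as $\varepsilon\to0$; 4. $u_{j,\varepsilon}\rightharpoonup u_j$ weakly in $L^1(\Omega_T)$ as $\varepsilon\to0$; 5. $u_{j,\varepsilon}$ is a solution of $P_{\Phi_\varepsilon^m}(F_j^\varepsilon,\varphi_j^\varepsilon,u_{0,j}^\varepsilon)$. Then, for almost every $t_0\in(0,T)$, $$\int_\Omega(u_1-u_2)_+(x,t_0)\,dx\le C\left(\int_{\Omega_T}(F_1-F_2)_+\,dx\,dt+\int_\Omega(u_{0,1}-u_{0,2})_+\,dx+\int_0^T\!\!\int_{\Omega}\int_{\Omega_e}\frac{(\Phi^m(\varphi_1)-\Phi^m(\varphi_2))_+(x,t)}{|x-y|^{n+2s}}\,dx\,dy\,dt\right).$$ -/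

import Mathlib

open MeasureTheory Set Filter Topology
open scoped ContDiff ENNReal NNReal

namespace NPME

/-- The Euclidean space `ℝⁿ`. -/
abbrev Rn (n : ℕ) : Type := EuclideanSpace ℝ (Fin n)

/-- A bounded open set whose boundary is locally the graph of a Lipschitz function: near every
boundary point there is a direction `e` such that, in a ball around that point, the set is the
strict epigraph in direction `e` of a Lipschitz function of the component orthogonal to `e`. -/
structure IsBoundedLipschitz {n : ℕ} (Ω : Set (Rn n)) : Prop where
  isOpen : IsOpen Ω
  isBounded : Bornology.IsBounded Ω
  lipschitz_boundary : ∀ x₀ ∈ frontier Ω, ∃ e : Rn n, ‖e‖ = 1 ∧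
    ∃ (γ : Rn n → ℝ) (M : ℝ≥0), LipschitzWith M γ ∧
      ∃ r : ℝ, 0 < r ∧ ∀ x ∈ Metric.ball x₀ r,
        (x ∈ Ω ↔ γ (x - (inner ℝ e x : ℝ) • e) < (inner ℝ e x : ℝ))

/-- The exterior `Ω_e = ℝⁿ \ closure Ω`. -/
def exterior {n : ℕ} (Ω : Set (Rn n)) : Set (Rn n) := (closure Ω)ᶜ

/-- Lebesgue measure on the cylinder `(0,T) × A`. -/
noncomputable def cylMeasure {n : ℕ} (T : ℝ) (A : Set (Rn n)) : Measure (ℝ × Rn n) :=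
  (volume.restrict (Ioo 0 T)).prod (volume.restrict A)

/-! ### Fractional Sobolev spaces -/

/-- The square `[u]²` of the Gagliardo seminorm of order `s` on `ℝⁿ`. -/
noncomputable def gagliardoSq {n : ℕ} (s : ℝ) (u : Rn n → ℝ) : ℝ≥0∞ :=
  ∫⁻ x, ∫⁻ y, ENNReal.ofReal (|u x - u y| ^ 2 / ‖x - y‖ ^ ((n : ℝ) + 2 * s))

/-- The square of the norm of `H^s(ℝⁿ)`. -/
noncomputable def hsNormSq {n : ℕ} (s : ℝ) (u : Rn n → ℝ) : ℝ≥0∞ :=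
  (∫⁻ x, ENNReal.ofReal (|u x| ^ 2)) + gagliardoSq s u

/-- `u ∈ H^s(ℝⁿ)`. -/
def MemHs {n : ℕ} (s : ℝ) (u : Rn n → ℝ) : Prop :=
  AEStronglyMeasurable u volume ∧ hsNormSq s u < ⊤

/-- `u ∈ H̃^s(Ω)`, the closure of `C_c^∞(Ω)` in `H^s(ℝⁿ)`. -/
def MemHsTilde {n : ℕ} (s : ℝ) (Ω : Set (Rn n)) (u : Rn n → ℝ) : Prop :=
  MemHs s u ∧ ∀ δ : ℝ≥0∞, 0 < δ → ∃ ψ : Rn n → ℝ,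
    ContDiff ℝ ∞ ψ ∧ HasCompactSupport ψ ∧ tsupport ψ ⊆ Ω ∧ hsNormSq s (fun x => u x - ψ x) < δ

/-- `w ∈ L²(0,T; H^s(ℝⁿ))`, for `w` given as a function of `(t, x)`. -/
def MemL2Hs {n : ℕ} (s T : ℝ) (w : ℝ → Rn n → ℝ) : Prop :=
  AEStronglyMeasurable (Function.uncurry w) (cylMeasure T univ) ∧
    (∀ᵐ t ∂(volume.restrict (Ioo 0 T)), MemHs s (w t)) ∧
    ∫⁻ t in Ioo 0 T, hsNormSq s (w t) < ⊤

/-- `w ∈ L²(0,T; H̃^s(Ω))`. -/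
def MemL2HsTilde {n : ℕ} (s T : ℝ) (Ω : Set (Rn n)) (w : ℝ → Rn n → ℝ) : Prop :=
  MemL2Hs s T w ∧ ∀ᵐ t ∂(volume.restrict (Ioo 0 T)), MemHsTilde s Ω (w t)

/-- `F ∈ L²(Ω_T)`. -/
def MemL2Cyl {n : ℕ} (T : ℝ) (Ω : Set (Rn n)) (F : ℝ → Rn n → ℝ) : Prop :=
  MemLp (Function.uncurry F) 2 (cylMeasure T Ω)

/-- `u ∈ H¹(0,T; L²(Ω))`: `u` and its distributional time derivative `w` are in
`L²(0,T; L²(Ω)) = L²(Ω_T)`. The identity `∫ η' u dt = - ∫ η w dt` is one in `L²(Ω)`. -/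
def MemH1L2 {n : ℕ} (T : ℝ) (Ω : Set (Rn n)) (u : ℝ → Rn n → ℝ) : Prop :=
  MemL2Cyl T Ω u ∧ ∃ w : ℝ → Rn n → ℝ, MemL2Cyl T Ω w ∧
    ∀ η : ℝ → ℝ, ContDiff ℝ ∞ η → HasCompactSupport η → tsupport η ⊆ Ioo 0 T →
      ∀ᵐ x ∂(volume.restrict Ω),
        ∫ t in Ioo 0 T, deriv η t * u t x = - ∫ t in Ioo 0 T, η t * w t x

/-- `φ ∈ C_c([0,T] × Ω_e)`, extended by zero to `[0,T] × ℝⁿ`. -/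
def MemCcExterior {n : ℕ} (T : ℝ) (Ω : Set (Rn n)) (φ : ℝ → Rn n → ℝ) : Prop :=
  ContinuousOn (Function.uncurry φ) (Icc 0 T ×ˢ univ) ∧
    ∃ S : Set (Rn n), IsCompact S ∧ S ⊆ exterior Ω ∧ ∀ t ∈ Icc 0 T, ∀ x ∉ S, φ t x = 0

/-- Weak convergence `v_ε ⇀ v` in `L¹(Ω_T)` as `ε → 0`, `ε > 0`. -/
def TendstoWeakL1 {n : ℕ} (T : ℝ) (Ω : Set (Rn n)) (vε : ℝ → ℝ → Rn n → ℝ)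
    (v : ℝ → Rn n → ℝ) : Prop :=
  (∀ᶠ ε in 𝓝[>] (0 : ℝ), Integrable (Function.uncurry (vε ε)) (cylMeasure T Ω)) ∧
    Integrable (Function.uncurry v) (cylMeasure T Ω) ∧
    ∀ g : ℝ × Rn n → ℝ, MemLp g ⊤ (cylMeasure T Ω) →
      Tendsto (fun ε => ∫ p, vε ε p.1 p.2 * g p ∂(cylMeasure T Ω)) (𝓝[>] 0)
        (𝓝 (∫ p, v p.1 p.2 * g p ∂(cylMeasure T Ω)))

/-! ### Nonlocal operators, the nonlinearity and weak solutions -/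

/-- The kernels of the operators in the class `𝓛₀`: measurable, symmetric, uniformly elliptic. -/
structure IsKernel {n : ℕ} (K : Rn n → Rn n → ℝ) : Prop where
  aemeasurable : AEMeasurable (Function.uncurry K) (volume : Measure (Rn n × Rn n))
  symm : ∀ x y, K x y = K y x
  elliptic : ∃ lam Lam : ℝ, 0 < lam ∧ lam ≤ Lam ∧ ∀ x y, lam ≤ K x y ∧ K x y ≤ Lam

/-- The bilinear form `B_K` of the operator `L_K` of order `2s`. -/
noncomputable def bilin {n : ℕ} (s : ℝ) (K : Rn n → Rn n → ℝ) (u v : Rn n → ℝ) : ℝ :=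
  ∫ p : Rn n × Rn n,
    K p.1 p.2 * ((u p.1 - u p.2) * (v p.1 - v p.2) / ‖p.1 - p.2‖ ^ ((n : ℝ) + 2 * s))

/-- `Φ^m(t) = |t|^{m-1} t`. -/
noncomputable def Phi (m t : ℝ) : ℝ := |t| ^ (m - 1) * t

/-- A family of regularizations `Φ_ε`, for small `ε > 0`, of the nonlinearity `Φ^m`. -/
def IsRegularization (m : ℝ) (Φε : ℝ → ℝ → ℝ) : Prop :=
  (∀ᶠ ε in 𝓝[>] (0 : ℝ), ContDiff ℝ 1 (Φε ε) ∧ (∀ t, Φε ε t = - Φε ε (-t)) ∧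
    ∃ c C : ℝ, 0 < c ∧ c ≤ C ∧ ∀ t, c ≤ deriv (Φε ε) t ∧ deriv (Φε ε) t ≤ C) ∧
  ∀ S : Set ℝ, IsCompact S → TendstoUniformlyOn Φε (Phi m) (𝓝[>] 0) S

/-- Admissible source, exterior value and initial value for the problem with nonlinearity `Φ`:
`F ∈ L²(Ω_T)`, `φ ∈ C_c([0,T] × Ω_e)` with `Φ(φ) ∈ L²(0,T; H^s(ℝⁿ))`,
`u₀ ∈ L^∞(Ω) ∩ H̃^s(Ω)`. -/
structure IsAdmissibleData {n : ℕ} (s T : ℝ) (Ω : Set (Rn n)) (Φ : ℝ → ℝ)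
    (F φ : ℝ → Rn n → ℝ) (u₀ : Rn n → ℝ) : Prop where
  source : MemL2Cyl T Ω F
  ext_cont : MemCcExterior T Ω φ
  ext_sobolev : MemL2Hs s T (fun t x => Φ (φ t x))
  init_bounded : MemLp u₀ ⊤ (volume.restrict Ω)
  init_sobolev : MemHsTilde s Ω u₀

/-- `u : (0,T) × ℝⁿ → ℝ` is a weak solution of `∂ₜu + L_K(Φ(u)) = F` in `Ω_T`, `u = φ` in
`(Ω_e)_T`, `u(0) = u₀` in `Ω`. The functions `ψ` restricted to `[0,T) × Ω` are exactly those of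
`C_c^∞([0,T) × Ω)`. -/
structure IsWeakSolution {n : ℕ} (s T : ℝ) (Ω : Set (Rn n)) (K : Rn n → Rn n → ℝ) (Φ : ℝ → ℝ)
    (F φ : ℝ → Rn n → ℝ) (u₀ : Rn n → ℝ) (u : ℝ → Rn n → ℝ) : Prop where
  sobolev : MemL2Hs s T (fun t x => Φ (u t x))
  exterior_value : MemL2HsTilde s T Ω (fun t x => Φ (u t x - φ t x))
  equation : ∀ ψ : ℝ → Rn n → ℝ, ContDiff ℝ ∞ (Function.uncurry ψ) →
    HasCompactSupport (Function.uncurry ψ) → tsupport (Function.uncurry ψ) ⊆ Iio T ×ˢ Ω →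
      - (∫ p, u p.1 p.2 * deriv (fun τ => ψ τ p.2) p.1 ∂(cylMeasure T Ω))
          + ∫ t in Ioo 0 T, bilin s K (fun x => Φ (u t x)) (ψ t)
        = (∫ p, F p.1 p.2 * ψ p.1 p.2 ∂(cylMeasure T Ω)) + ∫ x in Ω, u₀ x * ψ 0 x

/-! ### The quantities in the comparison estimate

For a real number `a`, `ENNReal.ofReal a` is the positive part `a₊`, as an element of `[0,∞]`. -/

/-- `∫_Ω (v - w)₊ dx`. -/
noncomputable def posPartInt {n : ℕ} (Ω : Set (Rn n)) (v w : Rn n → ℝ) : ℝ≥0∞ :=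
  ∫⁻ x in Ω, ENNReal.ofReal (v x - w x)

/-- `∫_{Ω_T} (F - G)₊ dx dt`. -/
noncomputable def posPartIntCyl {n : ℕ} (T : ℝ) (Ω : Set (Rn n)) (F G : ℝ → Rn n → ℝ) : ℝ≥0∞ :=
  ∫⁻ t in Ioo 0 T, posPartInt Ω (F t) (G t)

/-- `∫_{Ω_T} ∫_{Ω_e} (v - w)₊(x,t) / |x - y|^{n+2s} dx dy dt`, with `x ∈ Ω_e` and `y ∈ Ω`. -/
noncomputable def exteriorPosPartInt {n : ℕ} (s T : ℝ) (Ω : Set (Rn n))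
    (v w : ℝ → Rn n → ℝ) : ℝ≥0∞ :=
  ∫⁻ t in Ioo 0 T, ∫⁻ y in Ω, ∫⁻ x in exterior Ω,
    ENNReal.ofReal (v t x - w t x) / ENNReal.ofReal (‖x - y‖ ^ ((n : ℝ) + 2 * s))

end NPME

/-!
In terms of the pressure `w = Φ(u - φ)`, which vanishes outside `Ω`, a weak solution solves an
abstract evolution equation `β(w)' + L w = f` in `L²(Ω)`, where `β = Φ⁻¹` and the exterior value
enters through the source `-L_K Φ(φ)` in `Ω`. This source is bounded because the support of `φ`
keeps a positive distance from `Ω`, and the integral of the positive part of a difference of two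
such sources is at most twice the upper ellipticity bound of `K` times the exterior integral.

The operator `L` comes from a Markovian form, so the resolvent equations `β(z) + h L z = g` of the
implicit Euler scheme, which are solved by minimization, satisfy an `L¹` comparison principle. A
weak solution need not be strong, so it cannot be compared with another one by testing with the
sign of the difference. On grids on which the flux has good Riemann sums it is nevertheless close
to the Euler iterates in the norm dual to the energy norm; this follows from the monotonicity of
`β`. The comparison of the iterates passes to the limit against test functions with values in
`[0, 1]`.
-/

namespace NPME

/-! ### Elliptic problems in Hilbert spaces and the implicit Euler scheme -/

section Hilbert

theorem exists_isMinOn_of_uniformly_midpoint_convex {E : Type*} [NormedAddCommGroup E]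
    [NormedSpace ℝ E] [CompleteSpace E] {s : Set E} (hs : IsClosed s) (hsc : Convex ℝ s)
    (hne : s.Nonempty) {J : E → ℝ} (hJ : Continuous J) (hbdd : BddBelow (J '' s)) {κ : ℝ}
    (hκ : 0 < κ)
    (hmid : ∀ x ∈ s, ∀ y ∈ s, J (midpoint ℝ x y) + κ * ‖x - y‖ ^ 2 ≤ (J x + J y) / 2) :
    ∃ x ∈ s, IsMinOn J s x := by
  set c := sInf (J '' s)
  have hc : ∀ x ∈ s, c ≤ J x := fun x hx => csInf_le hbdd (mem_image_of_mem J hx)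
  have hmin : ∀ k : ℕ, ∃ x ∈ s, J x < c + 1 / ((k : ℝ) + 1) := fun k => by
    obtain ⟨_, ⟨x, hx, rfl⟩, hlt⟩ := exists_lt_of_csInf_lt (hne.image J)
      (lt_add_of_pos_right c (Nat.one_div_pos_of_nat (n := k)))
    exact ⟨x, hx, hlt⟩
  choose a has ha using hmin
  have hcauchy : CauchySeq a := by
    refine cauchySeq_of_le_tendsto_0 (fun N : ℕ => √(1 / ((N : ℝ) + 1) / κ)) ?_ ?_
    · intro k l N hk hl
      have hmem := hc _ (hsc.midpoint_mem (has k) (has l))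
      have hkN : (1 : ℝ) / ((k : ℝ) + 1) ≤ 1 / ((N : ℝ) + 1) := by gcongr
      have hlN : (1 : ℝ) / ((l : ℝ) + 1) ≤ 1 / ((N : ℝ) + 1) := by gcongr
      rw [dist_eq_norm]
      refine Real.le_sqrt_of_sq_le ((le_div_iff₀' hκ).2 ?_)
      linarith [hmid _ (has k) _ (has l), ha k, ha l]
    · simpa using ((tendsto_one_div_add_atTop_nhds_zero_nat (𝕜 := ℝ)).div_const κ).sqrt
  obtain ⟨x, hx⟩ := cauchySeq_tendsto_of_complete hcauchy
  refine ⟨x, hs.mem_of_tendsto hx (Eventually.of_forall has), fun y hy => ?_⟩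
  refine (le_of_tendsto_of_tendsto ((hJ.tendsto x).comp hx)
    (g := fun k : ℕ => c + 1 / ((k : ℝ) + 1)) ?_
    (Eventually.of_forall fun k => (ha k).le)).trans (hc y hy)
  simpa using (tendsto_one_div_add_atTop_nhds_zero_nat (𝕜 := ℝ)).const_add c

variable {H Y : Type*} [NormedAddCommGroup H] [InnerProductSpace ℝ H]
  [NormedAddCommGroup Y]

/-- `β x` is a subgradient at `x` of the (necessarily convex) function `P`, for every `x`. -/
def IsSubgradient (β : H → H) (P : H → ℝ) : Prop :=
  ∀ x y, P x + inner ℝ (β x) (y - x) ≤ P y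

namespace IsSubgradient

variable {β : H → H} {P : H → ℝ}

theorem inner_sub_sub_nonneg (hP : IsSubgradient β P) (x y : H) :
    0 ≤ inner ℝ (β x - β y) (x - y) := by
  have hxy := hP x y
  have hyx := hP y x
  rw [← neg_sub x y, inner_neg_right] at hxy
  rw [inner_sub_left]
  linarith

theorem continuous (hP : IsSubgradient β P) (hβ : Continuous β) : Continuous P := by
  rw [continuous_iff_continuousAt]
  intro y
  have hlower : Tendsto (fun x => P y + inner ℝ (β y) (x - y)) (𝓝 y) (𝓝 (P y)) := by
    have : ContinuousAt (fun x => P y + inner ℝ (β y) (x - y)) y := by fun_prop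
    simpa [ContinuousAt] using this
  have hupper : Tendsto (fun x => P y - inner ℝ (β x) (y - x)) (𝓝 y) (𝓝 (P y)) := by
    have : ContinuousAt (fun x => P y - inner ℝ (β x) (y - x)) y := by fun_prop
    simpa [ContinuousAt] using this
  exact tendsto_of_tendsto_of_tendsto_of_le_of_le hlower hupper (hP y)
    fun x => le_sub_iff_add_le.2 (hP x y)

theorem midpoint_le (hP : IsSubgradient β P) (x y : H) :
    P (midpoint ℝ x y) ≤ (P x + P y) / 2 := by
  have hx := hP (midpoint ℝ x y) x
  have hy := hP (midpoint ℝ x y) y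
  have hcancel : inner ℝ (β (midpoint ℝ x y)) (x - midpoint ℝ x y)
      + inner ℝ (β (midpoint ℝ x y)) (y - midpoint ℝ x y) = 0 := by
    rw [← inner_add_right, left_sub_midpoint, right_sub_midpoint, ← smul_add]
    simp
  linarith

end IsSubgradient

/-- The functional `P(a₁) + h/2 ‖a₂‖² - ⟪g, a₁⟫`, where `a = (a₁, a₂)` stands for a function and its
(nonlocal) gradient. Its minimizers solve `β(a) + h L a = g`, if `β` is the gradient of `P` and `L`
is the operator of the quadratic form `‖a₂‖²`. -/
noncomputable def energy (P : H → ℝ) (h : ℝ) (g : H) (a : H × Y) : ℝ :=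
  P a.1 + h / 2 * ‖a.2‖ ^ 2 - inner ℝ g a.1

theorem neg_sq_div_le_energy {P : H → ℝ} (hP0 : ∀ x, 0 ≤ P x) {h : ℝ} (hh : 0 < h) (g : H) {C : ℝ}
    {a : H × Y} (ha : ‖a.1‖ ≤ C * ‖a.2‖) : -(‖g‖ * C) ^ 2 / (2 * h) ≤ energy P h g a := by
  have hinner : inner ℝ g a.1 ≤ ‖g‖ * (C * ‖a.2‖) :=
    (real_inner_le_norm _ _).trans (mul_le_mul_of_nonneg_left ha (norm_nonneg _))
  rw [energy, div_le_iff₀ (by positivity)]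
  nlinarith [sq_nonneg (h * ‖a.2‖ - ‖g‖ * C), mul_nonneg hh.le (hP0 a.1),
    mul_nonneg hh.le (sub_nonneg.2 hinner)]

variable [InnerProductSpace ℝ Y]

theorem energy_midpoint_add_le {β : H → H} {P : H → ℝ} (hP : IsSubgradient β P) (h : ℝ) (g : H)
    (a b : H × Y) :
    energy P h g (midpoint ℝ a b) + h / 8 * ‖a.2 - b.2‖ ^ 2
      ≤ (energy P h g a + energy P h g b) / 2 := by
  have hfst : (midpoint ℝ a b).1 = midpoint ℝ a.1 b.1 := by
    simp only [midpoint_eq_smul_add, Prod.smul_fst, Prod.fst_add]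
  have hsnd : ‖(midpoint ℝ a b).2‖ ^ 2 = ‖a.2 + b.2‖ ^ 2 / 4 := by
    rw [midpoint_eq_smul_add, Prod.smul_snd, Prod.snd_add, norm_smul, mul_pow]
    norm_num
    ring
  have hinner : inner ℝ g (midpoint ℝ a.1 b.1) = (inner ℝ g a.1 + inner ℝ g b.1) / 2 := by
    rw [midpoint_eq_smul_add, inner_smul_right, inner_add_right, invOf_eq_inv]
    ring
  have hpar : ‖a.2 - b.2‖ ^ 2 = 2 * (‖a.2‖ ^ 2 + ‖b.2‖ ^ 2) - ‖a.2 + b.2‖ ^ 2 := by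
    linarith [parallelogram_law_with_norm ℝ a.2 b.2]
  rw [energy, hfst, hsnd, hinner, hpar, energy, energy]
  linarith [hP.midpoint_le a.1 b.1]

theorem exists_isMinOn_energy [CompleteSpace H] [CompleteSpace Y] {V : Submodule ℝ (H × Y)}
    (hV : IsClosed (V : Set (H × Y))) {C : ℝ} (hC : ∀ a ∈ V, ‖a.1‖ ≤ C * ‖a.2‖)
    {β : H → H} (hβ : Continuous β) {P : H → ℝ} (hP0 : ∀ x, 0 ≤ P x) (hP : IsSubgradient β P)
    {h : ℝ} (hh : 0 < h) (g : H) : ∃ ϑ ∈ V, IsMinOn (energy P h g) V ϑ := by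
  have hnorm : ∀ a ∈ V, ‖a‖ ≤ max C 1 * ‖a.2‖ := fun a ha =>
    max_le ((hC a ha).trans (by gcongr; exact le_max_left C 1))
      (le_mul_of_one_le_left (norm_nonneg _) (le_max_right C 1))
  have : 0 < max C 1 := lt_max_of_lt_right one_pos
  have hPc := hP.continuous hβ
  refine exists_isMinOn_of_uniformly_midpoint_convex (κ := h / 8 / max C 1 ^ 2) hV V.convex
    ⟨0, V.zero_mem⟩ (by unfold energy; fun_prop) ?_ (by positivity) fun a ha b hb => ?_
  · exact ⟨_, forall_mem_image.2 fun a ha => neg_sq_div_le_energy hP0 hh g (hC a ha)⟩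
  · refine le_trans ?_ (energy_midpoint_add_le hP h g a b)
    rw [div_mul_eq_mul_div, mul_div_assoc]
    gcongr
    rw [div_le_iff₀ (by positivity), mul_comm, ← mul_pow]
    gcongr
    exact hnorm _ (V.sub_mem ha hb)

theorem inner_add_mul_inner_eq_of_isMinOn_energy {V : Submodule ℝ (H × Y)} {β : H → H}
    (hβ : Continuous β) {P : H → ℝ} (hP : IsSubgradient β P) {h : ℝ} {g : H} {ϑ : H × Y}
    (hϑ : ϑ ∈ V) (hmin : IsMinOn (energy P h g) V ϑ) {ψ : H × Y} (hψ : ψ ∈ V) :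
    inner ℝ (β ϑ.1) ψ.1 + h * inner ℝ ϑ.2 ψ.2 = inner ℝ g ψ.1 := by
  have hvar : ∀ ψ ∈ V, 0 ≤ inner ℝ (β ϑ.1) ψ.1 + h * inner ℝ ϑ.2 ψ.2 - inner ℝ g ψ.1 := by
    intro ψ hψ
    set q : ℝ → ℝ := fun t => inner ℝ (β (ϑ.1 + t • ψ.1)) ψ.1 + h * inner ℝ ϑ.2 ψ.2
      + t * (h / 2 * ‖ψ.2‖ ^ 2) - inner ℝ g ψ.1
    have hq : Tendsto q (𝓝[>] 0) (𝓝 (q 0)) :=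
      (by fun_prop : ContinuousAt q 0).tendsto.mono_left nhdsWithin_le_nhds
    have hq0 : ∀ᶠ t in 𝓝[>] (0 : ℝ), 0 ≤ q t := by
      filter_upwards [self_mem_nhdsWithin] with t (ht : 0 < t)
      have hle : energy P h g ϑ ≤ energy P h g (ϑ + t • ψ) :=
        hmin (V.add_mem hϑ (V.smul_mem t hψ))
      have hsub := hP (ϑ.1 + t • ψ.1) ϑ.1
      simp only [energy, Prod.fst_add, Prod.snd_add, Prod.smul_fst, Prod.smul_snd,
        inner_add_right, inner_smul_right, norm_add_sq_real, norm_smul, mul_pow,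
        Real.norm_eq_abs, sq_abs] at hle
      rw [sub_add_cancel_left, inner_neg_right, inner_smul_right] at hsub
      refine (mul_nonneg_iff_of_pos_left ht).1 ?_
      simp only [q]
      linarith
    simpa [q] using ge_of_tendsto hq hq0
  have hneg := hvar (-ψ) (V.neg_mem hψ)
  simp only [Prod.fst_neg, Prod.snd_neg, inner_neg_right] at hneg
  linarith [hvar ψ hψ]

theorem exists_resolvent [CompleteSpace H] [CompleteSpace Y] {V : Submodule ℝ (H × Y)}
    (hV : IsClosed (V : Set (H × Y))) {C : ℝ} (hC : ∀ a ∈ V, ‖a.1‖ ≤ C * ‖a.2‖)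
    {β : H → H} (hβ : Continuous β) {P : H → ℝ} (hP0 : ∀ x, 0 ≤ P x) (hP : IsSubgradient β P)
    {h : ℝ} (hh : 0 < h) (g : H) :
    ∃ ϑ ∈ V, ∀ ψ ∈ V, inner ℝ (β ϑ.1) ψ.1 + h * inner ℝ ϑ.2 ψ.2 = inner ℝ g ψ.1 := by
  obtain ⟨ϑ, hϑ, hmin⟩ := exists_isMinOn_energy hV hC hβ hP0 hP hh g
  exact ⟨ϑ, hϑ, fun ψ hψ => inner_add_mul_inner_eq_of_isMinOn_energy hβ hP hϑ hmin hψ⟩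

/-- The next step `E + I - h ϑ₂` of the error tested with itself is controlled by monotonicity:
its product with `(a - ϑ)₂` has a sign. -/
theorem norm_euler_step_error_le {V : Submodule ℝ (H × Y)} {β : H → H}
    (hβ : ∀ x y, 0 ≤ inner ℝ (β x - β y) (x - y)) {a ϑ : H × Y} (ha : a ∈ V) (hϑ : ϑ ∈ V)
    {E I : Y} {h : ℝ} (hh : 0 ≤ h)
    (hE : ∀ ψ ∈ V, inner ℝ (E + I - h • ϑ.2) ψ.2 = inner ℝ (β ϑ.1 - β a.1) ψ.1) :
    ‖E + I - h • ϑ.2‖ ≤ ‖E‖ + ‖I - h • a.2‖ := by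
  set E' := E + I - h • ϑ.2 with hE'
  have hsplit : E' = (E + (I - h • a.2)) + h • (a - ϑ).2 := by
    rw [hE', Prod.snd_sub]
    module
  have hmono : h * inner ℝ E' (a - ϑ).2 ≤ 0 := by
    rw [hE _ (V.sub_mem ha hϑ), Prod.fst_sub, ← neg_sub ϑ.1, inner_neg_right]
    nlinarith [hβ ϑ.1 a.1]
  have hsq : ‖E'‖ * ‖E'‖ ≤ ‖E'‖ * ‖E + (I - h • a.2)‖ := by
    calc ‖E'‖ * ‖E'‖ = inner ℝ E' E' := (real_inner_self_eq_norm_mul_norm E').symm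
      _ = inner ℝ E' (E + (I - h • a.2)) + h * inner ℝ E' (a - ϑ).2 := by
        rw [← real_inner_smul_right, ← inner_add_right, ← hsplit]
      _ ≤ inner ℝ E' (E + (I - h • a.2)) := by linarith
      _ ≤ ‖E'‖ * ‖E + (I - h • a.2)‖ := real_inner_le_norm _ _
  refine le_trans ?_ (norm_add_le E (I - h • a.2))
  rcases (norm_nonneg E').eq_or_lt with h0 | hpos
  · rw [← h0]
    positivity
  · exact le_of_mul_le_mul_left hsq hpos

/-- `n` steps of the implicit Euler scheme `z (k + 1) - z k + h k • L ϑ (k + 1) = f k`, where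
`z k = β (ϑ k)` and the operator `L` is given in weak form by the energy space `V`. -/
structure IsImplicitEuler (V : Submodule ℝ (H × Y)) (β : H → H) (v₀ : H) (h : ℕ → ℝ) (f : ℕ → H)
    (n : ℕ) (z : ℕ → H) (ϑ : ℕ → H × Y) : Prop where
  initial : z 0 = v₀
  mem : ∀ k < n, ϑ (k + 1) ∈ V
  eq_map : ∀ k < n, z (k + 1) = β (ϑ (k + 1)).1
  equation : ∀ k < n, ∀ ψ ∈ V,
    inner ℝ (z (k + 1) - z k) ψ.1 + h k * inner ℝ (ϑ (k + 1)).2 ψ.2 = inner ℝ (f k) ψ.1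

theorem IsImplicitEuler.of_le {V : Submodule ℝ (H × Y)} {β : H → H} {v₀ : H} {h : ℕ → ℝ}
    {f : ℕ → H} {m n : ℕ} {z : ℕ → H} {ϑ : ℕ → H × Y} (hz : IsImplicitEuler V β v₀ h f n z ϑ)
    (hmn : m ≤ n) : IsImplicitEuler V β v₀ h f m z ϑ :=
  ⟨hz.initial, fun k hk => hz.mem k (hk.trans_le hmn), fun k hk => hz.eq_map k (hk.trans_le hmn),
    fun k hk => hz.equation k (hk.trans_le hmn)⟩

theorem exists_isImplicitEuler [CompleteSpace H] [CompleteSpace Y] {V : Submodule ℝ (H × Y)}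
    (hV : IsClosed (V : Set (H × Y))) {C : ℝ} (hC : ∀ a ∈ V, ‖a.1‖ ≤ C * ‖a.2‖)
    {β : H → H} (hβ : Continuous β) {P : H → ℝ} (hP0 : ∀ x, 0 ≤ P x) (hP : IsSubgradient β P)
    (v₀ : H) {h : ℕ → ℝ} (f : ℕ → H) {n : ℕ} (hh : ∀ k < n, 0 < h k) :
    ∃ z ϑ, IsImplicitEuler V β v₀ h f n z ϑ := by
  choose! R hR using fun (τ : ℝ) (g : H) (hτ : 0 < τ) => exists_resolvent hV hC hβ hP0 hP hτ g
  let z : ℕ → H := fun k => Nat.rec v₀ (fun k x => β (R (h k) (x + f k)).1) k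
  refine ⟨z, fun k => R (h (k - 1)) (z (k - 1) + f (k - 1)), rfl,
    fun k hk => (hR _ _ (hh k hk)).1, fun _ _ => rfl, fun k hk ψ hψ => ?_⟩
  have hstep := (hR _ (z k + f k) (hh k hk)).2 ψ hψ
  rw [inner_add_left] at hstep
  simp only [Nat.add_sub_cancel, inner_sub_left, z] at hstep ⊢
  linarith

/-- The error `z n - x n` of the implicit Euler scheme `z` is measured in the norm dual to the
energy norm `‖ψ₂‖`: it is represented by the vector `E`. The sequence `x` solves the scheme with
`I k` in place of the flux `h k • (a (k + 1)).2`. -/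
theorem exists_implicit_euler_error_le {V : Submodule ℝ (H × Y)} {β : H → H}
    (hβ : ∀ x y, 0 ≤ inner ℝ (β x - β y) (x - y)) {x z f : ℕ → H} {a ϑ : ℕ → H × Y} {I : ℕ → Y}
    {h : ℕ → ℝ} {n : ℕ} (hh : ∀ k < n, 0 ≤ h k) (hz : IsImplicitEuler V β (x 0) h f n z ϑ)
    (hx : ∀ k < n, a (k + 1) ∈ V ∧ x (k + 1) = β (a (k + 1)).1 ∧ ∀ ψ ∈ V,
      inner ℝ (x (k + 1) - x k) ψ.1 + inner ℝ (I k) ψ.2 = inner ℝ (f k) ψ.1) :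
    ∃ E : Y, ‖E‖ ≤ ∑ k ∈ Finset.range n, ‖I k - h k • (a (k + 1)).2‖ ∧
      ∀ ψ ∈ V, inner ℝ E ψ.2 = inner ℝ (z n - x n) ψ.1 := by
  induction n with
  | zero => exact ⟨0, by simp, fun ψ _ => by simp [hz.initial]⟩
  | succ n ih =>
    obtain ⟨E, hE, hEV⟩ := ih (fun k hk => hh k (by omega)) (hz.of_le n.le_succ)
      (fun k hk => hx k (by omega))
    obtain ⟨haV, hxβ, hxe⟩ := hx n n.lt_succ_self
    have hEV' : ∀ ψ ∈ V, inner ℝ (E + I n - h n • (ϑ (n + 1)).2) ψ.2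
        = inner ℝ (z (n + 1) - x (n + 1)) ψ.1 := fun ψ hψ => by
      have hE := hEV ψ hψ
      have hxe := hxe ψ hψ
      have hze := hz.equation n n.lt_succ_self ψ hψ
      simp only [inner_add_left, inner_sub_left, real_inner_smul_left] at hE hxe hze ⊢
      linarith
    refine ⟨_, ?_, hEV'⟩
    rw [hz.eq_map n n.lt_succ_self, hxβ] at hEV'
    rw [Finset.sum_range_succ]
    exact (norm_euler_step_error_le hβ haV (hz.mem n n.lt_succ_self) (hh n n.lt_succ_self)
      hEV').trans (by gcongr)

end Hilbert

/-! ### Riemann sums of vector-valued integrable functions -/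

section Grid

variable {E : Type*} [NormedAddCommGroup E]

theorem tendsto_lintegral_enorm_translate_sub {g : ℝ → E} (hg : Integrable g) :
    Tendsto (fun a : ℝ => ∫⁻ t, ‖g (a + t) - g t‖ₑ) (𝓝 0) (𝓝 0) := by
  have hg1 : MemLp g 1 volume := memLp_one_iff_integrable.2 hg
  have : Fact ((1 : ℝ≥0∞) ≠ ⊤) := ⟨ENNReal.one_ne_top⟩
  have hcont : Continuous fun a : ℝ => edist (DomAddAct.mk a +ᵥ hg1.toLp g) (hg1.toLp g) := by
    have hmk : Continuous fun a : ℝ => (DomAddAct.mk a : ℝᵈᵃᵃ) := DomAddAct.continuous_mk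
    exact (hmk.vadd continuous_const).edist continuous_const
  have htend : Tendsto (fun a : ℝ => edist (DomAddAct.mk a +ᵥ hg1.toLp g) (hg1.toLp g)) (𝓝 0)
      (𝓝 0) := by
    simpa using hcont.tendsto 0
  refine htend.congr fun a => ?_
  rw [DomAddAct.mk_vadd_toLp, Lp.edist_toLp_toLp, eLpNorm_one_eq_lintegral_enorm]
  rfl

theorem setLIntegral_Ioc_sub_self_eq (F : ℝ → ℝ≥0∞) (t h : ℝ) :
    ∫⁻ τ in Ioc (t - h) t, F τ = ∫⁻ a in Ioc (-h) 0, F (a + t) := by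
  rw [← (measurePreserving_add_right volume t).setLIntegral_comp_preimage_emb
    (measurableEmbedding_addRight t), preimage_add_const_Ioc, sub_self, sub_sub_cancel_left]

/-- The sum over `j < J` of the oscillation of `g` on the cell `(t - (j + 1) h, t - j h]`, measured
from its right end point. -/
noncomputable def gridOsc (g : ℝ → E) (h : ℝ) (J : ℕ) (t : ℝ) : ℝ≥0∞ :=
  ∑ j ∈ Finset.range J, ∫⁻ a in Ioc (-h) 0, ‖g (a + (t - j * h)) - g (t - j * h)‖ₑ

theorem measurable_enorm_translate_sub {g : ℝ → E} (hg : StronglyMeasurable g) (c : ℝ) :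
    Measurable fun p : ℝ × ℝ => ‖g (p.2 + (p.1 - c)) - g (p.1 - c)‖ₑ := by
  have hshift : StronglyMeasurable fun p : ℝ × ℝ => g (p.2 + (p.1 - c)) :=
    hg.comp_measurable (by fun_prop)
  have hbase : StronglyMeasurable fun p : ℝ × ℝ => g (p.1 - c) := hg.comp_measurable (by fun_prop)
  exact (hshift.sub hbase).enorm

theorem measurable_gridOsc {g : ℝ → E} (hg : StronglyMeasurable g) (h : ℝ) (J : ℕ) :
    Measurable (gridOsc g h J) :=
  Finset.measurable_fun_sum _ fun _ _ => (measurable_enorm_translate_sub hg _).lintegral_prod_right'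

theorem lintegral_gridOsc {g : ℝ → E} (hg : StronglyMeasurable g) (h : ℝ) (J : ℕ) :
    ∫⁻ t, gridOsc g h J t = J * ∫⁻ a in Ioc (-h) 0, ∫⁻ t, ‖g (a + t) - g t‖ₑ := by
  have hj : ∀ j : ℕ, ∫⁻ t, ∫⁻ a in Ioc (-h) 0, ‖g (a + (t - j * h)) - g (t - j * h)‖ₑ
      = ∫⁻ a in Ioc (-h) 0, ∫⁻ t, ‖g (a + t) - g t‖ₑ := fun j => by
    rw [lintegral_lintegral_swap (measurable_enorm_translate_sub hg _).aemeasurable]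
    exact lintegral_congr fun a => lintegral_sub_right_eq_self (fun t => ‖g (a + t) - g t‖ₑ) _
  unfold gridOsc
  rw [lintegral_finsetSum _ fun j _ =>
    (measurable_enorm_translate_sub hg _).lintegral_prod_right']
  simp only [hj, Finset.sum_const, Finset.card_range, nsmul_eq_mul]

theorem tendsto_lintegral_gridOsc {g : ℝ → E} (hg : StronglyMeasurable g) (hgi : Integrable g)
    (T : ℝ) :
    Tendsto (fun i : ℕ => ∫⁻ t, gridOsc g (T / ((i : ℝ) + 1)) (i + 1) t) atTop (𝓝 0) := by
  rw [ENNReal.tendsto_nhds_zero]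
  intro ε hε
  have hε' : 0 < ε / ENNReal.ofReal T := ENNReal.div_pos hε.ne' ENNReal.ofReal_ne_top
  obtain ⟨δ, hδ, hosc⟩ := Metric.eventually_nhds_iff.1
    (ENNReal.tendsto_nhds_zero.1 (tendsto_lintegral_enorm_translate_sub hgi) _ hε')
  have hstep : Tendsto (fun i : ℕ => T / ((i : ℝ) + 1)) atTop (𝓝 0) := by
    simpa [div_eq_mul_inv] using tendsto_one_div_add_atTop_nhds_zero_nat.const_mul T
  filter_upwards [hstep.eventually (gt_mem_nhds hδ)] with i hi
  rw [lintegral_gridOsc hg]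
  set h := T / ((i : ℝ) + 1) with hh
  calc ((i + 1 : ℕ) : ℝ≥0∞) * ∫⁻ a in Ioc (-h) 0, ∫⁻ t, ‖g (a + t) - g t‖ₑ
      ≤ ((i + 1 : ℕ) : ℝ≥0∞) * ∫⁻ _ in Ioc (-h) 0, ε / ENNReal.ofReal T := by
        refine mul_le_mul_right (setLIntegral_mono measurable_const fun _ ha => hosc ?_) _
        rw [Real.dist_eq, sub_zero, abs_of_nonpos ha.2]
        linarith [ha.1]
    _ = ENNReal.ofReal T * (ε / ENNReal.ofReal T) := by
        rw [lintegral_const, Measure.restrict_apply_univ, Real.volume_Ioc,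
          mul_comm (ε / _), ← mul_assoc, ← ENNReal.ofReal_natCast,
          ← ENNReal.ofReal_mul (Nat.cast_nonneg _), hh]
        congr 2
        push_cast
        field_simp
        ring
    _ ≤ ε := ENNReal.mul_div_le

theorem ae_liminf_gridOsc_eq_zero {g : ℝ → E} (hg : StronglyMeasurable g) (hgi : Integrable g)
    (T : ℝ) :
    ∀ᵐ t, liminf (fun i : ℕ => gridOsc g (T / ((i : ℝ) + 1)) (i + 1) t) atTop = 0 := by
  refine (lintegral_eq_zero_iff (Measurable.liminf fun i => measurable_gridOsc hg _ _)).1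
    (le_antisymm ?_ zero_le)
  refine (lintegral_liminf_le fun i => measurable_gridOsc hg _ _).trans ?_
  rw [(tendsto_lintegral_gridOsc hg hgi T).liminf_eq]

/-- The grid of step `h` on `[0, t]` counted back from `t`, with nodes `backwardGrid t h k` for
`k ≤ ⌈t / h⌉₊`. Only its first cell may be shorter than `h`. -/
noncomputable def backwardGrid (t h : ℝ) (k : ℕ) : ℝ :=
  max 0 (t - ((⌈t / h⌉₊ : ℝ) - k) * h)

section BackwardGrid

variable {t h : ℝ}

theorem backwardGrid_zero (hh : 0 < h) : backwardGrid t h 0 = 0 := by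
  have hle : t ≤ ⌈t / h⌉₊ * h := (div_le_iff₀ hh).1 (Nat.le_ceil _)
  rw [backwardGrid, Nat.cast_zero, sub_zero]
  exact max_eq_left (by linarith)

theorem backwardGrid_ceil (ht : 0 ≤ t) : backwardGrid t h ⌈t / h⌉₊ = t := by
  rw [backwardGrid, sub_self, zero_mul, sub_zero]
  exact max_eq_right ht

theorem sub_mul_pos_of_pos (ht : 0 ≤ t) (hh : 0 < h) {k : ℕ} (hk : 0 < k) :
    0 < t - ((⌈t / h⌉₊ : ℝ) - k) * h := by
  have hceil : ((⌈t / h⌉₊ : ℝ) - 1) * h < t := by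
    rw [← lt_div_iff₀ hh]
    linarith [Nat.ceil_lt_add_one (div_nonneg ht hh.le)]
  have hk : (1 : ℝ) ≤ k := by exact_mod_cast hk
  nlinarith

theorem backwardGrid_succ (ht : 0 ≤ t) (hh : 0 < h) {k : ℕ} (hk : k < ⌈t / h⌉₊) :
    backwardGrid t h (k + 1) = t - (⌈t / h⌉₊ - 1 - k : ℕ) * h := by
  rw [backwardGrid, max_eq_right (sub_mul_pos_of_pos ht hh k.succ_pos).le,
    Nat.cast_sub (by omega), Nat.cast_sub (by omega)]
  push_cast
  ring

theorem backwardGrid_lt_succ (ht : 0 ≤ t) (hh : 0 < h) (k : ℕ) :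
    backwardGrid t h k < backwardGrid t h (k + 1) := by
  have hpos := sub_mul_pos_of_pos ht hh k.succ_pos
  refine (max_lt hpos ?_).trans_le (le_max_right _ _)
  push_cast
  linarith

theorem backwardGrid_mem_Ioc (ht : 0 ≤ t) (hh : 0 < h) {k : ℕ} (hk : k < ⌈t / h⌉₊) :
    backwardGrid t h (k + 1) ∈ Ioc 0 t := by
  refine ⟨(le_max_left _ _).trans_lt (backwardGrid_lt_succ ht hh k), ?_⟩
  rw [backwardGrid_succ ht hh hk]
  exact sub_le_self _ (by positivity)

theorem backwardGrid_succ_sub_le (hh : 0 ≤ h) (k : ℕ) :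
    backwardGrid t h (k + 1) - h ≤ backwardGrid t h k := by
  refine sub_le_iff_le_add.2 (max_le (add_nonneg (le_max_left _ _) hh) ?_)
  refine le_trans (le_of_eq ?_) (add_le_add_left (le_max_right 0 _) h)
  push_cast
  ring

theorem sum_lintegral_backwardGrid_le_gridOsc (g : ℝ → E) (ht : 0 ≤ t) (hh : 0 < h) {J : ℕ}
    (hJ : ⌈t / h⌉₊ ≤ J) :
    ∑ k ∈ Finset.range ⌈t / h⌉₊, ∫⁻ τ in Ioc (backwardGrid t h k) (backwardGrid t h (k + 1)),
      ‖g τ - g (backwardGrid t h (k + 1))‖ₑ ≤ gridOsc g h J t := by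
  set osc : ℕ → ℝ≥0∞ := fun j =>
    ∫⁻ a in Ioc (-h) 0, ‖g (a + (t - j * h)) - g (t - j * h)‖ₑ with hosc
  calc _ ≤ ∑ k ∈ Finset.range ⌈t / h⌉₊, osc (⌈t / h⌉₊ - 1 - k) := by
        refine Finset.sum_le_sum fun k hk => ?_
        simp only [hosc]
        rw [← backwardGrid_succ ht hh (Finset.mem_range.1 hk),
          ← setLIntegral_Ioc_sub_self_eq (fun τ => ‖g τ - g (backwardGrid t h (k + 1))‖ₑ)]
        exact lintegral_mono_set (Ioc_subset_Ioc_left (backwardGrid_succ_sub_le hh.le k))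
    _ = ∑ k ∈ Finset.range ⌈t / h⌉₊, osc k := Finset.sum_range_reflect osc _
    _ ≤ gridOsc g h J t := Finset.sum_le_sum_of_subset (Finset.range_mono hJ)

end BackwardGrid

/-- The idea is to average over the choice of the end point of the grid. -/
theorem ae_exists_grid {g : ℝ → E} (hg : StronglyMeasurable g) (hgi : Integrable g) {p : ℝ → Prop}
    (hp : ∀ᵐ t, p t) {T : ℝ} (hT : 0 < T) :
    ∀ᵐ t₀ ∂(volume.restrict (Ioo 0 T)), ∀ ε : ℝ≥0∞, 0 < ε → ∃ (n : ℕ) (t : ℕ → ℝ),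
      0 < n ∧ t 0 = 0 ∧ t n = t₀ ∧
      (∀ k < n, t k < t (k + 1) ∧ t (k + 1) ∈ Ioc 0 t₀ ∧ p (t (k + 1))) ∧
      ∑ k ∈ Finset.range n, ∫⁻ τ in Ioc (t k) (t (k + 1)), ‖g τ - g (t (k + 1))‖ₑ < ε := by
  have hnodes : ∀ᵐ t₀ : ℝ, ∀ i j : ℕ, p (t₀ - j * (T / ((i : ℝ) + 1))) :=
    ae_all_iff.2 fun i => ae_all_iff.2 fun j =>
      (measurePreserving_sub_right volume _).quasiMeasurePreserving.ae hp
  rw [ae_restrict_iff' measurableSet_Ioo]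
  filter_upwards [ae_liminf_gridOsc_eq_zero hg hgi T, hnodes] with t₀ hliminf hnodes ht₀ ε hε
  obtain ⟨i, hi⟩ := (frequently_lt_of_liminf_lt (by isBoundedDefault) (hliminf ▸ hε)).exists
  set h := T / ((i : ℝ) + 1) with hh
  have hpos : 0 < h := by positivity
  have hceil : ⌈t₀ / h⌉₊ ≤ i + 1 := by
    refine Nat.ceil_le.2 ((div_le_iff₀ hpos).2 ?_)
    rw [hh, Nat.cast_succ, mul_div_cancel₀ _ (by positivity)]
    exact ht₀.2.le
  refine ⟨⌈t₀ / h⌉₊, backwardGrid t₀ h, Nat.ceil_pos.2 (div_pos ht₀.1 hpos),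
    backwardGrid_zero hpos, backwardGrid_ceil ht₀.1.le, fun k hk => ⟨?_, ?_, ?_⟩, ?_⟩
  · exact backwardGrid_lt_succ ht₀.1.le hpos k
  · exact backwardGrid_mem_Ioc ht₀.1.le hpos hk
  · rw [backwardGrid_succ ht₀.1.le hpos hk]
    exact hnodes i _
  · exact (sum_lintegral_backwardGrid_le_gridOsc g ht₀.1.le hpos hceil).trans_lt hi

theorem sum_norm_setIntegral_sub_smul_le [NormedSpace ℝ E] [CompleteSpace E] {g : ℝ → E}
    (hg : Integrable g) {n : ℕ} {t : ℕ → ℝ} (ht : ∀ k < n, t k ≤ t (k + 1)) {ε : ℝ} (hε : 0 ≤ ε)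
    (hsum : ∑ k ∈ Finset.range n, ∫⁻ τ in Ioc (t k) (t (k + 1)), ‖g τ - g (t (k + 1))‖ₑ
      ≤ ENNReal.ofReal ε) :
    ∑ k ∈ Finset.range n,
      ‖(∫ τ in Ioc (t k) (t (k + 1)), g τ) - (t (k + 1) - t k) • g (t (k + 1))‖ ≤ ε := by
  rw [← ENNReal.ofReal_le_ofReal_iff hε, ENNReal.ofReal_sum_of_nonneg fun _ _ => norm_nonneg _]
  refine (Finset.sum_le_sum fun k hk => ?_).trans hsum
  have hconst : (t (k + 1) - t k) • g (t (k + 1))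
      = ∫ _ in Ioc (t k) (t (k + 1)), g (t (k + 1)) := by
    rw [setIntegral_const, Real.volume_real_Ioc_of_le (ht k (Finset.mem_range.1 hk))]
  rw [hconst, ← integral_sub hg.integrableOn (integrable_const _), ofReal_norm]
  exact enorm_integral_le_lintegral_enorm _

theorem nonneg_of_lt_succ {n : ℕ} {t : ℕ → ℝ} (ht0 : t 0 = 0) (ht : ∀ k < n, t k < t (k + 1)) :
    ∀ k ≤ n, 0 ≤ t k := by
  intro k
  induction k with
  | zero => exact fun _ => ht0.ge
  | succ k ih => exact fun hk => (ih (by omega)).trans (ht k hk).le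

theorem sum_setLIntegral_Ioc (φ : ℝ → ℝ≥0∞) {n : ℕ} {t : ℕ → ℝ} (ht0 : t 0 = 0)
    (ht : ∀ k < n, t k < t (k + 1)) :
    ∑ k ∈ Finset.range n, ∫⁻ τ in Ioc (t k) (t (k + 1)), φ τ = ∫⁻ τ in Ioc 0 (t n), φ τ := by
  induction n with
  | zero => simp [ht0]
  | succ n ih =>
    have ht' : ∀ k < n, t k < t (k + 1) := fun k hk => ht k (by omega)
    rw [Finset.sum_range_succ, ih ht', ← Ioc_union_Ioc_eq_Ioc (nonneg_of_lt_succ ht0 ht' n le_rfl)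
      (ht n n.lt_succ_self).le, lintegral_union measurableSet_Ioc (Ioc_disjoint_Ioc_of_le le_rfl)]

end Grid

/-! ### The positive part in `L¹` -/

section PosPart

variable {α : Type*} [MeasurableSpace α] {μ : Measure α}

theorem inner_eq_integral (f g : Lp ℝ 2 μ) : inner ℝ f g = ∫ x, f x * g x ∂μ := by
  simp only [L2.inner_def, RCLike.inner_apply', conj_trivial]

theorem integrable_mul_Lp (f g : Lp ℝ 2 μ) : Integrable (fun x => f x * g x) μ :=
  MemLp.integrable_mul (Lp.memLp f) (Lp.memLp g)

theorem ofReal_integral_max_zero {f : α → ℝ} (hf : Integrable f μ) :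
    ENNReal.ofReal (∫ x, max (f x) 0 ∂μ) = ∫⁻ x, ENNReal.ofReal (f x) ∂μ := by
  rw [ofReal_integral_eq_lintegral_ofReal hf.pos_part (ae_of_all _ fun _ => le_max_right _ _)]
  simp only [ENNReal.ofReal_max, ENNReal.ofReal_zero, zero_le, sup_of_le_left]

theorem ofReal_integral_le_lintegral_ofReal (f : α → ℝ) :
    ENNReal.ofReal (∫ x, f x ∂μ) ≤ ∫⁻ x, ENNReal.ofReal (f x) ∂μ := by
  by_cases hf : Integrable f μ
  · rw [← ofReal_integral_max_zero hf]
    exact ENNReal.ofReal_le_ofReal (integral_mono hf hf.pos_part fun _ => le_max_left _ _)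
  · simp only [integral_undef hf, ENNReal.ofReal_zero, zero_le]

/-- The `L¹` norm of the positive part of an `L²` function. -/
noncomputable def posL1 (f : Lp ℝ 2 μ) : ℝ≥0∞ := ∫⁻ x, ENNReal.ofReal (f x) ∂μ

theorem posL1_add_le (f g : Lp ℝ 2 μ) : posL1 (f + g) ≤ posL1 f + posL1 g := by
  unfold posL1
  rw [← lintegral_add_left' (Lp.aestronglyMeasurable f).aemeasurable.ennreal_ofReal]
  refine lintegral_mono_ae ?_
  filter_upwards [Lp.coeFn_add f g] with x hx
  rw [hx]
  exact ENNReal.ofReal_add_le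

theorem ofReal_inner_le_posL1 (f : Lp ℝ 2 μ) {ζ : Lp ℝ 2 μ} (hζ : ∀ᵐ x ∂μ, ζ x ∈ Icc (0 : ℝ) 1) :
    ENNReal.ofReal (inner ℝ f ζ) ≤ posL1 f := by
  rw [inner_eq_integral]
  refine (ofReal_integral_le_lintegral_ofReal _).trans (lintegral_mono_ae ?_)
  filter_upwards [hζ] with x hx
  rw [ENNReal.ofReal_mul' hx.1]
  exact mul_le_of_le_one_right zero_le (ENNReal.ofReal_le_one.2 hx.2)

variable [IsFiniteMeasure μ]

theorem exists_inner_eq_posL1 (f : Lp ℝ 2 μ) : ∃ ζ : Lp ℝ 2 μ,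
    (∀ᵐ x ∂μ, ζ x ∈ Icc (0 : ℝ) 1) ∧ posL1 f = ENNReal.ofReal (inner ℝ f ζ) := by
  set A : Set α := {x | 0 < f x}
  have hA : MeasurableSet A :=
    measurableSet_lt measurable_const (Lp.stronglyMeasurable f).measurable
  have hζ := indicatorConstLp_coeFn (p := 2) (hs := hA) (hμs := measure_ne_top μ A) (c := (1 : ℝ))
  refine ⟨indicatorConstLp 2 hA (measure_ne_top μ A) 1, ?_, ?_⟩
  · filter_upwards [hζ] with x hx
    by_cases h : x ∈ A <;> simp [hx, h]
  · rw [posL1, ← ofReal_integral_max_zero ((Lp.memLp f).integrable one_le_two), inner_eq_integral]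
    refine congrArg ENNReal.ofReal (integral_congr_ae ?_)
    filter_upwards [hζ] with x hx
    by_cases h : x ∈ A
    · rw [hx, indicator_of_mem h, mul_one, max_eq_left h.le]
    · rw [hx, indicator_of_notMem h, mul_zero, max_eq_right (not_lt.1 h)]

theorem posL1_setIntegral_le {F : ℝ → Lp ℝ 2 μ} {s : Set ℝ} (hF : IntegrableOn F s) :
    posL1 (∫ τ in s, F τ) ≤ ∫⁻ τ in s, posL1 (F τ) := by
  obtain ⟨ζ, hζ, h⟩ := exists_inner_eq_posL1 (∫ τ in s, F τ)
  rw [h, real_inner_comm, ← integral_inner hF]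
  refine (ofReal_integral_le_lintegral_ofReal _).trans (lintegral_mono fun τ => ?_)
  rw [real_inner_comm]
  exact ofReal_inner_le_posL1 _ hζ

end PosPart

section SmoothSign

theorem exists_lipschitzWith_smoothTransition : ∃ L, LipschitzWith L Real.smoothTransition := by
  have hsmooth : ContDiff ℝ 1 Real.smoothTransition := Real.smoothTransition.contDiff (n := 1)
  obtain ⟨L, hL⟩ := isCompact_Icc.exists_bound_of_continuousOn
    ((hsmooth.continuous_deriv le_rfl).continuousOn (s := Icc 0 1))
  have hIcc : LipschitzOnWith L.toNNReal Real.smoothTransition (Icc 0 1) :=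
    (convex_Icc 0 1).lipschitzOnWith_of_nnnorm_deriv_le
      (fun x _ => hsmooth.differentiable one_ne_zero x)
      fun x hx => NNReal.coe_le_coe.1 ((hL x hx).trans (Real.le_coe_toNNReal L))
  refine ⟨L.toNNReal * 1, ?_⟩
  convert hIcc.to_restrict.comp (LipschitzWith.projIcc (zero_le_one (α := ℝ))) using 1
  ext x
  simp [Function.comp]

/-- Smooth nondecreasing approximations of the indicator function of `(0, ∞)`. -/
noncomputable def smoothSign (k : ℕ) (r : ℝ) : ℝ := Real.smoothTransition (k * r)

theorem exists_lipschitzWith_smoothSign (k : ℕ) : ∃ L, LipschitzWith L (smoothSign k) :=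
  exists_lipschitzWith_smoothTransition.imp' (· * _)
    fun _ hL => hL.comp (lipschitzWith_smul (k : ℝ))

theorem smoothSign_zero (k : ℕ) : smoothSign k 0 = 0 := by
  rw [smoothSign, mul_zero, Real.smoothTransition.zero]

theorem smoothSign_monotone (k : ℕ) : Monotone (smoothSign k) := fun _ _ h =>
  Real.smoothTransition.monotone (mul_le_mul_of_nonneg_left h (Nat.cast_nonneg k))

theorem contDiff_smoothSign (k : ℕ) : ContDiff ℝ ∞ (smoothSign k) :=
  Real.smoothTransition.contDiff.comp (contDiff_const.mul contDiff_id)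

theorem smoothSign_mem_Icc (k : ℕ) (r : ℝ) : smoothSign k r ∈ Icc (0 : ℝ) 1 :=
  ⟨Real.smoothTransition.nonneg _, Real.smoothTransition.le_one _⟩

theorem smoothSign_of_nonpos (k : ℕ) {r : ℝ} (hr : r ≤ 0) : smoothSign k r = 0 :=
  Real.smoothTransition.zero_of_nonpos (mul_nonpos_of_nonneg_of_nonpos (Nat.cast_nonneg k) hr)

theorem tendsto_smoothSign {r : ℝ} (hr : 0 < r) :
    Tendsto (fun k => smoothSign k r) atTop (𝓝 1) := by
  refine tendsto_const_nhds.congr' ?_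
  filter_upwards [eventually_ge_atTop ⌈1 / r⌉₊] with k hk
  exact (Real.smoothTransition.one_of_one_le
    ((div_le_iff₀ hr).1 ((Nat.le_ceil _).trans (by exact_mod_cast hk)))).symm

theorem tendsto_mul_smoothSign {z a : ℝ} (hpos : 0 < z → 0 < a) (hneg : z < 0 → a ≤ 0) :
    Tendsto (fun k => z * smoothSign k a) atTop (𝓝 (max z 0)) := by
  rcases lt_trichotomy z 0 with h | h | h
  · simp [smoothSign_of_nonpos _ (hneg h), max_eq_right h.le]
  · simp [h]
  · simpa [max_eq_left h.le] using (tendsto_smoothSign (hpos h)).const_mul z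

variable {α : Type*} [MeasurableSpace α] {μ : Measure α}

theorem tendsto_inner_compLp_smoothSign [IsFiniteMeasure μ] {z a : Lp ℝ 2 μ}
    (hpos : ∀ᵐ x ∂μ, 0 < z x → 0 < a x) (hneg : ∀ᵐ x ∂μ, z x < 0 → a x ≤ 0) {L : ℕ → ℝ≥0}
    (hL : ∀ k, LipschitzWith (L k) (smoothSign k)) :
    Tendsto (fun k => ENNReal.ofReal (inner ℝ z ((hL k).compLp (smoothSign_zero k) a))) atTop
      (𝓝 (posL1 z)) := by
  have hz : Integrable z μ := (Lp.memLp z).integrable one_le_two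
  have hcomp := fun k => (hL k).coeFn_compLp (smoothSign_zero k) a
  rw [posL1, ← ofReal_integral_max_zero hz]
  refine (ENNReal.continuous_ofReal.tendsto _).comp ?_
  simp only [inner_eq_integral]
  refine tendsto_integral_of_dominated_convergence (fun x => ‖z x‖)
    (fun k => (integrable_mul_Lp z _).1) hz.norm (fun k => ?_) ?_
  · filter_upwards [hcomp k] with x hx
    rw [hx, norm_mul, Function.comp_apply, Real.norm_of_nonneg (smoothSign_mem_Icc k _).1]
    exact mul_le_of_le_one_right (norm_nonneg _) (smoothSign_mem_Icc k _).2
  · filter_upwards [ae_all_iff.2 hcomp, hpos, hneg] with x hx hpos hneg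
    simpa only [hx, Function.comp_apply] using tendsto_mul_smoothSign hpos hneg

end SmoothSign

/-! ### Superposition operators on `L²` -/

theorem exists_dist_le_add_mul_dist {E F : Type*} [NormedAddCommGroup E] [NormedSpace ℝ E]
    [PseudoMetricSpace F] {f : E → F} (hf : UniformContinuous f) {δ : ℝ} (hδ : 0 < δ) :
    ∃ C, 0 ≤ C ∧ ∀ a b, dist (f a) (f b) ≤ δ + C * dist a b := by
  obtain ⟨η, hη, hηδ⟩ := Metric.uniformContinuous_iff.1 hf δ hδ
  refine ⟨δ / η, by positivity, fun a b => ?_⟩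
  set n : ℕ := ⌊dist a b / η⌋₊ + 1 with hn
  have hn0 : (0 : ℝ) < n := by positivity
  have hcell : dist a b / n < η := by
    rw [div_lt_iff₀ hn0, mul_comm, ← div_lt_iff₀ hη, hn, Nat.cast_succ]
    exact Nat.lt_floor_add_one _
  have hchain := dist_le_range_sum_of_dist_le
    (f := fun k : ℕ => f (AffineMap.lineMap a b ((k : ℝ) / n))) (d := fun _ => δ) n fun {k} _ => by
      refine (hηδ ?_).le
      rw [dist_lineMap_lineMap, Real.dist_eq, ← sub_div, Nat.cast_succ, sub_add_cancel_left,
        abs_div, abs_neg, abs_one, abs_of_pos hn0, one_div_mul_eq_div]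
      exact hcell
  simp only [Nat.cast_zero, zero_div, AffineMap.lineMap_apply_zero, div_self hn0.ne',
    AffineMap.lineMap_apply_one, Finset.sum_const, Finset.card_range, nsmul_eq_mul] at hchain
  calc dist (f a) (f b) ≤ n * δ := hchain
    _ ≤ (dist a b / η + 1) * δ := by
      rw [hn, Nat.cast_succ]
      gcongr
      exact Nat.floor_le (by positivity)
    _ = δ + δ / η * dist a b := by ring

theorem mul_sub_le_intervalIntegral_of_monotone {β : ℝ → ℝ} (hβ : Monotone β) (a b : ℝ) :
    β a * (b - a) ≤ ∫ t in a..b, β t := by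
  rcases le_total a b with hab | hba
  · have := intervalIntegral.integral_mono_on (μ := volume) hab intervalIntegrable_const
      hβ.intervalIntegrable fun t ht => hβ ht.1
    rw [intervalIntegral.integral_const, smul_eq_mul] at this
    linarith
  · have := intervalIntegral.integral_mono_on (μ := volume) hba hβ.intervalIntegrable
      intervalIntegrable_const fun t ht => hβ ht.2
    rw [intervalIntegral.integral_const, smul_eq_mul] at this
    rw [intervalIntegral.integral_symm]
    linarith

/-- The functions `β` for which `f ↦ β ∘ f` is a continuous monotone operator on `L²` of a finite
measure. -/
structure IsNonlinearity (β : ℝ → ℝ) : Prop where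
  monotone : Monotone β
  map_zero : β 0 = 0
  uniformContinuous : UniformContinuous β

section Superposition

variable {α : Type*} [MeasurableSpace α] {μ : Measure α} [IsFiniteMeasure μ] {β : ℝ → ℝ}

theorem IsNonlinearity.memLp_comp (hβ : IsNonlinearity β) {f : α → ℝ} (hf : MemLp f 2 μ) :
    MemLp (fun x => β (f x)) 2 μ := by
  obtain ⟨C, _, hC⟩ := exists_dist_le_add_mul_dist hβ.uniformContinuous one_pos
  refine ((memLp_const (1 : ℝ)).add (hf.norm.const_mul C)).of_le
    (hβ.uniformContinuous.continuous.comp_aestronglyMeasurable hf.1) (ae_of_all _ fun x => ?_)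
  have := hC (f x) 0
  rw [hβ.map_zero, dist_zero_right, dist_zero_right] at this
  exact this.trans (le_abs_self _)

/-- The superposition operator `f ↦ β ∘ f` on `L²`. -/
noncomputable def superpose (hβ : IsNonlinearity β) (f : Lp ℝ 2 μ) : Lp ℝ 2 μ :=
  (hβ.memLp_comp (Lp.memLp f)).toLp _

theorem coeFn_superpose (hβ : IsNonlinearity β) (f : Lp ℝ 2 μ) :
    superpose hβ f =ᵐ[μ] fun x => β (f x) :=
  MemLp.coeFn_toLp _

theorem norm_superpose_sub_le (hβ : IsNonlinearity β) {δ C : ℝ} (hδ : 0 ≤ δ) (hC : 0 ≤ C)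
    (h : ∀ a b, dist (β a) (β b) ≤ δ + C * dist a b) (f g : Lp ℝ 2 μ) :
    ‖superpose hβ f - superpose hβ g‖ ≤ ‖Lp.const 2 μ (1 : ℝ)‖ * δ + C * ‖f - g‖ := by
  have hpointwise : ‖superpose hβ f - superpose hβ g‖
      ≤ ‖δ • Lp.const 2 μ (1 : ℝ) + C • |f - g|‖ := by
    refine Lp.norm_le_norm_of_ae_le ?_
    filter_upwards [Lp.coeFn_sub (superpose hβ f) (superpose hβ g), Lp.coeFn_sub f g,
      coeFn_superpose hβ f, coeFn_superpose hβ g,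
      Lp.coeFn_add (δ • Lp.const 2 μ (1 : ℝ)) (C • |f - g|), Lp.coeFn_smul C |f - g|,
      Lp.coeFn_smul δ (Lp.const 2 μ (1 : ℝ)), Lp.coeFn_abs (f - g),
      Lp.coeFn_const (μ := μ) (p := 2) (1 : ℝ)] with x h₁ h₂ h₃ h₄ h₅ h₆ h₇ h₈ h₉
    rw [h₁, h₅, Pi.sub_apply, Pi.add_apply, h₃, h₄, h₆, h₇, Pi.smul_apply, Pi.smul_apply, h₈, h₉,
      h₂, Pi.sub_apply, Function.const_apply, smul_eq_mul, mul_one]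
    exact (h (f x) (g x)).trans (le_abs_self _)
  calc _ ≤ _ := hpointwise
    _ ≤ _ := norm_add_le _ _
    _ = _ := by rw [norm_smul, norm_smul, norm_abs_eq_norm, Real.norm_of_nonneg hδ,
          Real.norm_of_nonneg hC, mul_comm δ]

theorem continuous_superpose (hβ : IsNonlinearity β) :
    Continuous (superpose hβ : Lp ℝ 2 μ → Lp ℝ 2 μ) := by
  refine continuous_iff_continuousAt.2 fun f => Metric.tendsto_nhds.2 fun ε hε => ?_
  obtain ⟨δ, hδ, hδε⟩ := exists_pos_mul_lt hε ‖Lp.const 2 μ (1 : ℝ)‖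
  obtain ⟨C, hC, hbound⟩ := exists_dist_le_add_mul_dist hβ.uniformContinuous hδ
  have hlim : Tendsto (fun g => ‖Lp.const 2 μ (1 : ℝ)‖ * δ + C * ‖g - f‖) (𝓝 f)
      (𝓝 (‖Lp.const 2 μ (1 : ℝ)‖ * δ)) := by
    have hcont : Continuous fun g => ‖Lp.const 2 μ (1 : ℝ)‖ * δ + C * ‖g - f‖ := by fun_prop
    simpa using hcont.tendsto f
  filter_upwards [hlim.eventually (gt_mem_nhds hδε)] with g hg
  rw [dist_eq_norm]
  exact (norm_superpose_sub_le hβ hδ.le hC hbound g f).trans_lt hg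

theorem IsNonlinearity.primitive_nonneg (hβ : IsNonlinearity β) (a : ℝ) :
    0 ≤ ∫ t in (0 : ℝ)..a, β t := by
  simpa [hβ.map_zero] using mul_sub_le_intervalIntegral_of_monotone hβ.monotone 0 a

theorem IsNonlinearity.integrable_primitive (hβ : IsNonlinearity β) (f : Lp ℝ 2 μ) :
    Integrable (fun x => ∫ t in (0 : ℝ)..f x, β t) μ := by
  have hcont : Continuous fun a => ∫ t in (0 : ℝ)..a, β t :=
    intervalIntegral.continuous_primitive (fun _ _ => hβ.monotone.intervalIntegrable) 0
  refine (integrable_mul_Lp (superpose hβ f) f).mono'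
    (hcont.comp_aestronglyMeasurable (Lp.aestronglyMeasurable f)) ?_
  filter_upwards [coeFn_superpose hβ f] with x hx
  rw [hx, Real.norm_of_nonneg (hβ.primitive_nonneg _), intervalIntegral.integral_symm]
  linarith [mul_sub_le_intervalIntegral_of_monotone hβ.monotone (f x) 0]

theorem isSubgradient_superpose (hβ : IsNonlinearity β) :
    IsSubgradient (superpose hβ : Lp ℝ 2 μ → Lp ℝ 2 μ)
      fun f => ∫ x, (∫ t in (0 : ℝ)..f x, β t) ∂μ := by
  intro f g
  rw [inner_eq_integral, ← integral_add (hβ.integrable_primitive f) (integrable_mul_Lp _ _)]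
  refine integral_mono_ae ((hβ.integrable_primitive f).add (integrable_mul_Lp _ _))
    (hβ.integrable_primitive g) ?_
  filter_upwards [coeFn_superpose hβ f, Lp.coeFn_sub g f] with x h₁ h₂
  rw [h₁, h₂, Pi.sub_apply, ← intervalIntegral.integral_add_adjacent_intervals
    (hβ.monotone.intervalIntegrable (b := f x)) (hβ.monotone.intervalIntegrable (b := g x))]
  exact add_le_add_right (mul_sub_le_intervalIntegral_of_monotone hβ.monotone _ _) _

end Superposition

/-! ### Evolution equations in weak form and their implicit Euler approximation -/

theorem setIntegral_Ioc_add_adjacent {E : Type*} [NormedAddCommGroup E] [NormedSpace ℝ E]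
    {g : ℝ → E} (hg : Integrable g) {a b c : ℝ} (hab : a ≤ b) (hbc : b ≤ c) :
    ∫ τ in Ioc a c, g τ = (∫ τ in Ioc a b, g τ) + ∫ τ in Ioc b c, g τ := by
  rw [← Ioc_union_Ioc_eq_Ioc hab hbc, setIntegral_union (Ioc_disjoint_Ioc_of_le le_rfl)
    measurableSet_Ioc hg.integrableOn hg.integrableOn]

section Evolution

variable {H Y : Type*} [NormedAddCommGroup H] [InnerProductSpace ℝ H] [NormedAddCommGroup Y]
  [InnerProductSpace ℝ Y] {V : Submodule ℝ (H × Y)} {β : H → H} {w : ℝ → H × Y} {f : ℝ → H}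
  {v₀ : H}

/-- The equation `v' + L w = f`, `v(0) = v₀`, integrated over `(0, t)`, for the value `x = v(t)`.
The operator `L` is given in weak form by the energy space `V`. -/
def IntegratedEquation (V : Submodule ℝ (H × Y)) (w : ℝ → H × Y) (f : ℝ → H) (v₀ : H) (t : ℝ)
    (x : H) : Prop :=
  ∀ ψ ∈ V, inner ℝ (x - v₀) ψ.1 + inner ℝ (∫ τ in Ioc 0 t, (w τ).2) ψ.2
    = inner ℝ (∫ τ in Ioc 0 t, f τ) ψ.1

/-- The evolution equation `v' + L w = f`, `v(0) = v₀`, `v = β(w)` on `(0, T)`, integrated in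
time. -/
structure IsEvolution (V : Submodule ℝ (H × Y)) (β : H → H) (T : ℝ) (w : ℝ → H × Y) (f : ℝ → H)
    (v₀ : H) : Prop where
  stronglyMeasurable : StronglyMeasurable fun t => (w t).2
  integrable : Integrable fun t => (w t).2
  integrable_source : Integrable f
  mem : ∀ᵐ t, t ∈ Ioo 0 T → w t ∈ V
  equation : ∀ᵐ t, t ∈ Ioo 0 T → IntegratedEquation V w f v₀ t (β (w t).1)

theorem IntegratedEquation.inner_sub_add_inner_eq {s t : ℝ} {x y : H}
    (hx : IntegratedEquation V w f v₀ s x) (hy : IntegratedEquation V w f v₀ t y)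
    (hw : Integrable fun t => (w t).2) (hf : Integrable f) (hs : 0 ≤ s) (hst : s ≤ t)
    {ψ : H × Y} (hψ : ψ ∈ V) :
    inner ℝ (y - x) ψ.1 + inner ℝ (∫ τ in Ioc s t, (w τ).2) ψ.2
      = inner ℝ (∫ τ in Ioc s t, f τ) ψ.1 := by
  have hx := hx ψ hψ
  have hy := hy ψ hψ
  rw [setIntegral_Ioc_add_adjacent hw hs hst, setIntegral_Ioc_add_adjacent hf hs hst] at hy
  simp only [inner_sub_left, inner_add_left] at hx hy ⊢
  linarith

/-- A grid `0 = t 0 < … < t n` on which the flux `(w τ).2` has Riemann sums with error at most `ε`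
and at whose nodes the evolution equation holds. -/
structure IsAdaptedGrid (V : Submodule ℝ (H × Y)) (β : H → H) (w : ℝ → H × Y) (f : ℝ → H) (v₀ : H)
    (ε : ℝ) (n : ℕ) (t : ℕ → ℝ) : Prop where
  zero : t 0 = 0
  lt_succ : ∀ k < n, t k < t (k + 1)
  mem : ∀ k < n, w (t (k + 1)) ∈ V
  equation : ∀ k < n, IntegratedEquation V w f v₀ (t (k + 1)) (β (w (t (k + 1))).1)
  sum_le : ∑ k ∈ Finset.range n, ∫⁻ τ in Ioc (t k) (t (k + 1)),
    ‖(w τ).2 - (w (t (k + 1))).2‖ₑ ≤ ENNReal.ofReal ε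

theorem IsAdaptedGrid.abs_inner_implicitEuler_sub_le [CompleteSpace Y]
    (hβ : ∀ x y, 0 ≤ inner ℝ (β x - β y) (x - y)) (hw : Integrable fun t => (w t).2)
    (hf : Integrable f) {ε : ℝ} (hε : 0 ≤ ε) {n : ℕ} (hn : n ≠ 0) {t : ℕ → ℝ}
    (ht : IsAdaptedGrid V β w f v₀ ε n t) {z : ℕ → H} {ϑ : ℕ → H × Y}
    (hz : IsImplicitEuler V β v₀ (fun k => t (k + 1) - t k)
      (fun k => ∫ τ in Ioc (t k) (t (k + 1)), f τ) n z ϑ) {ψ : H × Y} (hψ : ψ ∈ V) :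
    |inner ℝ (z n - β (w (t n)).1) ψ.1| ≤ ε * ‖ψ.2‖ := by
  set x : ℕ → H := fun k => if k = 0 then v₀ else β (w (t k)).1 with hx
  have hequation : ∀ k ≤ n, IntegratedEquation V w f v₀ (t k) (x k) := by
    rintro (_ | k) hk
    · intro ψ _
      simp [hx, ht.zero]
    · simpa [hx] using ht.equation k hk
  obtain ⟨E, hE, hEV⟩ := exists_implicit_euler_error_le hβ (x := x) (a := fun k => w (t k))
    (fun k hk => (sub_pos.2 (ht.lt_succ k hk)).le) hz fun k hk =>
      ⟨ht.mem k hk, if_neg k.succ_ne_zero, fun ψ hψ =>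
        (hequation k hk.le).inner_sub_add_inner_eq (hequation (k + 1) hk) hw hf
          (nonneg_of_lt_succ ht.zero ht.lt_succ k hk.le) (ht.lt_succ k hk).le hψ⟩
  have hEε : ‖E‖ ≤ ε := hE.trans
    (sum_norm_setIntegral_sub_smul_le hw (fun k hk => (ht.lt_succ k hk).le) hε ht.sum_le)
  rw [show β (w (t n)).1 = x n from (if_neg hn).symm, ← hEV ψ hψ]
  exact (abs_real_inner_le_norm _ _).trans (mul_le_mul_of_nonneg_right hEε (norm_nonneg _))

theorem IsEvolution.ae_exists_isAdaptedGrid {T : ℝ} (hT : 0 < T) {w₁ w₂ : ℝ → H × Y}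
    {f₁ f₂ : ℝ → H} {v₁ v₂ : H} (h₁ : IsEvolution V β T w₁ f₁ v₁)
    (h₂ : IsEvolution V β T w₂ f₂ v₂) :
    ∀ᵐ t₀ ∂(volume.restrict (Ioo 0 T)), ∀ ε : ℝ, 0 < ε → ∃ (n : ℕ) (t : ℕ → ℝ),
      n ≠ 0 ∧ t n = t₀ ∧ IsAdaptedGrid V β w₁ f₁ v₁ ε n t ∧ IsAdaptedGrid V β w₂ f₂ v₂ ε n t := by
  have hgrid := ae_exists_grid (h₁.stronglyMeasurable.prodMk h₂.stronglyMeasurable)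
    (h₁.integrable.prodMk h₂.integrable)
    ((h₁.mem.and h₁.equation).and (h₂.mem.and h₂.equation)) hT
  filter_upwards [hgrid, ae_restrict_mem measurableSet_Ioo] with t₀ hgrid ht₀ ε hε
  obtain ⟨n, t, hn, ht0, htn, ht, hsum⟩ := hgrid _ (ENNReal.ofReal_pos.2 hε)
  have hnode : ∀ k < n, t (k + 1) ∈ Ioo 0 T := fun k hk =>
    ⟨(ht k hk).2.1.1, (ht k hk).2.1.2.trans_lt ht₀.2⟩
  refine ⟨n, t, hn.ne', htn, ⟨ht0, fun k hk => (ht k hk).1,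
    fun k hk => (ht k hk).2.2.1.1 (hnode k hk), fun k hk => (ht k hk).2.2.1.2 (hnode k hk), ?_⟩,
    ⟨ht0, fun k hk => (ht k hk).1,
    fun k hk => (ht k hk).2.2.2.1 (hnode k hk), fun k hk => (ht k hk).2.2.2.2 (hnode k hk), ?_⟩⟩
  · exact (Finset.sum_le_sum fun k _ => lintegral_mono fun τ =>
      enorm_le_iff_norm_le.2 (norm_fst_le (_ : Y × Y))).trans hsum.le
  · exact (Finset.sum_le_sum fun k _ => lintegral_mono fun τ =>
      enorm_le_iff_norm_le.2 (norm_snd_le (_ : Y × Y))).trans hsum.le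

end Evolution

/-! ### The Markov property and the comparison principle for evolution equations -/

section Markov

variable {α : Type*} [MeasurableSpace α] {μ : Measure α}
  {Y : Type*} [NormedAddCommGroup Y] [InnerProductSpace ℝ Y] {V : Submodule ℝ (Lp ℝ 2 μ × Y)}

/-- The first Beurling–Deny criterion for the form `a ↦ ‖a.2‖ ^ 2` on `V`: smooth nondecreasing
Lipschitz functions operate on a dense subset of `V`, and the form is nonnegative on `(a, G a)`. -/
def IsMarkov (V : Submodule ℝ (Lp ℝ 2 μ × Y)) : Prop :=
  ∀ (G : ℝ → ℝ) (L : ℝ≥0) (hL : LipschitzWith L G) (h0 : G 0 = 0), ContDiff ℝ ∞ G → Monotone G →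
    ∀ a ∈ V, ∀ η : ℝ, 0 < η → ∃ a' ∈ V, ∃ b ∈ V, ‖a - a'‖ ≤ η ∧ b.1 = hL.compLp h0 a'.1 ∧
      0 ≤ (inner ℝ a'.2 b.2 : ℝ) ∧ ‖b.2‖ ≤ L * ‖a'.2‖

theorem IsMarkov.neg_mul_le_inner_compLp (hV : IsMarkov V) {G : ℝ → ℝ} {L : ℝ≥0}
    (hL : LipschitzWith L G) (h0 : G 0 = 0) (hG : ContDiff ℝ ∞ G) (hm : Monotone G)
    {a : Lp ℝ 2 μ × Y} (ha : a ∈ V) {x : Lp ℝ 2 μ} {h : ℝ} (hh : 0 ≤ h)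
    (hx : ∀ ψ ∈ V, inner ℝ x ψ.1 = h * inner ℝ a.2 ψ.2) {η : ℝ} (hη : 0 < η) :
    -(h * (η * (L * (‖a‖ + η))) + ‖x‖ * (L * η)) ≤ inner ℝ x (hL.compLp h0 a.1) := by
  obtain ⟨a', _, b, hb, haa', hbG, hpos, hbL⟩ := hV G L hL h0 hG hm a ha η hη
  have hform : -(η * (L * (‖a‖ + η))) ≤ inner ℝ a.2 b.2 := by
    have hb2 : ‖b.2‖ ≤ L * (‖a‖ + η) := by
      refine hbL.trans (mul_le_mul_of_nonneg_left ((norm_snd_le _).trans ?_) L.coe_nonneg)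
      linarith [norm_sub_norm_le a' a, norm_sub_rev a a']
    have herr : |inner ℝ (a - a').2 b.2| ≤ η * (L * (‖a‖ + η)) :=
      (abs_real_inner_le_norm _ _).trans
        (mul_le_mul ((norm_snd_le _).trans haa') hb2 (norm_nonneg _) hη.le)
    rw [Prod.snd_sub, inner_sub_left] at herr
    linarith [neg_le_of_abs_le herr]
  have hLp : |inner ℝ x (hL.compLp h0 a.1 - b.1)| ≤ ‖x‖ * (L * η) := by
    refine (abs_real_inner_le_norm _ _).trans (mul_le_mul_of_nonneg_left ?_ (norm_nonneg _))
    rw [hbG]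
    exact (hL.norm_compLp_sub_le h0 _ _).trans
      (mul_le_mul_of_nonneg_left ((norm_fst_le (a - a')).trans haa') L.coe_nonneg)
  rw [inner_sub_right, hx b hb] at hLp
  linarith [neg_le_of_abs_le hLp, mul_le_mul_of_nonneg_left hform hh]

theorem IsMarkov.inner_compLp_nonneg (hV : IsMarkov V) {G : ℝ → ℝ} {L : ℝ≥0}
    (hL : LipschitzWith L G) (h0 : G 0 = 0) (hG : ContDiff ℝ ∞ G) (hm : Monotone G)
    {a : Lp ℝ 2 μ × Y} (ha : a ∈ V) {x : Lp ℝ 2 μ} {h : ℝ} (hh : 0 ≤ h)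
    (hx : ∀ ψ ∈ V, inner ℝ x ψ.1 = h * inner ℝ a.2 ψ.2) :
    0 ≤ (inner ℝ x (hL.compLp h0 a.1) : ℝ) := by
  have hcont : Continuous fun η : ℝ => -(h * (η * (L * (‖a‖ + η))) + ‖x‖ * (L * η)) := by fun_prop
  have hlim : Tendsto (fun η : ℝ => -(h * (η * (L * (‖a‖ + η))) + ‖x‖ * (L * η))) (𝓝[>] 0)
      (𝓝 0) := by
    simpa using (hcont.tendsto 0).mono_left (nhdsWithin_le_nhds (s := Ioi 0))
  refine le_of_tendsto hlim ?_
  filter_upwards [self_mem_nhdsWithin] with η hη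
  exact hV.neg_mul_le_inner_compLp hL h0 hG hm ha hh hx hη

variable [IsFiniteMeasure μ] {β : ℝ → ℝ}

/-- Testing the difference of the equations with smooth approximations of the sign of
`ϑ₁ - ϑ₂`, which is also the sign of `β ϑ₁ - β ϑ₂`, shows that the resolvent is a
`T`-contraction in `L¹`. -/
theorem IsMarkov.posL1_superpose_sub_le (hV : IsMarkov V) (hβ : IsNonlinearity β)
    {ϑ₁ ϑ₂ : Lp ℝ 2 μ × Y} (h₁ : ϑ₁ ∈ V) (h₂ : ϑ₂ ∈ V) {g₁ g₂ : Lp ℝ 2 μ} {h : ℝ} (hh : 0 ≤ h)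
    (he₁ : ∀ ψ ∈ V, inner ℝ (superpose hβ ϑ₁.1) ψ.1 + h * inner ℝ ϑ₁.2 ψ.2 = inner ℝ g₁ ψ.1)
    (he₂ : ∀ ψ ∈ V, inner ℝ (superpose hβ ϑ₂.1) ψ.1 + h * inner ℝ ϑ₂.2 ψ.2 = inner ℝ g₂ ψ.1) :
    posL1 (superpose hβ ϑ₁.1 - superpose hβ ϑ₂.1) ≤ posL1 (g₁ - g₂) := by
  choose L hL using exists_lipschitzWith_smoothSign
  have hz : ∀ᵐ x ∂μ, (superpose hβ ϑ₁.1 - superpose hβ ϑ₂.1 : Lp ℝ 2 μ) x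
      = β (ϑ₁.1 x) - β (ϑ₂.1 x) := by
    filter_upwards [Lp.coeFn_sub (superpose hβ ϑ₁.1) (superpose hβ ϑ₂.1),
      coeFn_superpose hβ ϑ₁.1, coeFn_superpose hβ ϑ₂.1] with x h₁ h₂ h₃
    rw [h₁, Pi.sub_apply, h₂, h₃]
  have ha := Lp.coeFn_sub ϑ₁.1 ϑ₂.1
  have hsign := tendsto_inner_compLp_smoothSign
    (z := superpose hβ ϑ₁.1 - superpose hβ ϑ₂.1) (a := (ϑ₁ - ϑ₂).1)
    (by
      filter_upwards [hz, ha] with x hz ha hpos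
      rw [hz, sub_pos] at hpos
      rw [Prod.fst_sub, ha]
      exact sub_pos.2 (hβ.monotone.reflect_lt hpos))
    (by
      filter_upwards [hz, ha] with x hz ha hneg
      rw [hz, sub_neg] at hneg
      rw [Prod.fst_sub, ha]
      exact sub_nonpos.2 (hβ.monotone.reflect_lt hneg).le) hL
  refine le_of_tendsto hsign (Eventually.of_forall fun k => ?_)
  set ζ : Lp ℝ 2 μ := (hL k).compLp (smoothSign_zero k) (ϑ₁ - ϑ₂).1
  have hζ : ∀ᵐ x ∂μ, ζ x ∈ Icc (0 : ℝ) 1 := by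
    filter_upwards [(hL k).coeFn_compLp (smoothSign_zero k) (ϑ₁ - ϑ₂).1] with x hx
    exact hx ▸ smoothSign_mem_Icc k _
  have htest := hV.inner_compLp_nonneg (hL k) (smoothSign_zero k) (contDiff_smoothSign k)
    (smoothSign_monotone k) (V.sub_mem h₁ h₂)
    (x := g₁ - g₂ - (superpose hβ ϑ₁.1 - superpose hβ ϑ₂.1)) hh (fun ψ hψ => by
      have he₁ := he₁ ψ hψ
      have he₂ := he₂ ψ hψ
      simp only [inner_sub_left, Prod.snd_sub]
      linarith)
  rw [inner_sub_left, sub_nonneg] at htest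
  exact (ENNReal.ofReal_le_ofReal htest).trans (ofReal_inner_le_posL1 _ hζ)

theorem IsMarkov.posL1_implicitEuler_sub_le (hV : IsMarkov V) (hβ : IsNonlinearity β)
    {v₁ v₂ : Lp ℝ 2 μ} {h : ℕ → ℝ} {f₁ f₂ z₁ z₂ : ℕ → Lp ℝ 2 μ} {ϑ₁ ϑ₂ : ℕ → Lp ℝ 2 μ × Y} {n : ℕ}
    (hh : ∀ k < n, 0 ≤ h k) (h₁ : IsImplicitEuler V (superpose hβ) v₁ h f₁ n z₁ ϑ₁)
    (h₂ : IsImplicitEuler V (superpose hβ) v₂ h f₂ n z₂ ϑ₂) :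
    posL1 (z₁ n - z₂ n) ≤ posL1 (v₁ - v₂) + ∑ k ∈ Finset.range n, posL1 (f₁ k - f₂ k) := by
  induction n with
  | zero => simp [h₁.initial, h₂.initial]
  | succ n ih =>
    have hn := n.lt_succ_self
    have hstep := hV.posL1_superpose_sub_le hβ (h₁.mem n hn) (h₂.mem n hn) (hh n hn)
      (g₁ := z₁ n + f₁ n) (g₂ := z₂ n + f₂ n)
      (fun ψ hψ => by
        have := h₁.equation n hn ψ hψ
        rw [h₁.eq_map n hn, inner_sub_left] at this
        rw [inner_add_left]
        linarith)
      (fun ψ hψ => by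
        have := h₂.equation n hn ψ hψ
        rw [h₂.eq_map n hn, inner_sub_left] at this
        rw [inner_add_left]
        linarith)
    rw [h₁.eq_map n hn, h₂.eq_map n hn, Finset.sum_range_succ, ← add_assoc]
    refine hstep.trans ?_
    rw [add_sub_add_comm]
    exact (posL1_add_le _ _).trans (add_le_add_left (ih (fun k hk => hh k (by omega))
      (h₁.of_le n.le_succ) (h₂.of_le n.le_succ)) _)

theorem sum_posL1_setIntegral_sub_le {f₁ f₂ : ℝ → Lp ℝ 2 μ} (hf₁ : Integrable f₁)
    (hf₂ : Integrable f₂) {n : ℕ} {t : ℕ → ℝ} (ht0 : t 0 = 0) (ht : ∀ k < n, t k < t (k + 1)) :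
    ∑ k ∈ Finset.range n, posL1 ((∫ τ in Ioc (t k) (t (k + 1)), f₁ τ)
      - ∫ τ in Ioc (t k) (t (k + 1)), f₂ τ) ≤ ∫⁻ τ in Ioc 0 (t n), posL1 (f₁ τ - f₂ τ) := by
  rw [← sum_setLIntegral_Ioc _ ht0 ht]
  refine Finset.sum_le_sum fun k _ => ?_
  rw [← integral_sub hf₁.integrableOn hf₂.integrableOn]
  exact posL1_setIntegral_le (hf₁.integrableOn.sub hf₂.integrableOn)

variable [CompleteSpace Y]

theorem IsMarkov.ofReal_inner_sub_le_of_isAdaptedGrid (hM : IsMarkov V)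
    (hV : IsClosed (V : Set (Lp ℝ 2 μ × Y))) {C : ℝ} (hC : ∀ a ∈ V, ‖a.1‖ ≤ C * ‖a.2‖)
    (hβ : IsNonlinearity β) {w₁ w₂ : ℝ → Lp ℝ 2 μ × Y} {f₁ f₂ : ℝ → Lp ℝ 2 μ} {v₁ v₂ : Lp ℝ 2 μ}
    (hw₁ : Integrable fun t => (w₁ t).2) (hw₂ : Integrable fun t => (w₂ t).2)
    (hf₁ : Integrable f₁) (hf₂ : Integrable f₂) {ε : ℝ} (hε : 0 ≤ ε) {n : ℕ} (hn : n ≠ 0)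
    {t : ℕ → ℝ} (ht₁ : IsAdaptedGrid V (superpose hβ) w₁ f₁ v₁ ε n t)
    (ht₂ : IsAdaptedGrid V (superpose hβ) w₂ f₂ v₂ ε n t) {ψ : Lp ℝ 2 μ × Y} (hψ : ψ ∈ V)
    (hψ1 : ∀ᵐ x ∂μ, ψ.1 x ∈ Icc (0 : ℝ) 1) :
    ENNReal.ofReal (inner ℝ (superpose hβ (w₁ (t n)).1 - superpose hβ (w₂ (t n)).1) ψ.1)
      ≤ posL1 (v₁ - v₂) + (∫⁻ τ in Ioc 0 (t n), posL1 (f₁ τ - f₂ τ))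
        + ENNReal.ofReal (2 * ‖ψ.2‖ * ε) := by
  have hh : ∀ k < n, 0 < t (k + 1) - t k := fun k hk => sub_pos.2 (ht₁.lt_succ k hk)
  have hsub := isSubgradient_superpose (μ := μ) hβ
  have hprim : ∀ f : Lp ℝ 2 μ, 0 ≤ ∫ x, (∫ r in (0 : ℝ)..f x, β r) ∂μ := fun _ =>
    integral_nonneg fun _ => hβ.primitive_nonneg _
  obtain ⟨z₁, ϑ₁, hz₁⟩ := exists_isImplicitEuler hV hC (continuous_superpose hβ) hprim hsub v₁
    (fun k => ∫ τ in Ioc (t k) (t (k + 1)), f₁ τ) hh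
  obtain ⟨z₂, ϑ₂, hz₂⟩ := exists_isImplicitEuler hV hC (continuous_superpose hβ) hprim hsub v₂
    (fun k => ∫ τ in Ioc (t k) (t (k + 1)), f₂ τ) hh
  have herr : inner ℝ (superpose hβ (w₁ (t n)).1 - superpose hβ (w₂ (t n)).1) ψ.1
      ≤ inner ℝ (z₁ n - z₂ n) ψ.1 + 2 * ‖ψ.2‖ * ε := by
    have h₁ := ht₁.abs_inner_implicitEuler_sub_le hsub.inner_sub_sub_nonneg hw₁ hf₁ hε hn hz₁ hψ
    have h₂ := ht₂.abs_inner_implicitEuler_sub_le hsub.inner_sub_sub_nonneg hw₂ hf₂ hε hn hz₂ hψ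
    simp only [inner_sub_left] at h₁ h₂ ⊢
    linarith [neg_le_of_abs_le h₁, le_of_abs_le h₂]
  refine (ENNReal.ofReal_le_ofReal herr).trans (ENNReal.ofReal_add_le.trans (add_le_add_left ?_ _))
  calc ENNReal.ofReal (inner ℝ (z₁ n - z₂ n) ψ.1)
      ≤ posL1 (z₁ n - z₂ n) := ofReal_inner_le_posL1 _ hψ1
    _ ≤ _ := hM.posL1_implicitEuler_sub_le hβ (fun k hk => (hh k hk).le) hz₁ hz₂
    _ ≤ _ := add_le_add_right (sum_posL1_setIntegral_sub_le hf₁ hf₂ ht₁.zero ht₁.lt_succ) _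

theorem IsMarkov.comparison (hM : IsMarkov V) (hV : IsClosed (V : Set (Lp ℝ 2 μ × Y))) {C : ℝ}
    (hC : ∀ a ∈ V, ‖a.1‖ ≤ C * ‖a.2‖) (hβ : IsNonlinearity β) {T : ℝ} (hT : 0 < T)
    {w₁ w₂ : ℝ → Lp ℝ 2 μ × Y} {f₁ f₂ : ℝ → Lp ℝ 2 μ} {v₁ v₂ : Lp ℝ 2 μ}
    (h₁ : IsEvolution V (superpose hβ) T w₁ f₁ v₁) (h₂ : IsEvolution V (superpose hβ) T w₂ f₂ v₂) :
    ∀ᵐ t₀ ∂(volume.restrict (Ioo 0 T)), ∀ ψ ∈ V, (∀ᵐ x ∂μ, ψ.1 x ∈ Icc (0 : ℝ) 1) →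
      ENNReal.ofReal (inner ℝ (superpose hβ (w₁ t₀).1 - superpose hβ (w₂ t₀).1) ψ.1)
        ≤ posL1 (v₁ - v₂) + ∫⁻ τ in Ioo 0 T, posL1 (f₁ τ - f₂ τ) := by
  filter_upwards [h₁.ae_exists_isAdaptedGrid hT h₂, ae_restrict_mem measurableSet_Ioo]
    with t₀ hgrid ht₀ ψ hψ hψ1
  refine ENNReal.le_of_forall_pos_le_add fun δ hδ _ => ?_
  obtain ⟨ε, hε, hεδ⟩ := exists_pos_mul_lt (NNReal.coe_pos.2 hδ) (2 * ‖ψ.2‖)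
  obtain ⟨n, t, hn, rfl, ht₁, ht₂⟩ := hgrid ε hε
  refine (hM.ofReal_inner_sub_le_of_isAdaptedGrid hV hC hβ h₁.integrable h₂.integrable
    h₁.integrable_source h₂.integrable_source hε.le hn ht₁ ht₂ hψ hψ1).trans ?_
  gcongr
  · exact ht₀.2
  · exact ENNReal.ofReal_le_of_le_toReal hεδ.le

end Markov

/-! ### Slices of measurable functions as `L²`-valued functions of time -/

section Slices

variable {α : Type*} [MeasurableSpace α] {μ : Measure α}

open scoped Classical in
/-- The class of `f` in `L²`, with the junk value `0` if `f` is not square integrable. -/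
noncomputable def lpOf (μ : Measure α) (f : α → ℝ) : Lp ℝ 2 μ :=
  if h : MemLp f 2 μ then h.toLp f else 0

theorem lpOf_of_memLp {f : α → ℝ} (h : MemLp f 2 μ) : lpOf μ f = h.toLp f := dif_pos h

theorem lpOf_of_not_memLp {f : α → ℝ} (h : ¬MemLp f 2 μ) : lpOf μ f = 0 := dif_neg h

theorem coeFn_lpOf {f : α → ℝ} (h : MemLp f 2 μ) : lpOf μ f =ᵐ[μ] f := by
  rw [lpOf_of_memLp h]
  exact h.coeFn_toLp

theorem lpOf_congr {f g : α → ℝ} (h : f =ᵐ[μ] g) : lpOf μ f = lpOf μ g := by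
  by_cases hf : MemLp f 2 μ
  · rw [lpOf_of_memLp hf, lpOf_of_memLp (hf.ae_eq h), MemLp.toLp_eq_toLp_iff]
    exact h
  · rw [lpOf_of_not_memLp hf, lpOf_of_not_memLp fun hg => hf (hg.ae_eq h.symm)]

theorem edist_lpOf {f : α → ℝ} (h : MemLp f 2 μ) (c : Lp ℝ 2 μ) :
    edist (lpOf μ f) c = eLpNorm (fun x => f x - c x) 2 μ := by
  rw [Lp.edist_def]
  refine eLpNorm_congr_ae ?_
  filter_upwards [coeFn_lpOf h] with x hx
  simp [hx]

theorem enorm_lpOf_sq {f : α → ℝ} (h : MemLp f 2 μ) :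
    ‖lpOf μ f‖ₑ ^ 2 = ∫⁻ x, ‖f x‖ₑ ^ 2 ∂μ := by
  rw [lpOf_of_memLp h, Lp.enorm_toLp, ← ENNReal.rpow_natCast,
    eLpNorm_eq_lintegral_rpow_enorm_toReal two_ne_zero ENNReal.ofNat_ne_top, ← ENNReal.rpow_mul]
  simp

theorem enorm_lpOf_sq_le (f : α → ℝ) : ‖lpOf μ f‖ₑ ^ 2 ≤ ∫⁻ x, ‖f x‖ₑ ^ 2 ∂μ := by
  by_cases hf : MemLp f 2 μ
  · exact (enorm_lpOf_sq hf).le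
  · simp [lpOf_of_not_memLp hf]

theorem lpOf_add {f g : α → ℝ} (hf : MemLp f 2 μ) (hg : MemLp g 2 μ) :
    lpOf μ f + lpOf μ g = lpOf μ fun x => f x + g x := by
  rw [lpOf_of_memLp hf, lpOf_of_memLp hg, ← MemLp.toLp_add hf hg]
  exact (lpOf_of_memLp (hf.add hg)).symm

theorem lpOf_sub {f g : α → ℝ} (hf : MemLp f 2 μ) (hg : MemLp g 2 μ) :
    lpOf μ f - lpOf μ g = lpOf μ fun x => f x - g x := by
  rw [lpOf_of_memLp hf, lpOf_of_memLp hg, ← MemLp.toLp_sub hf hg]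
  exact (lpOf_of_memLp (hf.sub hg)).symm

theorem lpOf_const_smul {f : α → ℝ} (hf : MemLp f 2 μ) (c : ℝ) :
    c • lpOf μ f = lpOf μ fun x => c * f x := by
  rw [lpOf_of_memLp hf, ← MemLp.toLp_const_smul c hf]
  exact (lpOf_of_memLp (hf.const_smul c)).symm

theorem inner_lpOf {f g : α → ℝ} (hf : MemLp f 2 μ) (hg : MemLp g 2 μ) :
    inner ℝ (lpOf μ f) (lpOf μ g) = ∫ x, f x * g x ∂μ := by
  rw [inner_eq_integral]
  refine integral_congr_ae ?_
  filter_upwards [coeFn_lpOf hf, coeFn_lpOf hg] with x hf hg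
  rw [hf, hg]

theorem memLp_two_iff_lintegral_enorm_sq {f : α → ℝ} (hf : AEStronglyMeasurable f μ) :
    MemLp f 2 μ ↔ ∫⁻ x, ‖f x‖ₑ ^ 2 ∂μ < ⊤ := by
  have hnorm := eLpNorm_lt_top_iff_lintegral_rpow_enorm_lt_top (f := f) (μ := μ) two_ne_zero
    ENNReal.ofNat_ne_top
  simp only [ENNReal.toReal_ofNat, ENNReal.rpow_ofNat] at hnorm
  rw [← hnorm]
  exact ⟨fun h => h.2, fun h => ⟨hf, h⟩⟩

variable {γ : Type*} [MeasurableSpace γ]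

theorem measurable_of_measurable_edist {X : Type*} [PseudoEMetricSpace X]
    [SecondCountableTopology X] [MeasurableSpace X] [BorelSpace X] {u : γ → X}
    (hu : ∀ c, Measurable fun t => edist (u t) c) : Measurable u := by
  refine measurable_of_isOpen fun U hU => ?_
  have hball : ∀ y : U, ∃ r : ℝ≥0∞, 0 < r ∧ Metric.eball (y : X) r ⊆ U := fun y =>
    EMetric.mem_nhds_iff.1 (hU.mem_nhds y.2)
  choose r hr hrU using hball
  obtain ⟨S, hS, hunion⟩ := TopologicalSpace.isOpen_iUnion_countable
    (fun y : U => Metric.eball (y : X) (r y)) fun y => Metric.isOpen_eball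
  have hU_eq : U = ⋃ y ∈ S, Metric.eball (y : X) (r y) := by
    rw [hunion]
    exact Subset.antisymm (fun y hy => mem_iUnion.2 ⟨⟨y, hy⟩, Metric.mem_eball_self (hr _)⟩)
      (iUnion_subset hrU)
  rw [hU_eq, preimage_iUnion₂]
  exact MeasurableSet.biUnion hS fun y _ => measurableSet_lt (hu y) measurable_const

variable [SFinite μ]

theorem measurable_eLpNorm_slice {G : γ × α → ℝ} (hG : StronglyMeasurable G) {p : ℝ≥0∞}
    (hp0 : p ≠ 0) (hp : p ≠ ⊤) : Measurable fun t => eLpNorm (fun x => G (t, x)) p μ := by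
  simp only [eLpNorm_eq_lintegral_rpow_enorm_toReal hp0 hp]
  exact ((hG.enorm.pow_const _).lintegral_prod_right' (ν := μ)).pow_const _

theorem measurableSet_memLp_slice {G : γ × α → ℝ} (hG : StronglyMeasurable G) {p : ℝ≥0∞}
    (hp0 : p ≠ 0) (hp : p ≠ ⊤) : MeasurableSet {t | MemLp (fun x => G (t, x)) p μ} := by
  have hiff : {t | MemLp (fun x => G (t, x)) p μ} = {t | eLpNorm (fun x => G (t, x)) p μ < ⊤} :=
    ext fun t => ⟨fun h => h.2, fun h =>
      ⟨(hG.comp_measurable measurable_prodMk_left).aestronglyMeasurable, h⟩⟩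
  rw [hiff]
  exact measurableSet_lt (measurable_eLpNorm_slice hG hp0 hp) measurable_const

variable [SecondCountableTopology (Lp ℝ 2 μ)]

theorem stronglyMeasurable_lpOf_slice {G : γ × α → ℝ} (hG : StronglyMeasurable G) :
    StronglyMeasurable fun t => lpOf μ fun x => G (t, x) := by
  classical
  borelize ↥(Lp ℝ 2 μ)
  refine (measurable_of_measurable_edist fun c => ?_).stronglyMeasurable
  have hpiecewise : (fun t => edist (lpOf μ fun x => G (t, x)) c)
      = {t | MemLp (fun x => G (t, x)) 2 μ}.piecewise
        (fun t => eLpNorm (fun x => G (t, x) - c x) 2 μ) fun _ => edist 0 c := by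
    ext t
    by_cases h : MemLp (fun x => G (t, x)) 2 μ
    · rw [piecewise_eq_of_mem _ _ _ (by exact h), edist_lpOf h]
    · rw [piecewise_eq_of_notMem _ _ _ (by exact h), lpOf_of_not_memLp h]
  rw [hpiecewise]
  exact (measurable_eLpNorm_slice
    (hG.sub ((Lp.stronglyMeasurable c).comp_measurable measurable_snd)) two_ne_zero
      ENNReal.ofNat_ne_top).piecewise
    (measurableSet_memLp_slice hG two_ne_zero ENNReal.ofNat_ne_top) measurable_const

variable {ν : Measure γ}

theorem aestronglyMeasurable_lpOf {F : γ → α → ℝ}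
    (hF : AEStronglyMeasurable (Function.uncurry F) (ν.prod μ)) :
    AEStronglyMeasurable (fun t => lpOf μ (F t)) ν :=
  ⟨_, stronglyMeasurable_lpOf_slice hF.stronglyMeasurable_mk,
    (Measure.ae_ae_of_ae_prod hF.ae_eq_mk).mono fun _ ht => lpOf_congr ht⟩

theorem memLp_lpOf {F : γ → α → ℝ}
    (hF : AEStronglyMeasurable (Function.uncurry F) (ν.prod μ))
    (h : ∫⁻ t, ∫⁻ x, ‖F t x‖ₑ ^ 2 ∂μ ∂ν < ⊤) : MemLp (fun t => lpOf μ (F t)) 2 ν := by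
  refine ⟨aestronglyMeasurable_lpOf hF, ?_⟩
  rw [eLpNorm_lt_top_iff_lintegral_rpow_enorm_lt_top two_ne_zero ENNReal.ofNat_ne_top]
  simp only [ENNReal.toReal_ofNat, ENNReal.rpow_ofNat]
  exact (lintegral_mono fun t => enorm_lpOf_sq_le (F t)).trans_lt h

end Slices

/-! ### Weak time derivatives with initial values -/

section Time

theorem integral_primitive_mul_deriv {a b : ℝ} {g η : ℝ → ℝ} (hg : IntervalIntegrable g volume a b)
    (hη : AbsolutelyContinuousOnInterval η a b) (c₀ : ℝ) :
    ∫ t in a..b, (c₀ + ∫ τ in a..t, g τ) * deriv η t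
      = (c₀ + ∫ τ in a..b, g τ) * η b - c₀ * η a - ∫ t in a..b, g t * η t := by
  have hprim : AbsolutelyContinuousOnInterval (fun t => c₀ + ∫ τ in a..t, g τ) a b :=
    contDiffOn_const.absolutelyContinuousOnInterval.fun_add
      (hg.absolutelyContinuousOnInterval_intervalIntegral left_mem_uIcc)
  have hderiv : ∫ t in a..b, deriv (fun t => c₀ + ∫ τ in a..t, g τ) t * η t
      = ∫ t in a..b, g t * η t := by
    refine intervalIntegral.integral_congr_ae ?_
    filter_upwards [hg.ae_hasDerivAt_integral] with t hderiv ht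
    rw [((hderiv (uIoc_subset_uIcc ht) a left_mem_uIcc).const_add c₀).deriv]
  rw [hprim.integral_mul_deriv_eq_deriv_mul hη, hderiv, intervalIntegral.integral_same, add_zero]

theorem exists_contDiff_deriv_eq {θ : ℝ → ℝ} (hθ : ContDiff ℝ ∞ θ) (b : ℝ) :
    ∃ Θ : ℝ → ℝ, ContDiff ℝ ∞ Θ ∧ deriv Θ = θ ∧ Θ b = 0 := by
  have hderiv : ∀ t, HasDerivAt (fun t => ∫ τ in b..t, θ τ) (θ t) t := fun t =>
    hθ.continuous.deriv_integral θ b t ▸ (intervalIntegral.differentiable_integral_of_continuous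
      hθ.continuous t).hasDerivAt
  have hderiv_eq : deriv (fun t => ∫ τ in b..t, θ τ) = θ := funext fun t => (hderiv t).deriv
  refine ⟨_, ?_, hderiv_eq, intervalIntegral.integral_same⟩
  rw [contDiff_infty_iff_deriv, hderiv_eq]
  exact ⟨fun t => (hderiv t).differentiableAt, hθ⟩

theorem exists_hasCompactSupport_deriv_eq {θ : ℝ → ℝ} (hθ : ContDiff ℝ ∞ θ)
    (hθc : HasCompactSupport θ) (a : ℝ) {b : ℝ} (hθb : tsupport θ ⊆ Iio b) :
    ∃ η : ℝ → ℝ, ContDiff ℝ ∞ η ∧ HasCompactSupport η ∧ tsupport η ⊆ Iio b ∧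
      ∀ t, a < t → deriv η t = θ t := by
  obtain ⟨Θ, hΘ, hderiv, hΘb⟩ := exists_contDiff_deriv_eq hθ b
  obtain ⟨c, hc, hmax⟩ := (hθc.isCompact.insert (b - 1)).exists_isGreatest (insert_nonempty _ _)
  have hcb : c < b := hc.elim (fun h => h ▸ sub_one_lt b) fun h => hθb h
  have hΘ_zero : ∀ t, c < t → Θ t = 0 := fun t ht => hΘb ▸
    isOpen_Ioi.is_const_of_deriv_eq_zero isPreconnected_Ioi
      (hΘ.differentiable (by simp)).differentiableOn (fun τ hτ => by
        rw [hderiv]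
        exact image_eq_zero_of_notMem_tsupport fun h => (hmax (mem_insert_of_mem _ h)).not_gt hτ)
      ht hcb
  set η : ℝ → ℝ := fun t => Real.smoothTransition (t - a + 1) * Θ t with hη
  have hη_supp : tsupport η ⊆ Icc (a - 1) c := by
    refine closure_minimal (fun t ht => ⟨?_, ?_⟩) isClosed_Icc
    · by_contra! h
      exact ht (by simp only [hη, Real.smoothTransition.zero_of_nonpos
        (show t - a + 1 ≤ 0 by linarith), zero_mul])
    · by_contra! h
      exact ht (by simp only [hη, hΘ_zero t h, mul_zero])
  refine ⟨η, (Real.smoothTransition.contDiff.comp (by fun_prop)).mul hΘ,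
    isCompact_Icc.of_isClosed_subset (isClosed_tsupport _) hη_supp,
    fun t ht => (hη_supp ht).2.trans_lt hcb, fun t ht => ?_⟩
  have hΘη : η =ᶠ[𝓝 t] Θ := by
    filter_upwards [Ioi_mem_nhds ht] with τ hτ
    simp only [hη, Real.smoothTransition.one_of_one_le
      (show 1 ≤ τ - a + 1 by linarith [mem_Ioi.1 hτ]), one_mul]
  rw [hΘη.deriv_eq, hderiv]

theorem ae_eq_primitive_of_weak {a b : ℝ} (hab : a ≤ b) {u g : ℝ → ℝ} {c₀ : ℝ}
    (hu : IntervalIntegrable u volume a b) (hg : IntervalIntegrable g volume a b)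
    (h : ∀ η : ℝ → ℝ, ContDiff ℝ ∞ η → HasCompactSupport η → tsupport η ⊆ Iio b →
      -(∫ t in a..b, u t * deriv η t) = (∫ t in a..b, g t * η t) + c₀ * η a) :
    ∀ᵐ t, t ∈ Ioo a b → u t = c₀ + ∫ τ in a..t, g τ := by
  set P : ℝ → ℝ := fun t => c₀ + ∫ τ in a..t, g τ
  have hPi : IntervalIntegrable P volume a b :=
    (continuousOn_const.add (intervalIntegral.continuousOn_primitive_interval'
      hg left_mem_uIcc)).intervalIntegrable
  have hdiff : IntegrableOn (fun t => u t - P t) (Ioo a b) :=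
    (intervalIntegrable_iff_integrableOn_Ioo_of_le hab).1 (hu.sub hPi)
  have hzero := isOpen_Ioo.ae_eq_zero_of_integral_contDiff_smul_eq_zero hdiff.locallyIntegrableOn
    fun θ hθ hθc hθs => by
      obtain ⟨η, hη, hηc, hηb, hηθ⟩ := exists_hasCompactSupport_deriv_eq hθ hθc a
        (hθs.trans fun _ h => h.2)
      have hη' : ContinuousOn (deriv η) (uIcc a b) := (hη.continuous_deriv (by simp)).continuousOn
      have hweak := h η hη hηc hηb
      have hparts := integral_primitive_mul_deriv hg
        (hη.of_le (by simp)).contDiffOn.absolutelyContinuousOnInterval c₀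
      rw [image_eq_zero_of_notMem_tsupport fun hb => lt_irrefl b (hηb hb), mul_zero] at hparts
      calc ∫ t, θ t • (u t - P t)
          = ∫ t in a..b, θ t * (u t - P t) := by
            rw [intervalIntegral.integral_of_le hab, integral_Ioc_eq_integral_Ioo]
            refine (setIntegral_eq_integral_of_forall_compl_eq_zero fun t ht => ?_).symm
            rw [image_eq_zero_of_notMem_tsupport fun h' => ht (hθs h'), zero_smul]
        _ = ∫ t in a..b, (u t * deriv η t - P t * deriv η t) :=
            intervalIntegral.integral_congr_ae (Eventually.of_forall fun t ht => by
              rw [uIoc_of_le hab] at ht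
              rw [hηθ t ht.1]
              ring)
        _ = (∫ t in a..b, u t * deriv η t) - ∫ t in a..b, P t * deriv η t :=
            intervalIntegral.integral_sub (hu.mul_continuousOn hη') (hPi.mul_continuousOn hη')
        _ = 0 := by linarith
  filter_upwards [hzero] with t ht ht'
  exact sub_eq_zero.1 (ht ht')

end Time

/-! ### The energy of test functions -/

section Energy

variable {n : ℕ} {s : ℝ} {K : Rn n → Rn n → ℝ} {Ω : Set (Rn n)}

/-- The test functions `C_c^∞(Ω)`. -/
structure IsTest (Ω : Set (Rn n)) (ζ : Rn n → ℝ) : Prop where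
  contDiff : ContDiff ℝ ∞ ζ
  hasCompactSupport : HasCompactSupport ζ
  tsupport_subset : tsupport ζ ⊆ Ω

theorem IsTest.eq_zero {ζ : Rn n → ℝ} (hζ : IsTest Ω ζ) {x : Rn n} (hx : x ∉ Ω) : ζ x = 0 :=
  image_eq_zero_of_notMem_tsupport fun h => hx (hζ.tsupport_subset h)

theorem IsTest.comp {ζ : Rn n → ℝ} (hζ : IsTest Ω ζ) {G : ℝ → ℝ} (hG : ContDiff ℝ ∞ G)
    (h0 : G 0 = 0) : IsTest Ω fun x => G (ζ x) :=
  ⟨hG.comp hζ.contDiff, hζ.hasCompactSupport.comp_left h0,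
    (tsupport_comp_subset h0 ζ).trans hζ.tsupport_subset⟩

theorem IsTest.add {ζ ξ : Rn n → ℝ} (hζ : IsTest Ω ζ) (hξ : IsTest Ω ξ) :
    IsTest Ω fun x => ζ x + ξ x :=
  ⟨hζ.contDiff.add hξ.contDiff, hζ.hasCompactSupport.add hξ.hasCompactSupport,
    (tsupport_add ζ ξ).trans (union_subset hζ.tsupport_subset hξ.tsupport_subset)⟩

theorem IsTest.zero : IsTest Ω fun _ => 0 :=
  ⟨contDiff_const, HasCompactSupport.zero, by simp [tsupport]⟩

theorem integrable_levy_weight (hn : 1 ≤ n) (hs : 0 < s) (hs1 : s < 1) :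
    Integrable fun z : Rn n => min 1 (‖z‖ ^ 2) / ‖z‖ ^ ((n : ℝ) + 2 * s) := by
  have : Nonempty (Fin n) := ⟨⟨0, hn⟩⟩
  rw [integrable_fun_norm_addHaar volume
    (f := fun r : ℝ => min 1 (r ^ 2) / r ^ ((n : ℝ) + 2 * s)), finrank_euclideanSpace_fin,
    ← Ioc_union_Ioi_eq_Ioi (zero_le_one (α := ℝ))]
  have hpow (r : ℝ) : r ^ (n - 1) = r ^ ((n : ℝ) - 1) := by
    rw [← Real.rpow_natCast, Nat.cast_sub hn, Nat.cast_one]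
  refine IntegrableOn.union ?near_zero ?at_infinity
  case near_zero =>
    have hint : IntegrableOn (fun r : ℝ => r ^ (1 - 2 * s)) (Ioc 0 1) := by
      rw [integrableOn_Ioc_iff_integrableOn_Ioo,
        intervalIntegral.integrableOn_Ioo_rpow_iff one_pos]
      linarith
    refine hint.congr_fun (fun r hr => ?_) measurableSet_Ioc
    have hr0 : 0 < r := hr.1
    simp only [smul_eq_mul]
    rw [min_eq_right (pow_le_one₀ hr0.le hr.2), hpow r, ← Real.rpow_natCast r 2,
      ← Real.rpow_sub hr0, ← Real.rpow_add hr0]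
    congr 1
    push_cast
    ring
  case at_infinity =>
    have hint : IntegrableOn (fun r : ℝ => r ^ (-1 - 2 * s)) (Ioi 1) :=
      integrableOn_Ioi_rpow_of_lt (by linarith) one_pos
    refine hint.congr_fun (fun r hr => ?_) measurableSet_Ioi
    have hr0 : 0 < r := one_pos.trans hr
    simp only [smul_eq_mul]
    rw [min_eq_left (one_le_pow₀ (le_of_lt hr)), hpow r, mul_one_div, ← Real.rpow_sub hr0]
    congr 1
    ring

theorem sq_abs_sub_le_mul_min {E : Type*} [SeminormedAddCommGroup E] {ζ : E → ℝ} {L : ℝ≥0} {B : ℝ}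
    (hL : LipschitzWith L ζ) (hB : ∀ x, ‖ζ x‖ ≤ B) (x y : E) :
    |ζ x - ζ y| ^ 2 ≤ max ((2 * B) ^ 2) ((L : ℝ) ^ 2) * min 1 (‖x - y‖ ^ 2) := by
  have hlip : |ζ x - ζ y| ≤ L * ‖x - y‖ := by simpa [dist_eq_norm] using hL.dist_le_mul x y
  have hbdd : |ζ x - ζ y| ≤ 2 * B :=
    (norm_sub_le (ζ x) (ζ y)).trans (by linarith [hB x, hB y])
  rw [mul_min_of_nonneg _ _ ((sq_nonneg _).trans (le_max_left _ _)), mul_one]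
  refine le_min ((pow_le_pow_left₀ (abs_nonneg _) hbdd 2).trans (le_max_left _ _)) ?_
  calc |ζ x - ζ y| ^ 2 ≤ (L * ‖x - y‖) ^ 2 := pow_le_pow_left₀ (abs_nonneg _) hlip 2
    _ = (L : ℝ) ^ 2 * ‖x - y‖ ^ 2 := mul_pow _ _ 2
    _ ≤ _ := by gcongr; exact le_max_right _ _

theorem lintegral_lintegral_indicator_add_mul_sub {G : Type*} [AddGroup G] [MeasurableSpace G]
    [MeasurableAdd₂ G] [MeasurableNeg G] {μ : Measure G} [SFinite μ] [μ.IsAddLeftInvariant]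
    [μ.IsAddRightInvariant] [μ.IsNegInvariant] {S : Set G} (hS : MeasurableSet S) {κ : G → ℝ≥0∞}
    (hκ : Measurable κ) :
    ∫⁻ x, ∫⁻ y, (S.indicator 1 x + S.indicator 1 y) * κ (x - y) ∂μ ∂μ
      = 2 * (μ S * ∫⁻ z, κ z ∂μ) := by
  have hS1 : Measurable (S.indicator (1 : G → ℝ≥0∞)) := measurable_one.indicator hS
  have hfst : ∫⁻ x, ∫⁻ y, S.indicator 1 x * κ (x - y) ∂μ ∂μ = μ S * ∫⁻ z, κ z ∂μ := by
    have hinner : ∀ x : G, ∫⁻ y, S.indicator 1 x * κ (x - y) ∂μ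
        = S.indicator 1 x * ∫⁻ z, κ z ∂μ := fun x => by
      rw [lintegral_const_mul _ (by fun_prop), lintegral_sub_left_eq_self]
    simp_rw [hinner]
    rw [lintegral_mul_const _ hS1, lintegral_indicator_one hS]
  have hsnd : ∫⁻ x, ∫⁻ y, S.indicator 1 y * κ (x - y) ∂μ ∂μ = μ S * ∫⁻ z, κ z ∂μ := by
    have hinner : ∀ y : G, ∫⁻ x, S.indicator 1 y * κ (x - y) ∂μ
        = S.indicator 1 y * ∫⁻ z, κ z ∂μ := fun y => by
      rw [lintegral_const_mul _ (by fun_prop), lintegral_sub_right_eq_self]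
    rw [lintegral_lintegral_swap (by fun_prop)]
    simp_rw [hinner]
    rw [lintegral_mul_const _ hS1, lintegral_indicator_one hS]
  simp_rw [add_mul]
  have hsplit : ∀ x : G, ∫⁻ y, (S.indicator 1 x * κ (x - y) + S.indicator 1 y * κ (x - y)) ∂μ
      = (∫⁻ y, S.indicator 1 x * κ (x - y) ∂μ) + ∫⁻ y, S.indicator 1 y * κ (x - y) ∂μ :=
    fun x => lintegral_add_left (by fun_prop) _
  simp_rw [hsplit]
  rw [lintegral_add_left (by fun_prop), hfst, hsnd, two_mul]

theorem gagliardoSq_lt_top_of_lipschitzWith (hn : 1 ≤ n) (hs : 0 < s) (hs1 : s < 1)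
    {ζ : Rn n → ℝ} {L : ℝ≥0} (hL : LipschitzWith L ζ) {B : ℝ} (hB : ∀ x, ‖ζ x‖ ≤ B)
    {S : Set (Rn n)} (hS : MeasurableSet S) (hSfin : volume S < ⊤) (hζS : ∀ x ∉ S, ζ x = 0) :
    gagliardoSq s ζ < ⊤ := by
  set M : ℝ := max ((2 * B) ^ 2) ((L : ℝ) ^ 2)
  have : 0 ≤ M := (sq_nonneg _).trans (le_max_left _ _)
  set κ : Rn n → ℝ≥0∞ := fun z =>
    ENNReal.ofReal (M * (min 1 (‖z‖ ^ 2) / ‖z‖ ^ ((n : ℝ) + 2 * s)))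
  have hκ : Measurable κ := by fun_prop
  have hle : ∀ x y, ENNReal.ofReal (|ζ x - ζ y| ^ 2 / ‖x - y‖ ^ ((n : ℝ) + 2 * s))
      ≤ (S.indicator 1 x + S.indicator 1 y) * κ (x - y) := by
    intro x y
    have hκle : ENNReal.ofReal (|ζ x - ζ y| ^ 2 / ‖x - y‖ ^ ((n : ℝ) + 2 * s)) ≤ κ (x - y) := by
      refine ENNReal.ofReal_le_ofReal ?_
      rw [← mul_div_assoc]
      gcongr
      exact sq_abs_sub_le_mul_min hL hB x y
    by_cases hx : x ∈ S
    · exact hκle.trans (le_mul_of_one_le_left zero_le (by simp [hx]))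
    by_cases hy : y ∈ S
    · exact hκle.trans (le_mul_of_one_le_left zero_le (by simp [hy]))
    simp [hζS x hx, hζS y hy]
  refine (lintegral_mono fun x => lintegral_mono fun y => hle x y).trans_lt ?_
  rw [lintegral_lintegral_indicator_add_mul_sub hS hκ]
  exact ENNReal.mul_lt_top (by simp) (ENNReal.mul_lt_top hSfin
    ((integrable_levy_weight hn hs hs1).const_mul M).lintegral_lt_top)

theorem IsTest.gagliardoSq_lt_top (hn : 1 ≤ n) (hs : 0 < s) (hs1 : s < 1) {ζ : Rn n → ℝ}
    (hζ : IsTest Ω ζ) : gagliardoSq s ζ < ⊤ := by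
  obtain ⟨L, hL⟩ := hζ.contDiff.lipschitzWith_of_hasCompactSupport hζ.hasCompactSupport (by simp)
  obtain ⟨B, hB⟩ := hζ.contDiff.continuous.bounded_above_of_compact_support hζ.hasCompactSupport
  exact gagliardoSq_lt_top_of_lipschitzWith hn hs hs1 hL hB (isClosed_tsupport ζ).measurableSet
    hζ.hasCompactSupport.isCompact.measure_lt_top fun _ => image_eq_zero_of_notMem_tsupport

theorem ofReal_abs_sq (a : ℝ) : ENNReal.ofReal (|a| ^ 2) = ‖a‖ₑ ^ 2 := by
  rw [ENNReal.ofReal_pow (abs_nonneg a), ← Real.norm_eq_abs, ofReal_norm]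

theorem memHs_iff {u : Rn n → ℝ} : MemHs s u ↔ MemLp u 2 ∧ gagliardoSq s u < ⊤ := by
  simp only [MemHs, hsNormSq, ofReal_abs_sq, ENNReal.add_lt_top, ← and_assoc]
  exact and_congr_left fun _ =>
    ⟨fun h => (memLp_two_iff_lintegral_enorm_sq h.1).2 h.2,
      fun h => ⟨h.1, (memLp_two_iff_lintegral_enorm_sq h.1).1 h⟩⟩

theorem IsTest.memHs (hn : 1 ≤ n) (hs : 0 < s) (hs1 : s < 1) {ζ : Rn n → ℝ}
    (hζ : IsTest Ω ζ) : MemHs s ζ :=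
  memHs_iff.2 ⟨hζ.contDiff.continuous.memLp_of_hasCompactSupport hζ.hasCompactSupport,
    hζ.gagliardoSq_lt_top hn hs hs1⟩

/-- The square root of the kernel of the bilinear form. -/
noncomputable def sqrtKernel (s : ℝ) (K : Rn n → Rn n → ℝ) (p : Rn n × Rn n) : ℝ :=
  √(K p.1 p.2 / ‖p.1 - p.2‖ ^ ((n : ℝ) + 2 * s))

/-- The nonlocal gradient with `B_K(u,v) = ∫ (D u) (D v)`. -/
noncomputable def nlGrad (s : ℝ) (K : Rn n → Rn n → ℝ) (u : Rn n → ℝ) (p : Rn n × Rn n) : ℝ :=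
  sqrtKernel s K p * (u p.1 - u p.2)

theorem IsKernel.nonneg (hK : IsKernel K) (x y : Rn n) : 0 ≤ K x y := by
  obtain ⟨l, L, hl, -, h⟩ := hK.elliptic
  exact hl.le.trans (h x y).1

theorem nlGrad_mul (hK : IsKernel K) (u v : Rn n → ℝ) (p : Rn n × Rn n) :
    nlGrad s K u p * nlGrad s K v p
      = K p.1 p.2 * ((u p.1 - u p.2) * (v p.1 - v p.2) / ‖p.1 - p.2‖ ^ ((n : ℝ) + 2 * s)) := by
  have h : sqrtKernel s K p * sqrtKernel s K p = K p.1 p.2 / ‖p.1 - p.2‖ ^ ((n : ℝ) + 2 * s) :=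
    Real.mul_self_sqrt (div_nonneg (hK.nonneg _ _) (by positivity))
  calc _ = sqrtKernel s K p * sqrtKernel s K p * ((u p.1 - u p.2) * (v p.1 - v p.2)) := by
        unfold nlGrad; ring
    _ = _ := by rw [h]; ring

theorem bilin_eq_integral (hK : IsKernel K) (u v : Rn n → ℝ) :
    bilin s K u v = ∫ p, nlGrad s K u p * nlGrad s K v p :=
  integral_congr_ae (Eventually.of_forall fun p => (nlGrad_mul hK u v p).symm)

theorem nlGrad_add (u v : Rn n → ℝ) (p : Rn n × Rn n) :
    nlGrad s K (fun x => u x + v x) p = nlGrad s K u p + nlGrad s K v p := by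
  unfold nlGrad; ring

theorem nlGrad_sub (u v : Rn n → ℝ) (p : Rn n × Rn n) :
    nlGrad s K (fun x => u x - v x) p = nlGrad s K u p - nlGrad s K v p := by
  unfold nlGrad; ring

theorem nlGrad_smul (c : ℝ) (u : Rn n → ℝ) (p : Rn n × Rn n) :
    nlGrad s K (fun x => c * u x) p = c * nlGrad s K u p := by
  unfold nlGrad; ring

theorem aemeasurable_sqrtKernel (hK : IsKernel K) : AEMeasurable (sqrtKernel s K) := by
  have hnum : AEMeasurable (fun p : Rn n × Rn n => K p.1 p.2) := hK.aemeasurable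
  have hden : Measurable fun p : Rn n × Rn n => ‖p.1 - p.2‖ ^ ((n : ℝ) + 2 * s) := by fun_prop
  exact (hnum.div hden.aemeasurable).sqrt

theorem aestronglyMeasurable_nlGrad (hK : IsKernel K) {u : Rn n → ℝ}
    (hu : AEStronglyMeasurable u) : AEStronglyMeasurable (nlGrad s K u) := by
  refine (aemeasurable_sqrtKernel hK).aestronglyMeasurable.mul ?_
  exact (hu.comp_quasiMeasurePreserving Measure.quasiMeasurePreserving_fst).sub
    (hu.comp_quasiMeasurePreserving Measure.quasiMeasurePreserving_snd)

theorem nlGrad_congr {u v : Rn n → ℝ} (h : u =ᵐ[volume] v) :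
    nlGrad s K u =ᵐ[volume] nlGrad s K v := by
  have h1 : ∀ᵐ p : Rn n × Rn n, u p.1 = v p.1 := Measure.quasiMeasurePreserving_fst.ae h
  have h2 : ∀ᵐ p : Rn n × Rn n, u p.2 = v p.2 := Measure.quasiMeasurePreserving_snd.ae h
  filter_upwards [h1, h2] with p h1 h2
  simp only [nlGrad, h1, h2]

theorem enorm_nlGrad_sq (hK : IsKernel K) (u : Rn n → ℝ) (p : Rn n × Rn n) :
    ‖nlGrad s K u p‖ₑ ^ 2 = ENNReal.ofReal (K p.1 p.2 *
      (|u p.1 - u p.2| ^ 2 / ‖p.1 - p.2‖ ^ ((n : ℝ) + 2 * s))) := by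
  rw [← ofReal_abs_sq, sq_abs, sq, nlGrad_mul hK, sq_abs, sq]

theorem gagliardoSq_eq_lintegral_prod {u : Rn n → ℝ} (hu : AEStronglyMeasurable u) :
    gagliardoSq s u = ∫⁻ p : Rn n × Rn n,
      ENNReal.ofReal (|u p.1 - u p.2| ^ 2 / ‖p.1 - p.2‖ ^ ((n : ℝ) + 2 * s)) := by
  have hm : AEMeasurable fun p : Rn n × Rn n =>
      ENNReal.ofReal (|u p.1 - u p.2| ^ 2 / ‖p.1 - p.2‖ ^ ((n : ℝ) + 2 * s)) := by
    have hnum : AEStronglyMeasurable fun p : Rn n × Rn n => u p.1 - u p.2 :=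
      (hu.comp_quasiMeasurePreserving Measure.quasiMeasurePreserving_fst).sub
        (hu.comp_quasiMeasurePreserving Measure.quasiMeasurePreserving_snd)
    have hden : Measurable fun p : Rn n × Rn n => ‖p.1 - p.2‖ ^ ((n : ℝ) + 2 * s) := by fun_prop
    exact ((hnum.aemeasurable.abs.pow_const 2).div hden.aemeasurable).ennreal_ofReal
  rw [Measure.volume_eq_prod, lintegral_prod _ hm]
  rfl

theorem exists_lintegral_nlGrad_le (hK : IsKernel K) (s : ℝ) : ∃ C : ℝ, 0 ≤ C ∧
    ∀ u : Rn n → ℝ, AEStronglyMeasurable u →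
      ∫⁻ p, ‖nlGrad s K u p‖ₑ ^ 2 ≤ ENNReal.ofReal C * gagliardoSq s u := by
  obtain ⟨l, L, hl, hlL, h⟩ := hK.elliptic
  refine ⟨L, hl.le.trans hlL, fun u hu => ?_⟩
  rw [gagliardoSq_eq_lintegral_prod hu, ← lintegral_const_mul' _ _ ENNReal.ofReal_ne_top]
  refine lintegral_mono fun p => ?_
  rw [enorm_nlGrad_sq hK, ← ENNReal.ofReal_mul (hl.le.trans hlL)]
  refine ENNReal.ofReal_le_ofReal ?_
  gcongr
  exact (h _ _).2

theorem exists_gagliardoSq_le (hK : IsKernel K) (s : ℝ) : ∃ C : ℝ, 0 ≤ C ∧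
    ∀ u : Rn n → ℝ, AEStronglyMeasurable u →
      gagliardoSq s u ≤ ENNReal.ofReal C * ∫⁻ p, ‖nlGrad s K u p‖ₑ ^ 2 := by
  obtain ⟨l, L, hl, -, h⟩ := hK.elliptic
  refine ⟨l⁻¹, (inv_pos.2 hl).le, fun u hu => ?_⟩
  rw [gagliardoSq_eq_lintegral_prod hu, ← lintegral_const_mul' _ _ ENNReal.ofReal_ne_top]
  refine lintegral_mono fun p => ?_
  rw [enorm_nlGrad_sq hK, ← ENNReal.ofReal_mul (inv_pos.2 hl).le]
  refine ENNReal.ofReal_le_ofReal ?_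
  rw [← mul_assoc]
  refine le_mul_of_one_le_left (by positivity) ?_
  rw [inv_mul_eq_div, one_le_div hl]
  exact (h _ _).1

theorem MemHs.memLp {u : Rn n → ℝ} (hu : MemHs s u) : MemLp u 2 := (memHs_iff.1 hu).1

theorem MemHs.memLp_nlGrad (hK : IsKernel K) {u : Rn n → ℝ} (hu : MemHs s u) :
    MemLp (nlGrad s K u) 2 := by
  rw [memLp_two_iff_lintegral_enorm_sq (aestronglyMeasurable_nlGrad hK hu.1)]
  obtain ⟨C, -, hC⟩ := exists_lintegral_nlGrad_le hK s
  exact (hC u hu.1).trans_lt (ENNReal.mul_lt_top ENNReal.ofReal_lt_top (memHs_iff.1 hu).2)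

end Energy
/-! ### The energy space -/

section EnergySpace

variable {n : ℕ} {s : ℝ} {K : Rn n → Rn n → ℝ} {Ω : Set (Rn n)}

/-- The ambient space of the energy space: a function on `Ω` and its nonlocal gradient. -/
abbrev PairSpace (Ω : Set (Rn n)) : Type :=
  Lp ℝ 2 ((volume : Measure (Rn n)).restrict Ω) × Lp ℝ 2 (volume : Measure (Rn n × Rn n))

/-- A function on `Ω` together with its nonlocal gradient. -/
noncomputable def energyPair (s : ℝ) (K : Rn n → Rn n → ℝ) (Ω : Set (Rn n)) (u : Rn n → ℝ) :
    PairSpace Ω :=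
  (lpOf _ u, lpOf _ (nlGrad s K u))

theorem energyPair_add (hK : IsKernel K) {u v : Rn n → ℝ} (hu : MemHs s u) (hv : MemHs s v) :
    energyPair s K Ω u + energyPair s K Ω v = energyPair s K Ω fun x => u x + v x := by
  simp only [energyPair, Prod.mk_add_mk]
  rw [lpOf_add (hu.memLp.restrict Ω) (hv.memLp.restrict Ω),
    lpOf_add (hu.memLp_nlGrad hK) (hv.memLp_nlGrad hK)]
  simp only [← nlGrad_add]

theorem energyPair_sub (hK : IsKernel K) {u v : Rn n → ℝ} (hu : MemHs s u) (hv : MemHs s v) :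
    energyPair s K Ω u - energyPair s K Ω v = energyPair s K Ω fun x => u x - v x := by
  simp only [energyPair, Prod.mk_sub_mk]
  rw [lpOf_sub (hu.memLp.restrict Ω) (hv.memLp.restrict Ω),
    lpOf_sub (hu.memLp_nlGrad hK) (hv.memLp_nlGrad hK)]
  simp only [← nlGrad_sub]

theorem energyPair_smul (hK : IsKernel K) {u : Rn n → ℝ} (hu : MemHs s u) (c : ℝ) :
    c • energyPair s K Ω u = energyPair s K Ω fun x => c * u x := by
  simp only [energyPair, Prod.smul_mk]
  rw [lpOf_const_smul (hu.memLp.restrict Ω), lpOf_const_smul (hu.memLp_nlGrad hK)]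
  simp only [← nlGrad_smul]

/-- The space of test functions, as a space of pairs. -/
noncomputable def testSpace (s : ℝ) (K : Rn n → Rn n → ℝ) (Ω : Set (Rn n)) :
    Submodule ℝ (PairSpace Ω) :=
  Submodule.span ℝ (energyPair s K Ω '' {ζ | IsTest Ω ζ})

theorem mem_testSpace (hn : 1 ≤ n) (hs : 0 < s) (hs1 : s < 1) (hK : IsKernel K) {a : PairSpace Ω} :
    a ∈ testSpace s K Ω ↔ ∃ ζ, IsTest Ω ζ ∧ energyPair s K Ω ζ = a := by
  refine ⟨fun ha => ?_, fun ha => Submodule.subset_span ha⟩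
  induction ha using Submodule.span_induction with
  | mem _ ha => exact ha
  | zero =>
    have h := energyPair_smul (Ω := Ω) hK ((IsTest.zero (Ω := Ω)).memHs hn hs hs1) 0
    exact ⟨_, IsTest.zero, by simpa only [zero_smul, mul_zero] using h.symm⟩
  | add _ _ _ _ iha ihb =>
    obtain ⟨ζ, hζ, rfl⟩ := iha
    obtain ⟨ξ, hξ, rfl⟩ := ihb
    exact ⟨_, hζ.add hξ, (energyPair_add hK (hζ.memHs hn hs hs1) (hξ.memHs hn hs hs1)).symm⟩
  | smul c _ _ iha =>
    obtain ⟨ζ, hζ, rfl⟩ := iha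
    exact ⟨_, hζ.comp (contDiff_const.mul contDiff_id) (mul_zero c),
      (energyPair_smul hK (hζ.memHs hn hs hs1) c).symm⟩

/-- The space `H̃^s(Ω)`, as a closed subspace of the space of pairs. -/
noncomputable def energySpace (s : ℝ) (K : Rn n → Rn n → ℝ) (Ω : Set (Rn n)) :
    Submodule ℝ (PairSpace Ω) :=
  (testSpace s K Ω).topologicalClosure

theorem isClosed_energySpace : IsClosed (energySpace s K Ω : Set (PairSpace Ω)) :=
  Submodule.isClosed_topologicalClosure _

theorem IsTest.mem_energySpace {ζ : Rn n → ℝ} (hζ : IsTest Ω ζ) :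
    energyPair s K Ω ζ ∈ energySpace s K Ω :=
  Submodule.le_topologicalClosure _ (Submodule.subset_span (mem_image_of_mem _ hζ))

theorem exists_isTest_norm_sub_lt (hn : 1 ≤ n) (hs : 0 < s) (hs1 : s < 1) (hK : IsKernel K)
    {a : PairSpace Ω} (ha : a ∈ energySpace s K Ω) {η : ℝ} (hη : 0 < η) :
    ∃ ζ, IsTest Ω ζ ∧ ‖a - energyPair s K Ω ζ‖ < η := by
  obtain ⟨b, hb, hab⟩ := Metric.mem_closure_iff.1 ha η hη
  obtain ⟨ζ, hζ, rfl⟩ := (mem_testSpace hn hs hs1 hK).1 hb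
  exact ⟨ζ, hζ, dist_eq_norm a _ ▸ hab⟩

theorem mem_of_mem_energySpace (hn : 1 ≤ n) (hs : 0 < s) (hs1 : s < 1) (hK : IsKernel K)
    {S : Set (PairSpace Ω)} (hS : IsClosed S) (h : ∀ ζ, IsTest Ω ζ → energyPair s K Ω ζ ∈ S)
    {a : PairSpace Ω} (ha : a ∈ energySpace s K Ω) : a ∈ S := by
  refine closure_minimal (fun b hb => ?_) hS ha
  obtain ⟨ζ, hζ, rfl⟩ := (mem_testSpace hn hs hs1 hK).1 hb
  exact h ζ hζ

theorem norm_lt_of_enorm_sq_lt {E : Type*} [NormedAddCommGroup E] {a : E} {ε : ℝ} (hε : 0 < ε)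
    (h : ‖a‖ₑ ^ 2 < ENNReal.ofReal (ε ^ 2)) : ‖a‖ < ε := by
  rw [← ofReal_norm, ← ENNReal.ofReal_pow (norm_nonneg _),
    ENNReal.ofReal_lt_ofReal_iff (by positivity)] at h
  exact lt_of_pow_lt_pow_left₀ 2 hε.le h

theorem norm_le_sqrt_mul_norm_of_enorm_sq_le {E F : Type*} [SeminormedAddCommGroup E]
    [SeminormedAddCommGroup F] {a : E} {b : F} {C : ℝ} (hC : 0 ≤ C)
    (h : ‖a‖ₑ ^ 2 ≤ ENNReal.ofReal C * ‖b‖ₑ ^ 2) : ‖a‖ ≤ √C * ‖b‖ := by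
  rw [← ofReal_norm a, ← ofReal_norm b, ← ENNReal.ofReal_pow (norm_nonneg _),
    ← ENNReal.ofReal_pow (norm_nonneg _), ← ENNReal.ofReal_mul hC,
    ENNReal.ofReal_le_ofReal_iff (by positivity)] at h
  refine (pow_le_pow_iff_left₀ (norm_nonneg _) (by positivity) two_ne_zero).1 ?_
  rwa [mul_pow, Real.sq_sqrt hC]

theorem lintegral_enorm_sq_le_hsNormSq (u : Rn n → ℝ) : ∫⁻ x, ‖u x‖ₑ ^ 2 ≤ hsNormSq s u := by
  simp only [← ofReal_abs_sq]
  exact le_self_add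

theorem exists_enorm_energyPair_sq_le (hK : IsKernel K) (s : ℝ) (Ω : Set (Rn n)) :
    ∃ C : ℝ, 0 < C ∧ ∀ u : Rn n → ℝ, AEStronglyMeasurable u →
      ‖energyPair s K Ω u‖ₑ ^ 2 ≤ ENNReal.ofReal C * hsNormSq s u := by
  obtain ⟨C, hC, hCu⟩ := exists_lintegral_nlGrad_le hK s
  refine ⟨C + 1, by positivity, fun u hu => ?_⟩
  have hfst : ‖lpOf (volume.restrict Ω) u‖ₑ ^ 2 ≤ ENNReal.ofReal (C + 1) * hsNormSq s u :=
    calc ‖lpOf (volume.restrict Ω) u‖ₑ ^ 2 ≤ ∫⁻ x, ‖u x‖ₑ ^ 2 :=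
          (enorm_lpOf_sq_le _).trans (lintegral_mono' Measure.restrict_le_self le_rfl)
      _ ≤ hsNormSq s u := lintegral_enorm_sq_le_hsNormSq u
      _ ≤ ENNReal.ofReal (C + 1) * hsNormSq s u :=
          le_mul_of_one_le_left zero_le (ENNReal.one_le_ofReal.2 (by linarith))
  have hsnd : ‖lpOf volume (nlGrad s K u)‖ₑ ^ 2 ≤ ENNReal.ofReal (C + 1) * hsNormSq s u :=
    calc ‖lpOf volume (nlGrad s K u)‖ₑ ^ 2 ≤ ENNReal.ofReal C * gagliardoSq s u :=
          (enorm_lpOf_sq_le _).trans (hCu u hu)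
      _ ≤ ENNReal.ofReal (C + 1) * hsNormSq s u := by
          gcongr
          · linarith
          · exact le_add_self
  have hprod : ‖energyPair s K Ω u‖ₑ
      = max ‖lpOf (volume.restrict Ω) u‖ₑ ‖lpOf volume (nlGrad s K u)‖ₑ := rfl
  rcases max_choice ‖lpOf (volume.restrict Ω) u‖ₑ ‖lpOf volume (nlGrad s K u)‖ₑ with h | h
  · rwa [hprod, h]
  · rwa [hprod, h]

theorem MemHsTilde.mem_energySpace (hn : 1 ≤ n) (hs : 0 < s) (hs1 : s < 1) (hK : IsKernel K)
    {u : Rn n → ℝ} (hu : MemHsTilde s Ω u) : energyPair s K Ω u ∈ energySpace s K Ω := by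
  refine Metric.mem_closure_iff.2 fun ε hε => ?_
  obtain ⟨C, hC, hCu⟩ := exists_enorm_energyPair_sq_le hK s Ω
  obtain ⟨ζ, hζ_smooth, hζ_comp, hζ_supp, hζu⟩ := hu.2 (ENNReal.ofReal (ε ^ 2 / C))
    (ENNReal.ofReal_pos.2 (by positivity))
  have hζ : IsTest Ω ζ := ⟨hζ_smooth, hζ_comp, hζ_supp⟩
  have hζs := hζ.memHs hn hs hs1
  refine ⟨_, (mem_testSpace hn hs hs1 hK).2 ⟨ζ, hζ, rfl⟩, ?_⟩
  rw [dist_eq_norm, energyPair_sub hK hu.1 hζs]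
  refine norm_lt_of_enorm_sq_lt hε ?_
  calc ‖energyPair s K Ω fun x => u x - ζ x‖ₑ ^ 2
      ≤ ENNReal.ofReal C * hsNormSq s (fun x => u x - ζ x) := hCu _ (hu.1.1.sub hζs.1)
    _ < ENNReal.ofReal C * ENNReal.ofReal (ε ^ 2 / C) :=
        ENNReal.mul_lt_mul_right (ENNReal.ofReal_pos.2 hC).ne' ENNReal.ofReal_ne_top hζu
    _ = ENNReal.ofReal (ε ^ 2) := by
        rw [← ENNReal.ofReal_mul hC.le, mul_div_cancel₀ _ hC.ne']

theorem MemHsTilde.ae_eq_zero (hΩ : MeasurableSet Ω) {u : Rn n → ℝ} (hu : MemHsTilde s Ω u) :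
    ∀ᵐ x, x ∉ Ω → u x = 0 := by
  have hzero : ∫⁻ x in Ωᶜ, ‖u x‖ₑ ^ 2 = 0 := by
    refine le_antisymm (le_of_forall_pos_le_add fun δ hδ => ?_) zero_le
    obtain ⟨ζ, hζ_smooth, hζ_comp, hζ_supp, hζu⟩ := hu.2 δ hδ
    have hζ : IsTest Ω ζ := ⟨hζ_smooth, hζ_comp, hζ_supp⟩
    rw [zero_add]
    calc ∫⁻ x in Ωᶜ, ‖u x‖ₑ ^ 2 = ∫⁻ x in Ωᶜ, ‖u x - ζ x‖ₑ ^ 2 :=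
          setLIntegral_congr_fun hΩ.compl fun x hx => by rw [hζ.eq_zero hx, sub_zero]
      _ ≤ ∫⁻ x, ‖u x - ζ x‖ₑ ^ 2 := setLIntegral_le_lintegral _ _
      _ ≤ δ := (lintegral_enorm_sq_le_hsNormSq (s := s) _).trans hζu.le
  rw [lintegral_eq_zero_iff' (hu.1.1.restrict.enorm.pow_const 2), EventuallyEq,
    ae_restrict_iff' hΩ.compl] at hzero
  filter_upwards [hzero] with x hx hxΩ
  simpa using hx hxΩ

-- Since `u` vanishes on a unit ball away from `Ω`, the pairs `(x, y)` with `y` in that ball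
-- already control the `L²` norm.
theorem exists_setLIntegral_enorm_sq_le_gagliardoSq (hn : 1 ≤ n) (hs : 0 < s)
    (hΩ : MeasurableSet Ω) (hΩb : Bornology.IsBounded Ω) :
    ∃ C : ℝ, 0 ≤ C ∧ ∀ u : Rn n → ℝ, Measurable u → (∀ x ∉ Ω, u x = 0) →
      ∫⁻ x in Ω, ‖u x‖ₑ ^ 2 ≤ ENNReal.ofReal C * gagliardoSq s u := by
  have : Nonempty (Fin n) := ⟨⟨0, hn⟩⟩
  obtain ⟨R, hR0, hR⟩ := hΩb.exists_pos_norm_le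
  obtain ⟨p, hp⟩ := exists_norm_eq (Rn n) (show 0 ≤ R + 2 by linarith)
  set c : ℝ := ((2 * R + 3) ^ ((n : ℝ) + 2 * s))⁻¹ with hc
  set k : ℝ≥0∞ := ENNReal.ofReal c * volume (Metric.ball p 1)
  have hk0 : k ≠ 0 := mul_ne_zero (ENNReal.ofReal_pos.2 (by positivity)).ne'
    (Metric.measure_ball_pos _ _ one_pos).ne'
  have hkt : k ≠ ⊤ := ENNReal.mul_ne_top ENNReal.ofReal_ne_top measure_ball_lt_top.ne
  refine ⟨k⁻¹.toReal, ENNReal.toReal_nonneg, fun u hu hu0 => ?_⟩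
  rw [ENNReal.ofReal_toReal (ENNReal.inv_ne_top.2 hk0), ← ENNReal.div_eq_inv_mul,
    ENNReal.le_div_iff_mul_le (.inl hk0) (.inl hkt), ← lintegral_mul_const _ (hu.enorm.pow_const 2)]
  refine (setLIntegral_mono' hΩ fun x hx => ?_).trans (setLIntegral_le_lintegral Ω _)
  rw [← mul_assoc, ← setLIntegral_const]
  refine (setLIntegral_mono' measurableSet_ball fun y hy => ?_).trans
    (setLIntegral_le_lintegral (Metric.ball p 1) _)
  have hyp : ‖y - p‖ < 1 := mem_ball_iff_norm.1 hy
  have hy_lower : R < ‖y‖ := by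
    have := norm_sub_norm_le p y
    rw [norm_sub_rev] at this
    linarith
  have hy_upper : ‖y‖ ≤ R + 3 := by linarith [norm_sub_norm_le y p]
  have hyΩ : y ∉ Ω := fun h => hy_lower.not_ge (hR y h)
  have hxy_pos : 0 < ‖x - y‖ := norm_pos_iff.2 (sub_ne_zero.2 fun h => hyΩ (h ▸ hx))
  have hxy_le : ‖x - y‖ ≤ 2 * R + 3 := (norm_sub_le _ _).trans (by linarith [hR x hx])
  rw [hu0 y hyΩ, sub_zero, ← ofReal_abs_sq, ← ENNReal.ofReal_mul (by positivity), hc,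
    ← div_eq_mul_inv]
  refine ENNReal.ofReal_le_ofReal ?_
  gcongr

theorem exists_poincare (hn : 1 ≤ n) (hs : 0 < s) (hs1 : s < 1) (hK : IsKernel K)
    (hΩ : MeasurableSet Ω) (hΩb : Bornology.IsBounded Ω) :
    ∃ C : ℝ, ∀ a ∈ energySpace s K Ω, ‖a.1‖ ≤ C * ‖a.2‖ := by
  obtain ⟨C, hC0, hC⟩ := exists_setLIntegral_enorm_sq_le_gagliardoSq hn hs hΩ hΩb
  obtain ⟨D, hD0, hD⟩ := exists_gagliardoSq_le hK s
  refine ⟨√(C * D), fun a ha => mem_of_mem_energySpace hn hs hs1 hK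
    (S := {a | ‖a.1‖ ≤ √(C * D) * ‖a.2‖}) (isClosed_le (by fun_prop) (by fun_prop))
    (fun ζ hζ => ?_) ha⟩
  have hζs := hζ.memHs hn hs hs1
  refine norm_le_sqrt_mul_norm_of_enorm_sq_le (mul_nonneg hC0 hD0) ?_
  calc ‖lpOf (volume.restrict Ω) ζ‖ₑ ^ 2 ≤ ∫⁻ x in Ω, ‖ζ x‖ₑ ^ 2 := enorm_lpOf_sq_le _
    _ ≤ ENNReal.ofReal C * gagliardoSq s ζ :=
        hC ζ hζ.contDiff.continuous.measurable fun x hx => hζ.eq_zero hx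
    _ ≤ ENNReal.ofReal C * (ENNReal.ofReal D * ∫⁻ p, ‖nlGrad s K ζ p‖ₑ ^ 2) := by
        gcongr
        exact hD ζ hζs.1
    _ = ENNReal.ofReal (C * D) * ‖lpOf volume (nlGrad s K ζ)‖ₑ ^ 2 := by
        rw [enorm_lpOf_sq (hζs.memLp_nlGrad hK), ENNReal.ofReal_mul hC0, mul_assoc]

theorem nlGrad_mul_nlGrad_comp_nonneg (hK : IsKernel K) {G : ℝ → ℝ} (hG : Monotone G)
    (u : Rn n → ℝ) (p : Rn n × Rn n) : 0 ≤ nlGrad s K u p * nlGrad s K (fun x => G (u x)) p := by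
  rw [nlGrad_mul hK]
  refine mul_nonneg (hK.nonneg _ _) (div_nonneg ?_ (by positivity))
  rcases le_total (u p.1) (u p.2) with h | h
  · exact mul_nonneg_of_nonpos_of_nonpos (sub_nonpos.2 h) (sub_nonpos.2 (hG h))
  · exact mul_nonneg (sub_nonneg.2 h) (sub_nonneg.2 (hG h))

theorem norm_nlGrad_comp_le {G : ℝ → ℝ} {L : ℝ≥0} (hG : LipschitzWith L G) (u : Rn n → ℝ)
    (p : Rn n × Rn n) : ‖nlGrad s K (fun x => G (u x)) p‖ ≤ L * ‖nlGrad s K u p‖ := by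
  simp only [nlGrad, norm_mul]
  rw [mul_left_comm]
  gcongr
  simpa [dist_eq_norm] using hG.dist_le_mul (u p.1) (u p.2)

theorem isMarkov_energySpace (hn : 1 ≤ n) (hs : 0 < s) (hs1 : s < 1) (hK : IsKernel K) :
    IsMarkov (energySpace s K Ω) := by
  intro G L hL h0 hG hmono a ha η hη
  obtain ⟨ζ, hζ, hζη⟩ := exists_isTest_norm_sub_lt hn hs hs1 hK ha hη
  have hζG := hζ.comp hG h0
  have hζs := hζ.memHs hn hs hs1
  have hζGs := hζG.memHs hn hs hs1
  refine ⟨_, hζ.mem_energySpace, _, hζG.mem_energySpace, hζη.le, Lp.ext ?_, ?_,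
    Lp.norm_le_mul_norm_of_ae_le_mul ?_⟩
  · filter_upwards [hL.coeFn_compLp h0 (energyPair s K Ω ζ).1, coeFn_lpOf (hζs.memLp.restrict Ω),
      coeFn_lpOf (hζGs.memLp.restrict Ω)] with x hcomp hζx hζGx
    rw [hcomp, Function.comp_apply, energyPair, energyPair, hζx, hζGx]
  · rw [energyPair, energyPair, inner_lpOf (hζs.memLp_nlGrad hK) (hζGs.memLp_nlGrad hK)]
    exact integral_nonneg fun p => nlGrad_mul_nlGrad_comp_nonneg hK hmono ζ p
  · filter_upwards [coeFn_lpOf (hζs.memLp_nlGrad hK), coeFn_lpOf (hζGs.memLp_nlGrad hK)]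
      with p hζp hζGp
    rw [energyPair, energyPair, hζp, hζGp]
    exact norm_nlGrad_comp_le hL ζ p

end EnergySpace
/-! ### The power nonlinearity -/

section Power

variable {p : ℝ}

theorem Phi_neg (p t : ℝ) : Phi p (-t) = -Phi p t := by simp only [Phi, abs_neg, mul_neg]

theorem Phi_zero (p : ℝ) : Phi p 0 = 0 := mul_zero _

theorem Phi_of_nonneg (hp : 0 < p) {t : ℝ} (ht : 0 ≤ t) : Phi p t = t ^ p := by
  rcases ht.eq_or_lt with rfl | ht
  · rw [Phi_zero, Real.zero_rpow hp.ne']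
  · rw [Phi, abs_of_pos ht, Real.rpow_sub_one ht.ne', div_mul_cancel₀ _ ht.ne']

theorem monotone_Phi (hp : 0 < p) : Monotone (Phi p) := by
  refine monotone_of_odd_of_monotoneOn_nonneg (Phi_neg p) fun a ha b hb hab => ?_
  rw [Phi_of_nonneg hp ha, Phi_of_nonneg hp hb]
  exact Real.rpow_le_rpow ha hab hp.le

theorem Phi_inv_Phi (hp : 0 < p) (t : ℝ) : Phi p⁻¹ (Phi p t) = t := by
  have hnonneg : ∀ t, 0 ≤ t → Phi p⁻¹ (Phi p t) = t := fun t ht => by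
    rw [Phi_of_nonneg hp ht, Phi_of_nonneg (inv_pos.2 hp) (by positivity),
      Real.rpow_rpow_inv ht hp.ne']
  rcases le_total 0 t with ht | ht
  · exact hnonneg t ht
  · have := hnonneg (-t) (by linarith)
    rwa [Phi_neg, Phi_neg, neg_inj] at this

theorem continuous_Phi (hp : 1 ≤ p) : Continuous (Phi p) := by
  unfold Phi
  exact (continuous_abs.rpow_const fun _ => Or.inr (by linarith)).mul continuous_id

theorem Phi_sub_le_of_nonneg (hp : 0 < p) (hp1 : p ≤ 1) {a b : ℝ} (hb : 0 ≤ b) (hab : b ≤ a) :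
    Phi p a - Phi p b ≤ (a - b) ^ p := by
  rw [Phi_of_nonneg hp hb, Phi_of_nonneg hp (hb.trans hab)]
  have hsub := Real.rpow_add_le_add_rpow hb (sub_nonneg.2 hab) hp.le hp1
  rw [add_sub_cancel] at hsub
  linarith

theorem abs_Phi_sub_le (hp : 0 < p) (hp1 : p ≤ 1) (a b : ℝ) :
    |Phi p a - Phi p b| ≤ 2 * |a - b| ^ p := by
  wlog hab : b ≤ a generalizing a b
  · rw [abs_sub_comm, abs_sub_comm a]
    exact this b a (le_of_not_ge hab)
  rw [abs_of_nonneg (sub_nonneg.2 (monotone_Phi hp hab)), abs_of_nonneg (sub_nonneg.2 hab)]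
  have hnn : 0 ≤ (a - b) ^ p := Real.rpow_nonneg (sub_nonneg.2 hab) _
  rcases le_total 0 b with hb | hb
  · linarith [Phi_sub_le_of_nonneg hp hp1 hb hab]
  rcases le_total a 0 with ha | ha
  · have hsub := Phi_sub_le_of_nonneg hp hp1 (neg_nonneg.2 ha) (neg_le_neg hab)
    rw [Phi_neg, Phi_neg, neg_sub_neg, neg_sub_neg] at hsub
    linarith
  · have hle : ∀ t, 0 ≤ t → t ≤ a - b → Phi p t ≤ (a - b) ^ p := fun t ht hta => by
      rw [Phi_of_nonneg hp ht]
      exact Real.rpow_le_rpow ht hta hp.le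
    have hneg := hle (-b) (by linarith) (by linarith)
    rw [Phi_neg] at hneg
    linarith [hle a ha (by linarith)]

theorem holderWith_Phi (hp : 0 < p) (hp1 : p ≤ 1) : HolderWith 2 ⟨p, hp.le⟩ (Phi p) := by
  intro a b
  calc edist (Phi p a) (Phi p b) = ENNReal.ofReal |Phi p a - Phi p b| := edist_dist _ _
    _ ≤ ENNReal.ofReal (2 * |a - b| ^ p) := ENNReal.ofReal_le_ofReal (abs_Phi_sub_le hp hp1 a b)
    _ = 2 * edist a b ^ p := by
        rw [ENNReal.ofReal_mul zero_le_two, ENNReal.ofReal_ofNat, edist_dist, Real.dist_eq,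
          ENNReal.ofReal_rpow_of_nonneg (abs_nonneg _) hp.le]

theorem isNonlinearity_Phi (hp : 0 < p) (hp1 : p ≤ 1) : IsNonlinearity (Phi p) where
  monotone := monotone_Phi hp
  map_zero := Phi_zero p
  uniformContinuous := (holderWith_Phi hp hp1).uniformContinuous hp

end Power

/-! ### Duality with test functions -/

section Duality

variable {n : ℕ} {Ω : Set (Rn n)}

theorem exists_isTest_one_on {U k : Set (Rn n)} (hU : IsOpen U) (hk : IsClosed k) (hkU : k ⊆ U)
    (hUb : Bornology.IsBounded U) : ∃ ζ, IsTest U ζ ∧ (∀ x, ζ x ∈ Icc (0 : ℝ) 1) ∧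
      ∀ x ∈ k, ζ x = 1 := by
  obtain ⟨f, h0, h1, h⟩ := exists_contMDiffMap_zero_one_nhds_of_isClosed (n := (⊤ : ℕ∞))
    (modelWithCornersSelf ℝ (Rn n)) hU.isClosed_compl hk
    (disjoint_compl_left_iff_subset.2 hkU)
  have hsupp : tsupport f ⊆ U := by
    intro x hx
    by_contra hxU
    exact notMem_tsupport_iff_eventuallyEq.2 (h0.filter_mono (nhds_le_nhdsSet hxU)) hx
  refine ⟨f, ⟨f.contMDiff.contDiff, ?_, hsupp⟩, h, fun x hx => h1.self_of_nhdsSet x hx⟩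
  exact Metric.isCompact_of_isClosed_isBounded (isClosed_tsupport _) (hUb.subset hsupp)

theorem exists_isTest_measure_ne_indicator_lt (hΩ : IsOpen Ω) (hΩb : Bornology.IsBounded Ω)
    {A : Set (Rn n)} (hA : MeasurableSet A) (hAΩ : A ⊆ Ω) {δ : ℝ≥0∞} (hδ : δ ≠ 0) :
    ∃ ζ, IsTest Ω ζ ∧ (∀ x, ζ x ∈ Icc (0 : ℝ) 1) ∧
      volume {x | ζ x ≠ A.indicator (fun _ => 1) x} < δ := by
  have hδ2 : δ / 2 ≠ 0 := (ENNReal.half_pos hδ).ne'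
  obtain ⟨k, hkA, hk, hkδ⟩ := hA.exists_isCompact_sdiff_lt (μ := volume)
    ((measure_mono hAΩ).trans_lt hΩb.measure_lt_top).ne hδ2
  obtain ⟨U, hkU, hU, hUδ⟩ := k.exists_isOpen_lt_add (μ := volume)
    (hk.measure_lt_top (μ := volume)).ne hδ2
  obtain ⟨ζ, hζ, hζ01, hζ1⟩ := exists_isTest_one_on (hU.inter hΩ) hk.isClosed
    (subset_inter hkU (hkA.trans hAΩ)) (hΩb.subset inter_subset_right)
  have hUk : volume (U \ k) < δ / 2 := by
    rw [measure_sdiff hkU hk.measurableSet.nullMeasurableSet hk.measure_lt_top.ne]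
    exact ENNReal.sub_lt_of_lt_add (measure_mono hkU) (by rwa [add_comm] at hUδ)
  have hne : {x | ζ x ≠ A.indicator (fun _ => 1) x} ⊆ A \ k ∪ U \ k := by
    intro x hx
    by_contra hxAU
    by_cases hxk : x ∈ k
    · exact hx (by rw [hζ1 x hxk, indicator_of_mem (hkA hxk)])
    · have hxA : x ∉ A := fun h => hxAU (Or.inl ⟨h, hxk⟩)
      have hxU : x ∉ U ∩ Ω := fun h => hxAU (Or.inr ⟨h.1, hxk⟩)
      exact hx (by rw [hζ.eq_zero hxU, indicator_of_notMem hxA])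
  refine ⟨ζ, ⟨hζ.contDiff, hζ.hasCompactSupport, hζ.tsupport_subset.trans inter_subset_right⟩,
    hζ01, ?_⟩
  calc volume {x | ζ x ≠ A.indicator (fun _ => 1) x}
      ≤ volume (A \ k) + volume (U \ k) := (measure_mono hne).trans (measure_union_le _ _)
    _ < δ / 2 + δ / 2 := ENNReal.add_lt_add hkδ hUk
    _ = δ := ENNReal.add_halves δ

theorem max_zero_le_mul_add_abs {a t : ℝ} (ht : t ∈ Icc (0 : ℝ) 1) : max a 0 ≤ a * t + |a| := by
  obtain ⟨ht0, ht1⟩ := ht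
  rcases le_total 0 a with ha | ha
  · rw [max_eq_left ha, abs_of_nonneg ha]
    linarith [mul_nonneg ha ht0]
  · rw [max_eq_right ha, abs_of_nonpos ha]
    linarith [mul_nonneg (neg_nonneg.2 ha) (sub_nonneg.2 ht1)]

theorem setLIntegral_ofReal_le_of_forall_isTest (hΩ : IsOpen Ω) (hΩb : Bornology.IsBounded Ω)
    {g : Rn n → ℝ} (hgm : Measurable g) (hg : IntegrableOn g Ω) {M : ℝ≥0∞}
    (h : ∀ ζ, IsTest Ω ζ → (∀ x, ζ x ∈ Icc (0 : ℝ) 1) →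
      ENNReal.ofReal (∫ x in Ω, g x * ζ x) ≤ M) : ∫⁻ x in Ω, ENNReal.ofReal (g x) ≤ M := by
  refine ENNReal.le_of_forall_pos_le_add fun ε hε _ => ?_
  obtain ⟨δ, hδ, hsmall⟩ := exists_pos_setLIntegral_lt_of_measure_lt hg.2.ne
    (ENNReal.coe_pos.2 hε).ne'
  obtain ⟨ζ, hζ, hζ01, hζδ⟩ := exists_isTest_measure_ne_indicator_lt hΩ hΩb
    (hΩ.measurableSet.inter (measurableSet_lt measurable_const hgm)) inter_subset_left hδ.ne'
  set S : Set (Rn n) := {x | ζ x ≠ (Ω ∩ {x | 0 < g x}).indicator (fun _ => 1) x}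
  have hζm : Measurable ζ := hζ.contDiff.continuous.measurable
  have hS : MeasurableSet S := (measurableSet_eq_fun hζm (measurable_const.indicator
    (hΩ.measurableSet.inter (measurableSet_lt measurable_const hgm)))).compl
  have hgζ : IntegrableOn (fun x => g x * ζ x) Ω :=
    hg.mul_bdd (c := 1) hζm.aestronglyMeasurable (ae_of_all _ fun x => by
      rw [Real.norm_of_nonneg (hζ01 x).1]; exact (hζ01 x).2)
  have hpt : ∀ x ∈ Ω, max (g x) 0 ≤ g x * ζ x + S.indicator (fun x => ‖g x‖) x := by
    intro x hx
    by_cases hxS : x ∈ S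
    · rw [indicator_of_mem hxS, Real.norm_eq_abs]
      exact max_zero_le_mul_add_abs (hζ01 x)
    · rw [indicator_of_notMem hxS, add_zero, show ζ x = _ from not_not.1 hxS]
      rcases lt_or_ge 0 (g x) with hgx | hgx
      · have hxA : x ∈ Ω ∩ {x | 0 < g x} := ⟨hx, hgx⟩
        rw [indicator_of_mem hxA, max_eq_left hgx.le, mul_one]
      · have hxA : x ∉ Ω ∩ {x | 0 < g x} := fun h => hgx.not_gt h.2
        rw [indicator_of_notMem hxA, max_eq_right hgx, mul_zero]
  calc ∫⁻ x in Ω, ENNReal.ofReal (g x) = ENNReal.ofReal (∫ x in Ω, max (g x) 0) :=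
        (ofReal_integral_max_zero hg).symm
    _ ≤ ENNReal.ofReal (∫ x in Ω, (g x * ζ x + S.indicator (fun x => ‖g x‖) x)) :=
        ENNReal.ofReal_le_ofReal (setIntegral_mono_on hg.pos_part (hgζ.add (hg.norm.indicator hS))
          hΩ.measurableSet hpt)
    _ ≤ ENNReal.ofReal (∫ x in Ω, g x * ζ x) + ∫⁻ x in S, ‖g x‖ₑ ∂(volume.restrict Ω) := by
        rw [integral_add hgζ (hg.norm.indicator hS), integral_indicator hS,
          ← ofReal_integral_norm_eq_lintegral_enorm hg.integrableOn]
        exact ENNReal.ofReal_add_le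
    _ ≤ M + ε := add_le_add (h ζ hζ hζ01)
        (hsmall S ((Measure.restrict_apply_le _ _).trans_lt hζδ)).le

end Duality

/-! ### Exterior values as a bounded source -/

section Exterior

variable {n : ℕ} {s A : ℝ} {K : Rn n → Rn n → ℝ} {Ω S : Set (Rn n)} {a ζ : Rn n → ℝ}

/-- Exterior values: measurable functions bounded by `A` which vanish off a compact subset `S` of
the exterior of `Ω`. -/
structure IsExteriorValue (Ω S : Set (Rn n)) (A : ℝ) (a : Rn n → ℝ) : Prop where
  aestronglyMeasurable : AEStronglyMeasurable a
  isCompact : IsCompact S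
  subset_exterior : S ⊆ exterior Ω
  abs_le : ∀ x, |a x| ≤ A
  eq_zero : ∀ x ∉ S, a x = 0

/-- The density `K(y,x) a(x) / |x - y|^{n+2s}` of the interaction of the point `y` with the
values of `a`. -/
noncomputable def interaction (s : ℝ) (K : Rn n → Rn n → ℝ) (a : Rn n → ℝ) (y x : Rn n) : ℝ :=
  K y x * (a x / ‖x - y‖ ^ ((n : ℝ) + 2 * s))

/-- The source `-L_K a` in `Ω` produced by a function `a` supported in the exterior of `Ω`. -/
noncomputable def extSource (s : ℝ) (K : Rn n → Rn n → ℝ) (Ω : Set (Rn n)) (a : Rn n → ℝ)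
    (y : Rn n) : ℝ :=
  2 * ∫ x in exterior Ω, interaction s K a y x

theorem measurableSet_exterior : MeasurableSet (exterior Ω) :=
  isClosed_closure.measurableSet.compl

theorem interaction_eq_zero {x : Rn n} (hx : a x = 0) (y : Rn n) : interaction s K a y x = 0 := by
  rw [interaction, hx, zero_div, mul_zero]

theorem exists_abs_interaction_le (hs : 0 < s) (hK : IsKernel K) (hS : IsCompact S)
    (hSΩ : S ⊆ exterior Ω) :
    ∃ B, 0 ≤ B ∧ ∀ a, ∀ y ∈ Ω, ∀ x ∈ S, |interaction s K a y x| ≤ B * |a x| := by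
  obtain ⟨l, L, hl, hlL, hKL⟩ := hK.elliptic
  obtain ⟨r, hr, hrd⟩ := Metric.exists_pos_forall_lt_edist hS (isClosed_closure (s := Ω))
    (subset_compl_iff_disjoint_right.1 hSΩ)
  set d : ℝ := (n : ℝ) + 2 * s
  have : 0 < d := by positivity
  have hL : 0 ≤ L := hl.le.trans hlL
  refine ⟨L / (r : ℝ) ^ d, by positivity, fun a y hy x hx => ?_⟩
  have hxy : (r : ℝ) < ‖x - y‖ := by
    have := hrd x hx y (subset_closure hy)
    rwa [edist_nndist, ENNReal.coe_lt_coe, ← NNReal.coe_lt_coe, coe_nndist, dist_eq_norm] at this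
  rw [interaction, abs_mul, abs_of_nonneg (hK.nonneg _ _), abs_div,
    abs_of_nonneg (by positivity : (0 : ℝ) ≤ ‖x - y‖ ^ d), div_mul_eq_mul_div, ← mul_div_assoc]
  have : 0 < (r : ℝ) ^ d := Real.rpow_pos_of_pos (NNReal.coe_pos.2 hr) d
  have := (hKL y x).2
  gcongr

theorem exists_abs_interaction_le_indicator (hs : 0 < s) (hK : IsKernel K) (hS : IsCompact S)
    (hSΩ : S ⊆ exterior Ω) (A : ℝ) :
    ∃ B, ∀ a, IsExteriorValue Ω S A a → ∀ y ∈ Ω, ∀ x,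
      |interaction s K a y x| ≤ S.indicator (fun _ => B) x := by
  obtain ⟨B, hB, hBa⟩ := exists_abs_interaction_le hs hK hS hSΩ
  refine ⟨B * A, fun a ha y hy x => ?_⟩
  by_cases hx : x ∈ S
  · rw [indicator_of_mem hx]
    exact (hBa a y hy x hx).trans (mul_le_mul_of_nonneg_left (ha.abs_le x) hB)
  · rw [indicator_of_notMem hx, interaction_eq_zero (ha.eq_zero x hx), abs_zero]

theorem aestronglyMeasurable_interaction (hK : IsKernel K) (ha : AEStronglyMeasurable a) :
    AEStronglyMeasurable (Function.uncurry (interaction s K a))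
      ((volume : Measure (Rn n)).prod volume) :=
  hK.aemeasurable.aestronglyMeasurable.mul
    ((ha.comp_quasiMeasurePreserving Measure.quasiMeasurePreserving_snd).div₀
      (Measurable.pow_const (by fun_prop) _).aestronglyMeasurable)

theorem integrable_indicator_const (hS : IsCompact S) (B : ℝ) :
    Integrable (S.indicator fun _ => B) :=
  (integrable_indicator_iff hS.measurableSet).2 (integrableOn_const hS.measure_lt_top.ne)

theorem IsExteriorValue.ae_integrable_interaction (ha : IsExteriorValue Ω S A a) (hs : 0 < s)
    (hK : IsKernel K) : ∀ᵐ y : Rn n, y ∈ Ω → Integrable (interaction s K a y) := by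
  obtain ⟨B, hB⟩ :=
    exists_abs_interaction_le_indicator hs hK ha.isCompact ha.subset_exterior A
  filter_upwards [(aestronglyMeasurable_interaction hK ha.aestronglyMeasurable).prodMk_left]
    with y hm hy
  exact (integrable_indicator_const ha.isCompact B).mono' hm (ae_of_all _ (hB a ha y hy))

theorem exists_abs_extSource_le (hs : 0 < s) (hK : IsKernel K) (hS : IsCompact S)
    (hSΩ : S ⊆ exterior Ω) (A : ℝ) :
    ∃ B, ∀ a, IsExteriorValue Ω S A a → ∀ y ∈ Ω, |extSource s K Ω a y| ≤ B := by
  obtain ⟨B, hB⟩ := exists_abs_interaction_le_indicator hs hK hS hSΩ A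
  refine ⟨2 * ∫ x in exterior Ω, S.indicator (fun _ => B) x, fun a ha y hy => ?_⟩
  rw [extSource, abs_mul, abs_two]
  gcongr
  rw [← Real.norm_eq_abs]
  exact norm_integral_le_of_norm_le (integrable_indicator_const hS B).integrableOn
    (ae_of_all _ (hB a ha y hy))

theorem IsExteriorValue.extSource_eq (ha : IsExteriorValue Ω S A a) (y : Rn n) :
    extSource s K Ω a y = 2 * ∫ x, interaction s K a y x := by
  rw [extSource, setIntegral_eq_integral_of_forall_compl_eq_zero fun x hx =>
    interaction_eq_zero (ha.eq_zero x fun h => hx (ha.subset_exterior h)) y]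

theorem IsExteriorValue.integrable_interaction_mul (ha : IsExteriorValue Ω S A a) (hs : 0 < s)
    (hK : IsKernel K) (hζ : IsTest Ω ζ) :
    Integrable fun p : Rn n × Rn n => interaction s K a p.1 p.2 * ζ p.1 := by
  obtain ⟨B, hB⟩ :=
    exists_abs_interaction_le_indicator hs hK ha.isCompact ha.subset_exterior A
  have hζi : Integrable ζ := hζ.contDiff.continuous.integrable_of_hasCompactSupport
    hζ.hasCompactSupport
  refine (hζi.norm.mul_prod (integrable_indicator_const ha.isCompact B)).mono'
    ((aestronglyMeasurable_interaction hK ha.aestronglyMeasurable).mul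
      (hζi.1.comp_quasiMeasurePreserving Measure.quasiMeasurePreserving_fst))
    (ae_of_all _ fun p => ?_)
  rw [norm_mul, mul_comm]
  by_cases hp : p.1 ∈ Ω
  · exact mul_le_mul_of_nonneg_left (hB a ha p.1 hp p.2) (norm_nonneg _)
  · rw [hζ.eq_zero hp, norm_zero, zero_mul, zero_mul]

theorem IsExteriorValue.mul_eq_zero (ha : IsExteriorValue Ω S A a) (hζ : IsTest Ω ζ) (x : Rn n) :
    a x * ζ x = 0 := by
  by_cases hx : x ∈ Ω
  · rw [ha.eq_zero x fun h => ha.subset_exterior h (subset_closure hx), zero_mul]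
  · rw [hζ.eq_zero hx, mul_zero]

theorem IsExteriorValue.kernel_mul_sub_mul_sub (ha : IsExteriorValue Ω S A a) (hK : IsKernel K)
    (hζ : IsTest Ω ζ) (x y : Rn n) :
    K x y * ((a x - a y) * (ζ x - ζ y) / ‖x - y‖ ^ ((n : ℝ) + 2 * s))
      = -(interaction s K a x y * ζ x + interaction s K a y x * ζ y) := by
  have hexpand : (a x - a y) * (ζ x - ζ y) = -(a y * ζ x) - a x * ζ y := by
    linear_combination ha.mul_eq_zero hζ x + ha.mul_eq_zero hζ y
  rw [interaction, interaction, hexpand, hK.symm y x, norm_sub_rev y x]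
  ring

theorem IsExteriorValue.integral_interaction_mul (ha : IsExteriorValue Ω S A a)
    (hζ : IsTest Ω ζ) (y : Rn n) :
    ∫ x, interaction s K a y x * ζ y
      = Ω.indicator (fun y => extSource s K Ω a y * ζ y / 2) y := by
  by_cases hy : y ∈ Ω
  · rw [indicator_of_mem hy, integral_mul_const, ha.extSource_eq]
    ring
  · simp only [indicator_of_notMem hy, hζ.eq_zero hy, mul_zero, integral_zero]

theorem IsExteriorValue.bilin_eq (ha : IsExteriorValue Ω S A a) (hΩ : MeasurableSet Ω)
    (hs : 0 < s) (hK : IsKernel K) (hζ : IsTest Ω ζ) :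
    bilin s K a ζ = -∫ y in Ω, extSource s K Ω a y * ζ y := by
  set k : Rn n × Rn n → ℝ := fun p => interaction s K a p.1 p.2 * ζ p.1
  have hk : Integrable k := ha.integrable_interaction_mul hs hK hζ
  have hks : Integrable fun p : Rn n × Rn n => k p.swap := hk.swap
  calc bilin s K a ζ = ∫ p, -(k p + k p.swap) :=
        integral_congr_ae (ae_of_all _ fun p => ha.kernel_mul_sub_mul_sub hK hζ p.1 p.2)
    _ = -(2 * ∫ p, k p) := by
        have hswap : ∫ p : Rn n × Rn n, k p.swap = ∫ p, k p := integral_prod_swap k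
        rw [integral_neg, integral_add hk hks, hswap, two_mul]
    _ = -(2 * ∫ y, Ω.indicator (fun y => extSource s K Ω a y * ζ y / 2) y) := by
        rw [show ∫ p, k p = ∫ y, ∫ x, k (y, x) from integral_prod k hk]
        simp only [k, ha.integral_interaction_mul hζ]
    _ = -∫ y in Ω, extSource s K Ω a y * ζ y := by
        rw [integral_indicator hΩ, integral_div]
        ring

theorem extSource_congr_kernel {K' : Rn n → Rn n → ℝ} {y : Rn n}
    (h : ∀ᵐ x, K y x = K' y x) (a : Rn n → ℝ) : extSource s K Ω a y = extSource s K' Ω a y := by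
  unfold extSource
  congr 1
  refine integral_congr_ae (ae_restrict_of_ae ?_)
  filter_upwards [h] with x hx
  rw [interaction, interaction, hx]

theorem stronglyMeasurable_extSource (hK : Measurable (Function.uncurry K)) {a : ℝ → Rn n → ℝ}
    (ha : Measurable (Function.uncurry a)) :
    StronglyMeasurable (Function.uncurry fun t => extSource s K Ω (a t)) := by
  have hm : Measurable fun q : (ℝ × Rn n) × Rn n => interaction s K (a q.1.1) q.1.2 q.2 :=
    (hK.comp (f := fun q : (ℝ × Rn n) × Rn n => (q.1.2, q.2)) (by fun_prop)).mul
      ((ha.comp (f := fun q : (ℝ × Rn n) × Rn n => (q.1.1, q.2)) (by fun_prop)).div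
        (Measurable.pow_const (by fun_prop) _))
  exact (hm.stronglyMeasurable.integral_prod_right' (ν := volume.restrict (exterior Ω))).const_mul 2

theorem aestronglyMeasurable_extSource (hK : IsKernel K) {a : ℝ → Rn n → ℝ}
    (ha : Measurable (Function.uncurry a)) {ν : Measure ℝ} :
    AEStronglyMeasurable (Function.uncurry fun t => extSource s K Ω (a t))
      (ν.prod (volume.restrict Ω)) := by
  have hKm : AEMeasurable (Function.uncurry K) ((volume : Measure (Rn n)).prod volume) :=
    hK.aemeasurable
  have hmk : ∀ᵐ y : Rn n, ∀ᵐ x : Rn n, K y x = Function.curry hKm.mk y x :=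
    Measure.ae_ae_of_ae_prod hKm.ae_eq_mk
  refine (stronglyMeasurable_extSource (s := s) (K := Function.curry hKm.mk) (Ω := Ω)
    hKm.measurable_mk ha).aestronglyMeasurable.congr ?_
  filter_upwards [Measure.quasiMeasurePreserving_snd.ae (ae_restrict_of_ae hmk)] with p hp
  exact (extSource_congr_kernel hp (a p.1)).symm

theorem ofReal_interaction_sub_le (hK : IsKernel K) {L : ℝ} (hL : ∀ x y, K x y ≤ L)
    (a₁ a₂ : Rn n → ℝ) {x y : Rn n} (hxy : x ≠ y) :
    ENNReal.ofReal (interaction s K a₁ y x - interaction s K a₂ y x)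
      ≤ ENNReal.ofReal L *
        (ENNReal.ofReal (a₁ x - a₂ x) / ENNReal.ofReal (‖x - y‖ ^ ((n : ℝ) + 2 * s))) := by
  have hd : 0 < ‖x - y‖ ^ ((n : ℝ) + 2 * s) :=
    Real.rpow_pos_of_pos (norm_pos_iff.2 (sub_ne_zero.2 hxy)) _
  rw [interaction, interaction, ← mul_sub, ← sub_div, ENNReal.ofReal_mul (hK.nonneg _ _),
    ENNReal.ofReal_div_of_pos hd]
  gcongr
  exact hL y x

theorem ofReal_extSource_sub_le (hs : 0 < s) (hK : IsKernel K) {L : ℝ} (hL : ∀ x y, K x y ≤ L)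
    {S₁ S₂ : Set (Rn n)} {A₁ A₂ : ℝ} {a₁ a₂ : Rn n → ℝ} (ha₁ : IsExteriorValue Ω S₁ A₁ a₁)
    (ha₂ : IsExteriorValue Ω S₂ A₂ a₂) :
    ∀ᵐ y : Rn n, y ∈ Ω → ENNReal.ofReal (extSource s K Ω a₁ y - extSource s K Ω a₂ y)
      ≤ ENNReal.ofReal (2 * L) * ∫⁻ x in exterior Ω, ENNReal.ofReal (a₁ x - a₂ x)
        / ENNReal.ofReal (‖x - y‖ ^ ((n : ℝ) + 2 * s)) := by
  filter_upwards [ha₁.ae_integrable_interaction hs hK, ha₂.ae_integrable_interaction hs hK]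
    with y h₁ h₂ hy
  rw [extSource, extSource, ← mul_sub, ← integral_sub (h₁ hy).integrableOn (h₂ hy).integrableOn,
    ENNReal.ofReal_mul zero_le_two, ENNReal.ofReal_mul zero_le_two, mul_assoc,
    ← lintegral_const_mul' _ _ ENNReal.ofReal_ne_top]
  gcongr
  refine (ofReal_integral_le_lintegral_ofReal _).trans
    (setLIntegral_mono' measurableSet_exterior fun x hx => ?_)
  exact ofReal_interaction_sub_le hK hL a₁ a₂ fun h => hx (subset_closure (h ▸ hy))

end Exterior

/-! ### Functions on the cylinder as functions of time -/

section Cylinder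

variable {n : ℕ} {s T : ℝ} {K : Rn n → Rn n → ℝ} {Ω : Set (Rn n)} {F G w : ℝ → Rn n → ℝ}
  {ζ : Rn n → ℝ}

theorem secondCountableTopology_Lp {α : Type*} [MeasurableSpace α]
    [MeasurableSpace.CountablyGenerated α] (μ : Measure α) [SFinite μ] :
    SecondCountableTopology (Lp ℝ 2 μ) :=
  haveI : Fact ((2 : ℝ≥0∞) ≠ ⊤) := ⟨ENNReal.ofNat_ne_top⟩
  inferInstance

theorem isFiniteMeasure_restrict (hΩb : Bornology.IsBounded Ω) :
    IsFiniteMeasure ((volume : Measure (Rn n)).restrict Ω) :=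
  ⟨by simpa using hΩb.measure_lt_top⟩

theorem cylMeasure_eq_restrict (T : ℝ) (A : Set (Rn n)) :
    cylMeasure T A = (volume : Measure (ℝ × Rn n)).restrict (Ioo 0 T ×ˢ A) :=
  Measure.prod_restrict _ _

theorem isFiniteMeasure_cylMeasure [IsFiniteMeasure ((volume : Measure (Rn n)).restrict Ω)] :
    IsFiniteMeasure (cylMeasure T Ω) := by
  unfold cylMeasure
  infer_instance

theorem MemL2Cyl.add (hF : MemL2Cyl T Ω F) (hG : MemL2Cyl T Ω G) :
    MemL2Cyl T Ω fun t x => F t x + G t x :=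
  MemLp.add hF hG

theorem MemL2Cyl.congr (hF : MemL2Cyl T Ω F) (hΩ : MeasurableSet Ω)
    (h : ∀ t ∈ Ioo 0 T, ∀ x ∈ Ω, F t x = G t x) : MemL2Cyl T Ω G := by
  refine MemLp.ae_eq ?_ hF
  rw [cylMeasure_eq_restrict]
  filter_upwards [ae_restrict_mem (measurableSet_Ioo.prod hΩ)] with p hp
  exact h p.1 hp.1 p.2 hp.2

theorem MemL2Cyl.comp_nonlinearity [IsFiniteMeasure ((volume : Measure (Rn n)).restrict Ω)]
    {β : ℝ → ℝ} (hβ : IsNonlinearity β) (hF : MemL2Cyl T Ω F) :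
    MemL2Cyl T Ω fun t x => β (F t x) :=
  have := isFiniteMeasure_cylMeasure (T := T) (Ω := Ω)
  hβ.memLp_comp hF

theorem MemL2Cyl.lintegral_lt_top (hF : MemL2Cyl T Ω F) :
    ∫⁻ t in Ioo 0 T, ∫⁻ x in Ω, ‖F t x‖ₑ ^ 2 < ⊤ := by
  have h := (memLp_two_iff_lintegral_enorm_sq hF.1).1 hF
  rwa [cylMeasure, lintegral_prod _ (hF.1.enorm.pow_const 2)] at h

theorem MemL2Cyl.ae_memLp (hF : MemL2Cyl T Ω F) :
    ∀ᵐ t ∂(volume.restrict (Ioo 0 T)), MemLp (F t) 2 (volume.restrict Ω) := by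
  have hFm : AEStronglyMeasurable (Function.uncurry F)
      ((volume.restrict (Ioo 0 T)).prod (volume.restrict Ω)) := hF.1
  filter_upwards [ae_lt_top' (hFm.enorm.pow_const 2).lintegral_prod_right'
    hF.lintegral_lt_top.ne, hFm.prodMk_left] with t hfin hmeas
  exact (memLp_two_iff_lintegral_enorm_sq hmeas).2 hfin

theorem MemL2Cyl.memLp_lpOf (hF : MemL2Cyl T Ω F) :
    MemLp (fun t => lpOf (volume.restrict Ω) (F t)) 2 (volume.restrict (Ioo 0 T)) :=
  haveI := secondCountableTopology_Lp ((volume : Measure (Rn n)).restrict Ω)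
  NPME.memLp_lpOf hF.1 hF.lintegral_lt_top

theorem MemL2Cyl.integrable_inner_lpOf (hF : MemL2Cyl T Ω F)
    (c : Lp ℝ 2 ((volume : Measure (Rn n)).restrict Ω)) :
    IntegrableOn (fun t => inner ℝ (lpOf (volume.restrict Ω) (F t)) c) (Ioo 0 T) :=
  (hF.memLp_lpOf.integrable one_le_two).inner_const c

theorem IsTest.memLp (hζ : IsTest Ω ζ) : MemLp ζ 2 :=
  hζ.contDiff.continuous.memLp_of_hasCompactSupport hζ.hasCompactSupport

theorem tsupport_mul_prod_subset {X Y R : Type*} [TopologicalSpace X] [TopologicalSpace Y]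
    [MulZeroClass R] (f : X → R) (g : Y → R) :
    tsupport (fun p : X × Y => f p.1 * g p.2) ⊆ tsupport f ×ˢ tsupport g :=
  closure_minimal (fun _ hp => ⟨subset_tsupport _ (left_ne_zero_of_mul hp),
    subset_tsupport _ (right_ne_zero_of_mul hp)⟩)
    ((isClosed_tsupport f).prod (isClosed_tsupport g))

theorem hasCompactSupport_mul_prod {X Y R : Type*} [TopologicalSpace X] [TopologicalSpace Y]
    [MulZeroClass R] {f : X → R} {g : Y → R} (hf : HasCompactSupport f)
    (hg : HasCompactSupport g) : HasCompactSupport fun p : X × Y => f p.1 * g p.2 :=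
  (IsCompact.prod hf hg).of_isClosed_subset (isClosed_tsupport _) (tsupport_mul_prod_subset f g)

theorem MemL2Cyl.integral_mul_test (hF : MemL2Cyl T Ω F) {η : ℝ → ℝ}
    (hη : Continuous η) (hηc : HasCompactSupport η) (hζ : IsTest Ω ζ) :
    ∫ p, F p.1 p.2 * (η p.1 * ζ p.2) ∂(cylMeasure T Ω)
      = ∫ t in Ioo 0 T, inner ℝ (lpOf (volume.restrict Ω) (F t)) (lpOf _ ζ) * η t := by
  have hηζ : MemLp (fun p : ℝ × Rn n => η p.1 * ζ p.2) 2 (cylMeasure T Ω) := by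
    rw [cylMeasure_eq_restrict]
    have hcont : Continuous fun p : ℝ × Rn n => η p.1 * ζ p.2 :=
      (hη.comp continuous_fst).mul (hζ.contDiff.continuous.comp continuous_snd)
    exact (hcont.memLp_of_hasCompactSupport
      (hasCompactSupport_mul_prod hηc hζ.hasCompactSupport)).restrict _
  have hint : Integrable (fun p : ℝ × Rn n => F p.1 p.2 * (η p.1 * ζ p.2)) (cylMeasure T Ω) :=
    MemLp.integrable_mul hF hηζ
  rw [cylMeasure] at hint ⊢
  rw [integral_prod _ hint]
  refine integral_congr_ae ?_
  filter_upwards [hF.ae_memLp] with t ht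
  rw [inner_lpOf ht (hζ.memLp.restrict Ω), ← integral_mul_const]
  exact integral_congr_ae (ae_of_all _ fun x => by ring)

theorem MemL2Hs.memL2Cyl (hw : MemL2Hs s T w) (Ω : Set (Rn n)) : MemL2Cyl T Ω w := by
  have hwm : AEStronglyMeasurable (Function.uncurry w) (cylMeasure T Ω) := by
    refine hw.1.mono_measure ?_
    rw [cylMeasure_eq_restrict, cylMeasure_eq_restrict]
    exact Measure.restrict_mono (prod_mono le_rfl (subset_univ _)) le_rfl
  refine (memLp_two_iff_lintegral_enorm_sq hwm).2 ?_
  rw [cylMeasure] at hwm ⊢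
  rw [lintegral_prod _ (hwm.enorm.pow_const 2)]
  exact (lintegral_mono fun t => (setLIntegral_le_lintegral Ω _).trans
    (lintegral_enorm_sq_le_hsNormSq _)).trans_lt hw.2.2

theorem MemL2Hs.aestronglyMeasurable_nlGrad (hK : IsKernel K) (hw : MemL2Hs s T w) :
    AEStronglyMeasurable (Function.uncurry fun t => nlGrad s K (w t))
      ((volume.restrict (Ioo 0 T)).prod volume) := by
  have hwm : AEStronglyMeasurable (Function.uncurry w)
      ((volume.restrict (Ioo 0 T)).prod (volume : Measure (Rn n))) := by
    simpa only [cylMeasure, Measure.restrict_univ] using hw.1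
  have hfst : Measure.QuasiMeasurePreserving (fun q : ℝ × (Rn n × Rn n) => (q.1, q.2.1))
      ((volume.restrict (Ioo 0 T)).prod volume) ((volume.restrict (Ioo 0 T)).prod volume) :=
    Measure.quasiMeasurePreserving_fst.comp
      (measurePreserving_prodAssoc _ _ _).symm.quasiMeasurePreserving
  have hsnd : Measure.QuasiMeasurePreserving (fun q : ℝ × (Rn n × Rn n) => (q.1, q.2.2))
      ((volume.restrict (Ioo 0 T)).prod volume) ((volume.restrict (Ioo 0 T)).prod volume) :=
    hfst.comp ((MeasurePreserving.id _).prod Measure.measurePreserving_swap).quasiMeasurePreserving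
  exact ((aemeasurable_sqrtKernel hK).aestronglyMeasurable.comp_quasiMeasurePreserving
    Measure.quasiMeasurePreserving_snd).mul
      ((hwm.comp_quasiMeasurePreserving hfst).sub (hwm.comp_quasiMeasurePreserving hsnd))

theorem MemL2Hs.memLp_nlGrad (hK : IsKernel K) (hw : MemL2Hs s T w) :
    MemLp (fun t => lpOf (volume : Measure (Rn n × Rn n)) (nlGrad s K (w t))) 2
      (volume.restrict (Ioo 0 T)) := by
  obtain ⟨C, -, hC⟩ := exists_lintegral_nlGrad_le hK s
  have := secondCountableTopology_Lp (volume : Measure (Rn n × Rn n))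
  refine memLp_lpOf (hw.aestronglyMeasurable_nlGrad hK) ?_
  calc _ ≤ ∫⁻ t in Ioo 0 T, ENNReal.ofReal C * hsNormSq s (w t) := by
        refine lintegral_mono_ae ?_
        filter_upwards [hw.2.1] with t ht
        exact (hC _ ht.1).trans (mul_le_mul_right le_add_self _)
    _ = ENNReal.ofReal C * ∫⁻ t in Ioo 0 T, hsNormSq s (w t) :=
        lintegral_const_mul' _ _ ENNReal.ofReal_ne_top
    _ < ⊤ := ENNReal.mul_lt_top ENNReal.ofReal_lt_top hw.2.2

end Cylinder

/-! ### Weak solutions as solutions of an evolution equation -/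

section Source

variable {n : ℕ} {s T : ℝ} {K : Rn n → Rn n → ℝ} {Ω : Set (Rn n)} {Φ β : ℝ → ℝ}
  {F φ u : ℝ → Rn n → ℝ} {u₀ : Rn n → ℝ}

/-- `Φ` is a pressure law with inverse `β`: in terms of the pressure `v = Φ(u)`, the equation
`∂ₜu + L_K Φ(u) = F` becomes `∂ₜβ(v) + L_K v = F`. -/
structure IsPressureLaw (Φ β : ℝ → ℝ) : Prop where
  continuous : Continuous Φ
  map_zero : Φ 0 = 0
  leftInverse : Function.LeftInverse β Φ
  isNonlinearity : IsNonlinearity β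

theorem isPressureLaw_Phi {m : ℝ} (hm : 1 ≤ m) : IsPressureLaw (Phi m) (Phi m⁻¹) where
  continuous := continuous_Phi hm
  map_zero := Phi_zero m
  leftInverse := Phi_inv_Phi (by linarith)
  isNonlinearity := isNonlinearity_Phi (inv_pos.2 (by linarith)) (inv_le_one_of_one_le₀ hm)

/-- The exterior value `Φ(φ)` of the pressure on `[0, T]`, extended by zero to all times. -/
noncomputable def extValue (Φ : ℝ → ℝ) (T : ℝ) (φ : ℝ → Rn n → ℝ) (t : ℝ) (x : Rn n) : ℝ :=
  (Icc 0 T).indicator (fun t => Φ (φ t x)) t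

theorem extValue_of_mem {t : ℝ} (ht : t ∈ Ioo 0 T) (x : Rn n) :
    extValue Φ T φ t x = Φ (φ t x) :=
  indicator_of_mem (Ioo_subset_Icc_self ht) _

theorem measurable_extValue (hΦ : Continuous Φ)
    (hφ : ContinuousOn (Function.uncurry φ) (Icc 0 T ×ˢ univ)) :
    Measurable (Function.uncurry (extValue Φ T φ)) := by
  classical
  have hpiecewise : Function.uncurry (extValue Φ T φ) = (Icc 0 T ×ˢ univ).piecewise
      (fun p : ℝ × Rn n => Φ (Function.uncurry φ p)) fun _ => 0 := by
    ext p
    by_cases ht : p.1 ∈ Icc 0 T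
    · rw [piecewise_eq_of_mem _ _ _ (show p ∈ Icc 0 T ×ˢ univ from ⟨ht, mem_univ _⟩)]
      exact indicator_of_mem ht fun t => Φ (φ t p.2)
    · rw [piecewise_eq_of_notMem _ _ _ fun h => ht h.1]
      exact indicator_of_notMem ht fun t => Φ (φ t p.2)
  rw [hpiecewise]
  exact (hΦ.comp_continuousOn hφ).measurable_piecewise continuousOn_const
    (measurableSet_Icc.prod MeasurableSet.univ)

theorem exists_isExteriorValue_extValue (hΦ : Continuous Φ) (h0 : Φ 0 = 0)
    (hφ : MemCcExterior T Ω φ) :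
    ∃ S A, IsCompact S ∧ S ⊆ exterior Ω ∧ ∀ t, IsExteriorValue Ω S A (extValue Φ T φ t) := by
  obtain ⟨hφc, S, hS, hSΩ, hφS⟩ := hφ
  obtain ⟨A, hA⟩ := (isCompact_Icc.prod hS).exists_bound_of_continuousOn
    ((hΦ.comp_continuousOn hφc).mono (prod_mono le_rfl (subset_univ _)))
  have hzero : ∀ t, ∀ x ∉ S, extValue Φ T φ t x = 0 := fun t x hx =>
    indicator_apply_eq_zero.2 fun ht => by rw [hφS t ht x hx, h0]
  refine ⟨S, |A|, hS, hSΩ, fun t => ⟨((measurable_extValue hΦ hφc).comp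
    measurable_prodMk_left).aestronglyMeasurable, hS, hSΩ, fun x => ?_, hzero t⟩⟩
  by_cases hx : x ∈ S
  · by_cases ht : t ∈ Icc 0 T
    · rw [extValue, indicator_of_mem ht]
      exact (hA (t, x) ⟨ht, hx⟩).trans (le_abs_self A)
    · simp [extValue, indicator_of_notMem ht]
  · simp [hzero t x hx]

theorem memL2Cyl_extSource [IsFiniteMeasure ((volume : Measure (Rn n)).restrict Ω)]
    (hs : 0 < s) (hΩ : MeasurableSet Ω) (hK : IsKernel K) (hΦ : Continuous Φ) (h0 : Φ 0 = 0)
    (hφ : MemCcExterior T Ω φ) :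
    MemL2Cyl T Ω fun t => extSource s K Ω (extValue Φ T φ t) := by
  obtain ⟨S, A, hS, hSΩ, hA⟩ := exists_isExteriorValue_extValue hΦ h0 hφ
  obtain ⟨B, hB⟩ := exists_abs_extSource_le hs hK hS hSΩ A
  have hmem : ∀ᵐ p ∂((volume.restrict (Ioo 0 T)).prod ((volume : Measure (Rn n)).restrict Ω)),
      p.2 ∈ Ω := Measure.quasiMeasurePreserving_snd.ae (ae_restrict_mem hΩ)
  unfold MemL2Cyl cylMeasure
  refine MemLp.of_bound (aestronglyMeasurable_extSource hK (measurable_extValue hΦ hφ.1)) B ?_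
  filter_upwards [hmem] with p hp
  exact hB _ (hA p.1) p.2 hp

/-- The source `F - L_K Φ(φ)` in `Ω`, which contains the contribution of the exterior values. -/
noncomputable def totalSource (s : ℝ) (K : Rn n → Rn n → ℝ) (T : ℝ) (Ω : Set (Rn n)) (Φ : ℝ → ℝ)
    (F φ : ℝ → Rn n → ℝ) (t : ℝ) (x : Rn n) : ℝ :=
  F t x + extSource s K Ω (extValue Φ T φ t) x

theorem memL2Cyl_totalSource [IsFiniteMeasure ((volume : Measure (Rn n)).restrict Ω)]
    (hs : 0 < s) (hΩ : MeasurableSet Ω) (hK : IsKernel K) (hΦ : Continuous Φ) (h0 : Φ 0 = 0)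
    (hF : MemL2Cyl T Ω F) (hφ : MemCcExterior T Ω φ) :
    MemL2Cyl T Ω (totalSource s K T Ω Φ F φ) :=
  hF.add (memL2Cyl_extSource hs hΩ hK hΦ h0 hφ)

theorem posPartIntCyl_totalSource_le (hs : 0 < s) (hΩ : MeasurableSet Ω) (hK : IsKernel K) {L : ℝ}
    (hL : ∀ x y, K x y ≤ L) (hΦ : Continuous Φ) (h0 : Φ 0 = 0) {F₁ F₂ φ₁ φ₂ : ℝ → Rn n → ℝ}
    (hF₁ : MemL2Cyl T Ω F₁) (hF₂ : MemL2Cyl T Ω F₂) (hφ₁ : MemCcExterior T Ω φ₁)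
    (hφ₂ : MemCcExterior T Ω φ₂) :
    posPartIntCyl T Ω (totalSource s K T Ω Φ F₁ φ₁) (totalSource s K T Ω Φ F₂ φ₂)
      ≤ posPartIntCyl T Ω F₁ F₂ + ENNReal.ofReal (2 * L) * exteriorPosPartInt s T Ω
        (fun t x => Φ (φ₁ t x)) (fun t x => Φ (φ₂ t x)) := by
  obtain ⟨S₁, A₁, -, -, hA₁⟩ := exists_isExteriorValue_extValue hΦ h0 hφ₁
  obtain ⟨S₂, A₂, -, -, hA₂⟩ := exists_isExteriorValue_extValue hΦ h0 hφ₂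
  have hFm : AEMeasurable (fun p : ℝ × Rn n => ENNReal.ofReal (F₁ p.1 p.2 - F₂ p.1 p.2))
      ((volume.restrict (Ioo 0 T)).prod (volume.restrict Ω)) :=
    (hF₁.1.sub hF₂.1).aemeasurable.ennreal_ofReal
  have hFmt : AEMeasurable (fun t => posPartInt Ω (F₁ t) (F₂ t)) (volume.restrict (Ioo 0 T)) :=
    hFm.lintegral_prod_right'
  unfold posPartIntCyl exteriorPosPartInt
  rw [← lintegral_const_mul' _ _ ENNReal.ofReal_ne_top, ← lintegral_add_left' hFmt]
  refine lintegral_mono_ae ?_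
  filter_upwards [hF₁.ae_memLp, hF₂.ae_memLp, ae_restrict_mem measurableSet_Ioo]
    with t hF₁t hF₂t ht
  have hFt : AEMeasurable (fun x => ENNReal.ofReal (F₁ t x - F₂ t x)) (volume.restrict Ω) :=
    (hF₁t.1.sub hF₂t.1).aemeasurable.ennreal_ofReal
  unfold posPartInt
  rw [← lintegral_const_mul' _ _ ENNReal.ofReal_ne_top, ← lintegral_add_left' hFt]
  refine lintegral_mono_ae ?_
  filter_upwards [ae_restrict_mem hΩ,
    ae_restrict_of_ae (ofReal_extSource_sub_le hs hK hL (hA₁ t) (hA₂ t))] with y hy hext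
  rw [totalSource, totalSource, add_sub_add_comm]
  refine ENNReal.ofReal_add_le.trans (add_le_add le_rfl ?_)
  simpa only [extValue_of_mem ht] using hext hy

end Source

section Abstract

theorem inner_setIntegral {α E : Type*} [MeasurableSpace α] {μ : Measure α} [NormedAddCommGroup E]
    [InnerProductSpace ℝ E] [CompleteSpace E] {g : α → E} {S : Set α} (hg : IntegrableOn g S μ)
    (c : E) : inner ℝ (∫ t in S, g t ∂μ) c = ∫ t in S, inner ℝ (g t) c ∂μ := by
  rw [real_inner_comm, ← integral_inner hg]
  simp only [real_inner_comm]

theorem ae_forall_mem_closure {α X : Type*} [MeasurableSpace α] {μ : Measure α}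
    [PseudoMetricSpace X] [SecondCountableTopology X] {D : Set X} {P : α → Set X}
    (hP : ∀ t, IsClosed (P t)) (h : ∀ x ∈ D, ∀ᵐ t ∂μ, x ∈ P t) :
    ∀ᵐ t ∂μ, ∀ x ∈ closure D, x ∈ P t := by
  obtain ⟨D', hD'D, hD'c, hDD'⟩ :=
    (TopologicalSpace.IsSeparable.of_separableSpace D).exists_countable_dense_subset
  filter_upwards [(ae_ball_iff hD'c).2 fun x hx => h x (hD'D hx)] with t ht x hx
  exact closure_minimal ht (hP t) (closure_minimal hDD' isClosed_closure hx)

variable {H Y : Type*} [NormedAddCommGroup H] [InnerProductSpace ℝ H] [NormedAddCommGroup Y]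
  [InnerProductSpace ℝ Y] {V : Submodule ℝ (H × Y)} {β : H → H} {T : ℝ} {w w' : ℝ → H × Y}
  {f f' : ℝ → H} {v₀ x : H}

theorem IntegratedEquation.congr {t : ℝ} (h : IntegratedEquation V w f v₀ t x)
    (ht : t ∈ Ioo 0 T) (hw : ∀ᵐ τ ∂(volume.restrict (Ioo 0 T)), (w' τ).2 = (w τ).2)
    (hf : ∀ᵐ τ ∂(volume.restrict (Ioo 0 T)), f' τ = f τ) :
    IntegratedEquation V w' f' v₀ t x := by
  have hsub : Ioc 0 t ⊆ Ioo 0 T := Ioc_subset_Ioo_right ht.2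
  intro ψ hψ
  rw [integral_congr_ae (ae_restrict_of_ae_restrict_of_subset hsub hw),
    integral_congr_ae (ae_restrict_of_ae_restrict_of_subset hsub hf)]
  exact h ψ hψ

theorem exists_isEvolution_of_integrableOn (hw : IntegrableOn (fun t => (w t).2) (Ioo 0 T))
    (hf : IntegrableOn f (Ioo 0 T)) (hmem : ∀ᵐ t ∂(volume.restrict (Ioo 0 T)), w t ∈ V)
    (heq : ∀ᵐ t ∂(volume.restrict (Ioo 0 T)), IntegratedEquation V w f v₀ t (β (w t).1)) :
    ∃ w' f', IsEvolution V β T w' f' v₀ ∧ (∀ᵐ t ∂(volume.restrict (Ioo 0 T)), w' t = w t) ∧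
      ∀ᵐ t ∂(volume.restrict (Ioo 0 T)), f' t = f t := by
  have hwm := hw.aestronglyMeasurable
  set w' : ℝ → H × Y := fun t => ((w t).1, (Ioo 0 T).indicator hwm.mk t)
  have hw' : ∀ᵐ t ∂(volume.restrict (Ioo 0 T)), w' t = w t := by
    filter_upwards [hwm.ae_eq_mk, ae_restrict_mem measurableSet_Ioo] with t hmk ht
    exact Prod.ext rfl ((indicator_of_mem ht _).trans hmk.symm)
  have hf' : ∀ᵐ t ∂(volume.restrict (Ioo 0 T)), (Ioo 0 T).indicator f t = f t :=
    (ae_restrict_mem measurableSet_Ioo).mono fun t ht => indicator_of_mem ht f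
  refine ⟨w', (Ioo 0 T).indicator f, ⟨hwm.stronglyMeasurable_mk.indicator measurableSet_Ioo,
    (integrable_indicator_iff measurableSet_Ioo).2 (hw.congr hwm.ae_eq_mk),
    (integrable_indicator_iff measurableSet_Ioo).2 hf, ?_, ?_⟩, hw', hf'⟩
  · rw [← ae_restrict_iff' measurableSet_Ioo]
    filter_upwards [hw', hmem] with t ht hmem
    rwa [ht]
  · rw [← ae_restrict_iff' measurableSet_Ioo]
    filter_upwards [heq, ae_restrict_mem measurableSet_Ioo] with t heq ht
    exact heq.congr ht (hw'.mono fun τ hτ => congrArg Prod.snd hτ) hf'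

end Abstract

section Equation

variable {n : ℕ} {s T : ℝ} {K : Rn n → Rn n → ℝ} {Ω : Set (Rn n)} {Φ β : ℝ → ℝ}
  {F φ u : ℝ → Rn n → ℝ} {u₀ : Rn n → ℝ} {ζ : Rn n → ℝ}

theorem bilin_mul_right (u v : Rn n → ℝ) (c : ℝ) :
    bilin s K u (fun x => c * v x) = bilin s K u v * c := by
  unfold bilin
  rw [← integral_mul_const]
  exact integral_congr_ae (ae_of_all _ fun p => by ring)

theorem IsWeakSolution.equation_mul (hu : IsWeakSolution s T Ω K Φ F φ u₀ u)
    (huL2 : MemL2Cyl T Ω u) (hF : MemL2Cyl T Ω F) (hu₀ : MemLp u₀ 2 (volume.restrict Ω))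
    {η : ℝ → ℝ} (hη : ContDiff ℝ ∞ η) (hηc : HasCompactSupport η) (hηT : tsupport η ⊆ Iio T)
    (hζ : IsTest Ω ζ) :
    -(∫ t in Ioo 0 T, inner ℝ (lpOf (volume.restrict Ω) (u t)) (lpOf _ ζ) * deriv η t)
        + ∫ t in Ioo 0 T, bilin s K (fun x => Φ (u t x)) ζ * η t
      = (∫ t in Ioo 0 T, inner ℝ (lpOf (volume.restrict Ω) (F t)) (lpOf _ ζ) * η t)
        + inner ℝ (lpOf (volume.restrict Ω) u₀) (lpOf _ ζ) * η 0 := by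
  have h := hu.equation (fun t x => η t * ζ x)
    ((hη.comp contDiff_fst).mul (hζ.contDiff.comp contDiff_snd))
    (hasCompactSupport_mul_prod hηc hζ.hasCompactSupport)
    ((tsupport_mul_prod_subset η ζ).trans (prod_mono hηT hζ.tsupport_subset))
  simp only [deriv_mul_const_field, bilin_mul_right] at h
  rw [huL2.integral_mul_test (hη.continuous_deriv (by simp)) hηc.deriv hζ,
    hF.integral_mul_test hη.continuous hηc hζ] at h
  rw [h, inner_lpOf hu₀ (hζ.memLp.restrict Ω), ← integral_mul_const]
  congr 1
  exact integral_congr_ae (ae_of_all _ fun x => by ring)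

theorem IsExteriorValue.bilin_eq_inner_sub_inner {S : Set (Rn n)} {A : ℝ} {v w a : Rn n → ℝ}
    (ha : IsExteriorValue Ω S A a) (hn : 1 ≤ n) (hs : 0 < s) (hs1 : s < 1)
    (hΩ : MeasurableSet Ω) (hK : IsKernel K) (hv : MemHs s v) (hw : MemHs s w)
    (hvw : v =ᵐ[volume] fun x => w x + a x)
    (hq : MemLp (extSource s K Ω a) 2 (volume.restrict Ω)) (hζ : IsTest Ω ζ) :
    bilin s K v ζ = inner ℝ (lpOf volume (nlGrad s K w)) (lpOf _ (nlGrad s K ζ))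
      - inner ℝ (lpOf (volume.restrict Ω) (extSource s K Ω a)) (lpOf _ ζ) := by
  have hζg := (hζ.memHs hn hs hs1).memLp_nlGrad hK
  have hsplit : ∀ᵐ p, nlGrad s K v p = nlGrad s K w p + nlGrad s K a p := by
    filter_upwards [nlGrad_congr (s := s) (K := K) hvw] with p hp
    rw [hp, nlGrad_add]
  have hag : MemLp (nlGrad s K a) 2 := by
    refine ((hv.memLp_nlGrad hK).sub (hw.memLp_nlGrad hK)).ae_eq ?_
    filter_upwards [hsplit] with p hp
    rw [Pi.sub_apply, hp, add_sub_cancel_left]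
  have hwζ : Integrable fun p => nlGrad s K w p * nlGrad s K ζ p :=
    MemLp.integrable_mul (hw.memLp_nlGrad hK) hζg
  have haζ : Integrable fun p => nlGrad s K a p * nlGrad s K ζ p := MemLp.integrable_mul hag hζg
  rw [inner_lpOf (hw.memLp_nlGrad hK) hζg, inner_lpOf hq (hζ.memLp.restrict Ω), sub_eq_add_neg,
    ← ha.bilin_eq hΩ hs hK hζ, bilin_eq_integral hK, bilin_eq_integral hK,
    ← integral_add hwζ haζ]
  refine integral_congr_ae ?_
  filter_upwards [hsplit] with p hp
  rw [hp, add_mul]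

theorem MemCcExterior.eq_zero_of_mem (hφ : MemCcExterior T Ω φ) {t : ℝ} (ht : t ∈ Ioo 0 T)
    {x : Rn n} (hx : x ∈ Ω) : φ t x = 0 := by
  obtain ⟨-, S, -, hS, h⟩ := hφ
  exact h t (Ioo_subset_Icc_self ht) x fun hxS => hS hxS (subset_closure hx)

theorem IsPressureLaw.ae_eq_add_extValue (hΦ : IsPressureLaw Φ β) (hΩ : MeasurableSet Ω)
    (hφ : MemCcExterior T Ω φ) {t : ℝ} (ht : t ∈ Ioo 0 T)
    (hu : MemHsTilde s Ω fun x => Φ (u t x - φ t x)) :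
    (fun x => Φ (u t x)) =ᵐ[volume] fun x => Φ (u t x - φ t x) + extValue Φ T φ t x := by
  filter_upwards [hu.ae_eq_zero hΩ] with x hx
  rw [extValue_of_mem ht]
  by_cases hxΩ : x ∈ Ω
  · rw [hφ.eq_zero_of_mem ht hxΩ, sub_zero, hΦ.map_zero, add_zero]
  · have huφ : u t x = φ t x :=
      sub_eq_zero.1 (hΦ.leftInverse.injective ((hx hxΩ).trans hΦ.map_zero.symm))
    rw [huφ, sub_self, hΦ.map_zero, zero_add]

/-- The pressure `Φ(u - φ)`, which vanishes outside `Ω`, as a curve in the energy space. -/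
noncomputable def pressurePair (s : ℝ) (K : Rn n → Rn n → ℝ) (Ω : Set (Rn n)) (Φ : ℝ → ℝ)
    (φ u : ℝ → Rn n → ℝ) (t : ℝ) : PairSpace Ω :=
  energyPair s K Ω fun x => Φ (u t x - φ t x)

theorem IsWeakSolution.integrableOn_pressurePair_snd (hu : IsWeakSolution s T Ω K Φ F φ u₀ u)
    (hK : IsKernel K) : IntegrableOn (fun t => (pressurePair s K Ω Φ φ u t).2) (Ioo 0 T) :=
  (hu.exterior_value.1.memLp_nlGrad hK).integrable one_le_two

variable [IsFiniteMeasure ((volume : Measure (Rn n)).restrict Ω)]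

theorem IsWeakSolution.ae_bilin_eq (hu : IsWeakSolution s T Ω K Φ F φ u₀ u)
    (hΦ : IsPressureLaw Φ β) (hn : 1 ≤ n) (hs : 0 < s) (hs1 : s < 1) (hΩ : MeasurableSet Ω)
    (hK : IsKernel K) (hφ : MemCcExterior T Ω φ) :
    ∀ᵐ t ∂(volume.restrict (Ioo 0 T)), ∀ ζ, IsTest Ω ζ → bilin s K (fun x => Φ (u t x)) ζ
      = inner ℝ (lpOf volume (nlGrad s K fun x => Φ (u t x - φ t x))) (lpOf _ (nlGrad s K ζ))
        - inner ℝ (lpOf (volume.restrict Ω) (extSource s K Ω (extValue Φ T φ t))) (lpOf _ ζ) := by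
  obtain ⟨S, A, -, -, hA⟩ := exists_isExteriorValue_extValue hΦ.continuous hΦ.map_zero hφ
  have hq := memL2Cyl_extSource hs hΩ hK hΦ.continuous hΦ.map_zero hφ
  filter_upwards [hu.sobolev.2.1, hu.exterior_value.2, hq.ae_memLp,
    ae_restrict_mem measurableSet_Ioo] with t hv hw hqt ht ζ hζ
  exact (hA t).bilin_eq_inner_sub_inner hn hs hs1 hΩ hK hv hw.1
    (hΦ.ae_eq_add_extValue hΩ hφ ht hw) hqt hζ

theorem IsWeakSolution.memL2Cyl (hu : IsWeakSolution s T Ω K Φ F φ u₀ u)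
    (hΦ : IsPressureLaw Φ β) (hΩ : MeasurableSet Ω) (hφ : MemCcExterior T Ω φ) :
    MemL2Cyl T Ω u := by
  refine ((hu.exterior_value.1.memL2Cyl Ω).comp_nonlinearity hΦ.isNonlinearity).congr hΩ
    fun t ht x hx => ?_
  rw [hΦ.leftInverse, hφ.eq_zero_of_mem ht hx, sub_zero]

theorem superpose_lpOf {α : Type*} [MeasurableSpace α] {μ : Measure α} [IsFiniteMeasure μ]
    (hβ : IsNonlinearity β) {f : α → ℝ} (hf : MemLp f 2 μ) :
    superpose hβ (lpOf μ f) = lpOf μ fun x => β (f x) := by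
  refine Lp.ext ?_
  filter_upwards [coeFn_superpose hβ (lpOf μ f), coeFn_lpOf hf, coeFn_lpOf (hβ.memLp_comp hf)]
    with x hsup hfx hβfx
  rw [hsup, hfx, hβfx]

theorem IsWeakSolution.ae_superpose_pressurePair (hu : IsWeakSolution s T Ω K Φ F φ u₀ u)
    (hΦ : IsPressureLaw Φ β) (hΩ : MeasurableSet Ω) (hφ : MemCcExterior T Ω φ) :
    ∀ᵐ t ∂(volume.restrict (Ioo 0 T)),
      superpose hΦ.isNonlinearity (pressurePair s K Ω Φ φ u t).1 = lpOf _ (u t) := by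
  filter_upwards [hu.exterior_value.2, ae_restrict_mem measurableSet_Ioo] with t hw ht
  rw [pressurePair, energyPair, superpose_lpOf hΦ.isNonlinearity (hw.1.memLp.restrict Ω)]
  refine lpOf_congr ?_
  filter_upwards [ae_restrict_mem hΩ] with x hx
  rw [hΦ.leftInverse, hφ.eq_zero_of_mem ht hx, sub_zero]

end Equation

section Evolution

variable {n : ℕ} {s T : ℝ} {K : Rn n → Rn n → ℝ} {Ω : Set (Rn n)} {Φ β : ℝ → ℝ}
  {F φ u : ℝ → Rn n → ℝ} {u₀ : Rn n → ℝ} {ζ : Rn n → ℝ}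
  [IsFiniteMeasure ((volume : Measure (Rn n)).restrict Ω)]

theorem IsWeakSolution.integral_mul_deriv_eq (hu : IsWeakSolution s T Ω K Φ F φ u₀ u)
    (hΦ : IsPressureLaw Φ β) (hn : 1 ≤ n) (hs : 0 < s) (hs1 : s < 1) (hΩ : MeasurableSet Ω)
    (hK : IsKernel K) (hF : MemL2Cyl T Ω F) (hφ : MemCcExterior T Ω φ)
    (hu₀ : MemLp u₀ 2 (volume.restrict Ω)) (hζ : IsTest Ω ζ) {η : ℝ → ℝ}
    (hη : ContDiff ℝ ∞ η) (hηc : HasCompactSupport η) (hηT : tsupport η ⊆ Iio T) :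
    -(∫ t in Ioo 0 T, inner ℝ (lpOf (volume.restrict Ω) (u t)) (lpOf _ ζ) * deriv η t)
      = (∫ t in Ioo 0 T, (inner ℝ (lpOf (volume.restrict Ω) (totalSource s K T Ω Φ F φ t))
            (lpOf _ ζ) - inner ℝ (pressurePair s K Ω Φ φ u t).2 (energyPair s K Ω ζ).2) * η t)
        + inner ℝ (lpOf (volume.restrict Ω) u₀) (lpOf _ ζ) * η 0 := by
  have hq := memL2Cyl_extSource hs hΩ hK hΦ.continuous hΦ.map_zero hφ
  obtain ⟨B, hB⟩ := hη.continuous.bounded_above_of_compact_support hηc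
  have hbilin : ∀ᵐ t ∂(volume.restrict (Ioo 0 T)), bilin s K (fun x => Φ (u t x)) ζ
      = inner ℝ (pressurePair s K Ω Φ φ u t).2 (energyPair s K Ω ζ).2
        - inner ℝ (lpOf (volume.restrict Ω) (extSource s K Ω (extValue Φ T φ t))) (lpOf _ ζ) :=
    (hu.ae_bilin_eq hΦ hn hs hs1 hΩ hK hφ).mono fun t ht => ht ζ hζ
  have hbilin_int : IntegrableOn (fun t => bilin s K (fun x => Φ (u t x)) ζ) (Ioo 0 T) :=
    (((hu.integrableOn_pressurePair_snd hK).inner_const _).sub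
      (hq.integrable_inner_lpOf (lpOf _ ζ))).congr (hbilin.mono fun t ht => ht.symm)
  have hmul {g : ℝ → ℝ} (hg : Integrable g (volume.restrict (Ioo 0 T))) :
      Integrable (fun t => g t * η t) (volume.restrict (Ioo 0 T)) :=
    hg.mul_bdd hη.continuous.aestronglyMeasurable (ae_of_all _ hB)
  have hsource : ∫ t in Ioo 0 T, (inner ℝ (lpOf (volume.restrict Ω)
        (totalSource s K T Ω Φ F φ t)) (lpOf _ ζ)
          - inner ℝ (pressurePair s K Ω Φ φ u t).2 (energyPair s K Ω ζ).2) * η t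
      = (∫ t in Ioo 0 T, inner ℝ (lpOf (volume.restrict Ω) (F t)) (lpOf _ ζ) * η t)
        - ∫ t in Ioo 0 T, bilin s K (fun x => Φ (u t x)) ζ * η t := by
    rw [← integral_sub (hmul (hF.integrable_inner_lpOf (lpOf _ ζ))) (hmul hbilin_int)]
    refine integral_congr_ae ?_
    filter_upwards [hbilin, hF.ae_memLp, hq.ae_memLp] with t ht hFt hqt
    have hsum : lpOf (volume.restrict Ω) (totalSource s K T Ω Φ F φ t)
        = lpOf _ (F t) + lpOf _ (extSource s K Ω (extValue Φ T φ t)) := (lpOf_add hFt hqt).symm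
    rw [ht, hsum, inner_add_left]
    ring
  have heq := hu.equation_mul (hu.memL2Cyl hΦ hΩ hφ) hF hu₀ hη hηc hηT hζ
  linarith

theorem IsWeakSolution.ae_inner_sub_eq (hu : IsWeakSolution s T Ω K Φ F φ u₀ u)
    (hΦ : IsPressureLaw Φ β) (hn : 1 ≤ n) (hT : 0 < T) (hs : 0 < s) (hs1 : s < 1)
    (hΩ : MeasurableSet Ω) (hK : IsKernel K) (hF : MemL2Cyl T Ω F) (hφ : MemCcExterior T Ω φ)
    (hu₀ : MemLp u₀ 2 (volume.restrict Ω)) (hζ : IsTest Ω ζ) :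
    ∀ᵐ t ∂(volume.restrict (Ioo 0 T)),
      inner ℝ (lpOf (volume.restrict Ω) (u t) - lpOf _ u₀) (lpOf _ ζ)
        = ∫ τ in Ioc 0 t, (inner ℝ (lpOf (volume.restrict Ω) (totalSource s K T Ω Φ F φ τ))
            (lpOf _ ζ) - inner ℝ (pressurePair s K Ω Φ φ u τ).2 (energyPair s K Ω ζ).2) := by
  have hsource := memL2Cyl_totalSource hs hΩ hK hΦ.continuous hΦ.map_zero hF hφ
  have huc := (hu.memL2Cyl hΦ hΩ hφ).integrable_inner_lpOf (lpOf _ ζ)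
  have hgc : IntegrableOn (fun t => inner ℝ (lpOf (volume.restrict Ω) (totalSource s K T Ω Φ F φ t))
      (lpOf _ ζ) - inner ℝ (pressurePair s K Ω Φ φ u t).2 (energyPair s K Ω ζ).2) (Ioo 0 T) :=
    (hsource.integrable_inner_lpOf (lpOf _ ζ)).sub
      ((hu.integrableOn_pressurePair_snd hK).inner_const (energyPair s K Ω ζ).2)
  rw [ae_restrict_iff' measurableSet_Ioo]
  filter_upwards [ae_eq_primitive_of_weak hT.le
    ((intervalIntegrable_iff_integrableOn_Ioo_of_le hT.le).2 huc)
    ((intervalIntegrable_iff_integrableOn_Ioo_of_le hT.le).2 hgc)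
    fun η hη hηc hηT => by
      simpa only [intervalIntegral.integral_of_le hT.le, integral_Ioc_eq_integral_Ioo]
        using hu.integral_mul_deriv_eq hΦ hn hs hs1 hΩ hK hF hφ hu₀ hζ hη hηc hηT] with t ht h0t
  rw [inner_sub_left, ht h0t, add_sub_cancel_left, intervalIntegral.integral_of_le h0t.1.le]

theorem IsWeakSolution.ae_integratedEquation (hu : IsWeakSolution s T Ω K Φ F φ u₀ u)
    (hΦ : IsPressureLaw Φ β) (hn : 1 ≤ n) (hT : 0 < T) (hs : 0 < s) (hs1 : s < 1)
    (hΩ : MeasurableSet Ω) (hK : IsKernel K) (hF : MemL2Cyl T Ω F) (hφ : MemCcExterior T Ω φ)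
    (hu₀ : MemLp u₀ 2 (volume.restrict Ω)) :
    ∀ᵐ t ∂(volume.restrict (Ioo 0 T)), IntegratedEquation (energySpace s K Ω)
      (pressurePair s K Ω Φ φ u) (fun t => lpOf _ (totalSource s K T Ω Φ F φ t)) (lpOf _ u₀) t
      (lpOf _ (u t)) := by
  have := secondCountableTopology_Lp ((volume : Measure (Rn n)).restrict Ω)
  have := secondCountableTopology_Lp (volume : Measure (Rn n × Rn n))
  have hf : IntegrableOn (fun t => lpOf (volume.restrict Ω) (totalSource s K T Ω Φ F φ t))
      (Ioo 0 T) :=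
    (memL2Cyl_totalSource hs hΩ hK hΦ.continuous hΦ.map_zero hF hφ).memLp_lpOf.integrable one_le_two
  have hw := hu.integrableOn_pressurePair_snd hK
  refine ae_forall_mem_closure (D := testSpace s K Ω) (P := fun t => {ψ : PairSpace Ω |
    inner ℝ (lpOf _ (u t) - lpOf _ u₀) ψ.1
      + inner ℝ (∫ τ in Ioc 0 t, (pressurePair s K Ω Φ φ u τ).2) ψ.2
      = inner ℝ (∫ τ in Ioc 0 t, lpOf _ (totalSource s K T Ω Φ F φ τ)) ψ.1})
    (fun t => isClosed_eq (by fun_prop) (by fun_prop)) fun ψ hψ => ?_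
  obtain ⟨ζ, hζ, rfl⟩ := (mem_testSpace hn hs hs1 hK).1 hψ
  filter_upwards [hu.ae_inner_sub_eq hΦ hn hT hs hs1 hΩ hK hF hφ hu₀ hζ,
    ae_restrict_mem measurableSet_Ioo] with t ht h0t
  have hft := hf.mono_set (Ioc_subset_Ioo_right h0t.2)
  have hwt := hw.mono_set (Ioc_subset_Ioo_right h0t.2)
  change _ + inner ℝ (∫ τ in Ioc 0 t, _) _ = inner ℝ (∫ τ in Ioc 0 t, _) _
  rw [inner_setIntegral hft, inner_setIntegral hwt]
  refine (congrArg (· + _) ht).trans ?_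
  rw [integral_sub (hft.inner_const _) (hwt.inner_const _), sub_add_cancel]
  rfl

theorem IsWeakSolution.exists_isEvolution (hu : IsWeakSolution s T Ω K Φ F φ u₀ u)
    (hΦ : IsPressureLaw Φ β) (hn : 1 ≤ n) (hT : 0 < T) (hs : 0 < s) (hs1 : s < 1)
    (hΩ : MeasurableSet Ω) (hK : IsKernel K) (hF : MemL2Cyl T Ω F) (hφ : MemCcExterior T Ω φ)
    (hu₀ : MemLp u₀ 2 (volume.restrict Ω)) :
    ∃ w f, IsEvolution (energySpace s K Ω) (superpose hΦ.isNonlinearity) T w f (lpOf _ u₀) ∧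
      (∀ᵐ t ∂(volume.restrict (Ioo 0 T)), superpose hΦ.isNonlinearity (w t).1 = lpOf _ (u t)) ∧
      ∀ᵐ t ∂(volume.restrict (Ioo 0 T)), f t = lpOf _ (totalSource s K T Ω Φ F φ t) := by
  have hβw := hu.ae_superpose_pressurePair (K := K) hΦ hΩ hφ
  obtain ⟨w, f, hev, hw, hf⟩ := exists_isEvolution_of_integrableOn
    (β := superpose hΦ.isNonlinearity) (hu.integrableOn_pressurePair_snd hK)
    ((memL2Cyl_totalSource hs hΩ hK hΦ.continuous hΦ.map_zero hF hφ).memLp_lpOf.integrable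
      one_le_two)
    (hu.exterior_value.2.mono fun t ht => ht.mem_energySpace hn hs hs1 hK)
    (by
      filter_upwards [hu.ae_integratedEquation hΦ hn hT hs hs1 hΩ hK hF hφ hu₀, hβw] with t ht hβt
      rwa [hβt])
  refine ⟨w, f, hev, ?_, hf⟩
  filter_upwards [hw, hβw] with t hwt hβt
  rw [hwt, hβt]

end Evolution

/-! ### Comparison of weak solutions -/

section Comparison

theorem posL1_lpOf_sub {α : Type*} [MeasurableSpace α] {μ : Measure α} {v w : α → ℝ}
    (hv : MemLp v 2 μ) (hw : MemLp w 2 μ) :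
    posL1 (lpOf μ v - lpOf μ w) = ∫⁻ x, ENNReal.ofReal (v x - w x) ∂μ := by
  rw [lpOf_sub hv hw]
  refine lintegral_congr_ae ?_
  filter_upwards [coeFn_lpOf (hv.sub hw)] with x hx
  exact congrArg ENNReal.ofReal hx

variable {n : ℕ} {Ω : Set (Rn n)}

theorem posPartInt_le_of_forall_isTest (hΩ : IsOpen Ω) (hΩb : Bornology.IsBounded Ω)
    {v w : Rn n → ℝ} (hv : MemLp v 2 (volume.restrict Ω)) (hw : MemLp w 2 (volume.restrict Ω))
    {M : ℝ≥0∞} (h : ∀ ζ, IsTest Ω ζ → (∀ x, ζ x ∈ Icc 0 1) →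
      ENNReal.ofReal (inner ℝ (lpOf (volume.restrict Ω) v - lpOf _ w) (lpOf _ ζ)) ≤ M) :
    posPartInt Ω v w ≤ M := by
  have := isFiniteMeasure_restrict hΩb
  set g := lpOf (volume.restrict Ω) v - lpOf _ w with hg
  rw [posPartInt, ← posL1_lpOf_sub hv hw, ← hg]
  refine setLIntegral_ofReal_le_of_forall_isTest hΩ hΩb (Lp.stronglyMeasurable g).measurable
    ((Lp.memLp g).integrable one_le_two) fun ζ hζ hζ01 => ?_
  refine le_of_eq_of_le (congrArg ENNReal.ofReal ?_) (h ζ hζ hζ01)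
  rw [inner_eq_integral]
  refine integral_congr_ae ?_
  filter_upwards [coeFn_lpOf (hζ.memLp.restrict Ω)] with x hx
  rw [hx]

variable {s T L : ℝ} {K : Rn n → Rn n → ℝ} {Φ β : ℝ → ℝ} {F₁ F₂ φ₁ φ₂ u₁ u₂ : ℝ → Rn n → ℝ}
  {v₁ v₂ : Rn n → ℝ}

theorem IsWeakSolution.ae_posPartInt_le (hu₁ : IsWeakSolution s T Ω K Φ F₁ φ₁ v₁ u₁)
    (hu₂ : IsWeakSolution s T Ω K Φ F₂ φ₂ v₂ u₂) (hΦ : IsPressureLaw Φ β) (hn : 1 ≤ n)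
    (hT : 0 < T) (hs : 0 < s) (hs1 : s < 1) (hΩ : IsOpen Ω) (hΩb : Bornology.IsBounded Ω)
    (hK : IsKernel K) (hL : ∀ x y, K x y ≤ L) (hF₁ : MemL2Cyl T Ω F₁) (hF₂ : MemL2Cyl T Ω F₂)
    (hφ₁ : MemCcExterior T Ω φ₁) (hφ₂ : MemCcExterior T Ω φ₂)
    (hv₁ : MemLp v₁ 2 (volume.restrict Ω)) (hv₂ : MemLp v₂ 2 (volume.restrict Ω)) :
    ∀ᵐ t₀ ∂(volume.restrict (Ioo 0 T)), posPartInt Ω (u₁ t₀) (u₂ t₀)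
      ≤ posPartIntCyl T Ω F₁ F₂ + posPartInt Ω v₁ v₂ + ENNReal.ofReal (2 * L)
        * exteriorPosPartInt s T Ω (fun t x => Φ (φ₁ t x)) (fun t x => Φ (φ₂ t x)) := by
  have := isFiniteMeasure_restrict hΩb
  have hΩm := hΩ.measurableSet
  obtain ⟨w₁, f₁, hw₁, hβw₁, hf₁⟩ := hu₁.exists_isEvolution hΦ hn hT hs hs1 hΩm hK hF₁ hφ₁ hv₁
  obtain ⟨w₂, f₂, hw₂, hβw₂, hf₂⟩ := hu₂.exists_isEvolution hΦ hn hT hs hs1 hΩm hK hF₂ hφ₂ hv₂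
  obtain ⟨C, hC⟩ := exists_poincare hn hs hs1 hK hΩm hΩb
  have hsource {F φ : ℝ → Rn n → ℝ} (hF : MemL2Cyl T Ω F) (hφ : MemCcExterior T Ω φ) :=
    (memL2Cyl_totalSource hs hΩm hK hΦ.continuous hΦ.map_zero hF hφ).ae_memLp
  have hsource_le : ∫⁻ τ in Ioo 0 T, posL1 (f₁ τ - f₂ τ) ≤ posPartIntCyl T Ω F₁ F₂
      + ENNReal.ofReal (2 * L)
        * exteriorPosPartInt s T Ω (fun t x => Φ (φ₁ t x)) (fun t x => Φ (φ₂ t x)) := by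
    refine le_of_eq_of_le (lintegral_congr_ae ?_) (posPartIntCyl_totalSource_le hs hΩm hK hL
      hΦ.continuous hΦ.map_zero hF₁ hF₂ hφ₁ hφ₂)
    filter_upwards [hf₁, hf₂, hsource hF₁ hφ₁, hsource hF₂ hφ₂] with t hf₁t hf₂t hs₁ hs₂
    rw [hf₁t, hf₂t, posL1_lpOf_sub hs₁ hs₂, posPartInt]
  filter_upwards [(isMarkov_energySpace hn hs hs1 hK).comparison isClosed_energySpace hC
    hΦ.isNonlinearity hT hw₁ hw₂, hβw₁, hβw₂, (hu₁.memL2Cyl hΦ hΩm hφ₁).ae_memLp,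
    (hu₂.memL2Cyl hΦ hΩm hφ₂).ae_memLp] with t hcomp hβt₁ hβt₂ hut₁ hut₂
  refine posPartInt_le_of_forall_isTest hΩ hΩb hut₁ hut₂ fun ζ hζ hζ01 => ?_
  have hζt := hcomp (energyPair s K Ω ζ) hζ.mem_energySpace
    ((coeFn_lpOf (hζ.memLp.restrict Ω)).mono fun x hx => hx ▸ hζ01 x)
  rw [hβt₁, hβt₂, posL1_lpOf_sub hv₁ hv₂] at hζt
  refine hζt.trans ((add_le_add le_rfl hsource_le).trans_eq ?_)
  rw [← add_assoc, add_comm (∫⁻ x in Ω, _), posPartInt]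

end Comparison

end NPME

theorem mainTheorem5_general (n : ℕ) (hn : 1 ≤ n) (Ω : Set (NPME.Rn n)) (hΩ : IsOpen Ω)
    (hΩb : Bornology.IsBounded Ω) (T s : ℝ) (hT : 0 < T) (hs : 0 < s) (hs1 : s < 1)
    (K : NPME.Rn n → NPME.Rn n → ℝ) (hK : NPME.IsKernel K) :
    ∃ C : ℝ, 0 < C ∧
      ∀ Φ β : ℝ → ℝ, NPME.IsPressureLaw Φ β →
      ∀ (F φ : Fin 2 → ℝ → NPME.Rn n → ℝ) (u₀ : Fin 2 → NPME.Rn n → ℝ)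
        (u : Fin 2 → ℝ → NPME.Rn n → ℝ),
      (∀ j, NPME.MemL2Cyl T Ω (F j)) →
      (∀ j, NPME.MemCcExterior T Ω (φ j)) →
      (∀ j, MemLp (u₀ j) 2 (volume.restrict Ω)) →
      (∀ j, NPME.IsWeakSolution s T Ω K Φ (F j) (φ j) (u₀ j) (u j)) →
      ∀ᵐ t₀ ∂(volume.restrict (Ioo 0 T)),
        NPME.posPartInt Ω (u 0 t₀) (u 1 t₀)
          ≤ ENNReal.ofReal C *
            (NPME.posPartIntCyl T Ω (F 0) (F 1) + NPME.posPartInt Ω (u₀ 0) (u₀ 1)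
              + NPME.exteriorPosPartInt s T Ω
                  (fun t x => Φ (φ 0 t x)) (fun t x => Φ (φ 1 t x))) := by
  obtain ⟨_, L, -, -, hKb⟩ := hK.elliptic
  refine ⟨max 1 (2 * L), lt_max_of_lt_left one_pos, fun Φ β hΦ F φ u₀ u hF hφ hu₀ hu => ?_⟩
  filter_upwards [(hu 0).ae_posPartInt_le (hu 1) hΦ hn hT hs hs1 hΩ hΩb hK
    (fun x y => (hKb x y).2) (hF 0) (hF 1) (hφ 0) (hφ 1) (hu₀ 0) (hu₀ 1)] with t₀ ht₀
  have hone : 1 ≤ ENNReal.ofReal (max 1 (2 * L)) := ENNReal.one_le_ofReal.2 (le_max_left _ _)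
  rw [mul_add (ENNReal.ofReal (max 1 (2 * L)))]
  exact ht₀.trans (add_le_add (le_mul_of_one_le_left' hone)
    (mul_le_mul_left (ENNReal.ofReal_le_ofReal (le_max_right _ _)) _))

theorem mainTheorem5 (n : ℕ) (hn : 1 ≤ n) (Ω : Set (NPME.Rn n)) (hΩ : NPME.IsBoundedLipschitz Ω)
    (T s m : ℝ) (hT : 0 < T) (hs : 0 < s) (hs1 : s < 1) (hm : 1 < m)
    (K : NPME.Rn n → NPME.Rn n → ℝ) (hK : NPME.IsKernel K) :
    ∃ C : ℝ, 0 < C ∧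
      -- the regularizations, the data and the solutions of the two problems
      ∀ (Φε : ℝ → ℝ → ℝ) (F φ : Fin 2 → ℝ → NPME.Rn n → ℝ) (u₀ : Fin 2 → NPME.Rn n → ℝ)
        (u : Fin 2 → ℝ → NPME.Rn n → ℝ),
      NPME.IsRegularization m Φε →
      (∀ j, NPME.IsAdmissibleData s T Ω (NPME.Phi m) (F j) (φ j) (u₀ j)) →
      (∀ j, NPME.IsWeakSolution s T Ω K (NPME.Phi m) (F j) (φ j) (u₀ j) (u j)) →
      -- the data and the solutions of the regularized problems
      (∃ (Fε φε : Fin 2 → ℝ → ℝ → NPME.Rn n → ℝ) (u₀ε : Fin 2 → ℝ → NPME.Rn n → ℝ)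
          (uε : Fin 2 → ℝ → ℝ → NPME.Rn n → ℝ),
        (∀ j, ∀ᶠ ε in 𝓝[>] (0 : ℝ),
          NPME.IsAdmissibleData s T Ω (Φε ε) (Fε j ε) (φε j ε) (u₀ε j ε)) ∧
        (∀ j, ∀ᶠ ε in 𝓝[>] (0 : ℝ), NPME.MemH1L2 T Ω (uε j ε) ∧ NPME.MemL2Hs s T (uε j ε)) ∧
        liminf (fun ε => NPME.posPartIntCyl T Ω (Fε 0 ε) (Fε 1 ε)) (𝓝[>] 0)
          ≤ NPME.posPartIntCyl T Ω (F 0) (F 1) ∧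
        liminf (fun ε => NPME.exteriorPosPartInt s T Ω
            (fun t x => Φε ε (φε 0 ε t x)) (fun t x => Φε ε (φε 1 ε t x))) (𝓝[>] 0)
          ≤ NPME.exteriorPosPartInt s T Ω
            (fun t x => NPME.Phi m (φ 0 t x)) (fun t x => NPME.Phi m (φ 1 t x)) ∧
        (∀ j, Tendsto (fun ε => ∫⁻ x in Ω, ‖u₀ε j ε x - u₀ j x‖ₑ) (𝓝[>] 0) (𝓝 0)) ∧
        (∀ j, NPME.TendstoWeakL1 T Ω (uε j) (u j)) ∧
        (∀ j, ∀ᶠ ε in 𝓝[>] (0 : ℝ),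
          NPME.IsWeakSolution s T Ω K (Φε ε) (Fε j ε) (φε j ε) (u₀ε j ε) (uε j ε))) →
      ∀ᵐ t₀ ∂(volume.restrict (Ioo 0 T)),
        NPME.posPartInt Ω (u 0 t₀) (u 1 t₀)
          ≤ ENNReal.ofReal C *
            (NPME.posPartIntCyl T Ω (F 0) (F 1) + NPME.posPartInt Ω (u₀ 0) (u₀ 1)
              + NPME.exteriorPosPartInt s T Ω
                  (fun t x => NPME.Phi m (φ 0 t x)) (fun t x => NPME.Phi m (φ 1 t x))) := by
  have := NPME.isFiniteMeasure_restrict hΩ.isBounded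
  obtain ⟨C, hC, h⟩ := mainTheorem5_general n hn Ω hΩ.isOpen hΩ.isBounded T s hT hs hs1 K hK
  exact ⟨C, hC, fun _ F φ u₀ u _ hd hu _ => h _ _ (NPME.isPressureLaw_Phi hm.le) F φ u₀ u
    (fun j => (hd j).source) (fun j => (hd j).ext_cont)
    (fun j => (hd j).init_bounded.mono_exponent le_top) hu⟩
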